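/- Let $m\ge 1$ and $r\ge 0$ be integers, $\mathbb T=(\mathbb C^*)^r$, $\mathbb L=\operatorname{Hom}(\mathbb C^*,\mathbb T)\cong\mathbb Z^r$, $\mathbb L^\vee=\operatorname{Hom}(\mathbb T,\mathbb C^*)$, let $D_1,\dots,D_m\in\mathbb L^\vee$ span $\mathbb L^\vee\otimes\mathbb R$, and let $\eta\in\mathbb L^\vee\otimes\mathbb R$. Put $\mathcal A=\{I\subset\{1,\dots,m\} : \eta\in\sum_{i\in I}\mathbb R_{>0}D_i\}$ and assume (A) $\{1,\dots,m\}\in\mathcal A$; (B) $\sum_{i\in I}\mathbb R D_i=\mathbb L^\vee\otimes\mathbb R$ for every $I\in\mathcal A$; (C) if $c_1,\dots,c_m\ge 0$ and $\sum_i c_iD_i=0$, then all $c_i=0$. Let $\mathbb T$ act on $\mathbb C^m$ through the characters $D_1,\dots,D_m$, let $\mathcal U_\eta=\mathbb C^m\setminus\bigcup_{I\notin\mathcal A}\{z : z_i=0 \text{ for } i\notin I\}$, and let $\mathcal X=[\mathcal U_\eta/\mathbb T]$ be the associated toric orbifold, of dimension $n=m-r$. The components of its inertia stack are the quotients $[\mathcal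 U_\eta^g/\mathbb T]$ for those $g\in\mathbb T$ whose fixed locus $\mathcal U_\eta^g=\{z\in\mathcal U_\eta : gz=z\}$ is non-empty, and the (even parity) orbifold cohomology is $$H^*_{\rm orb}(\mathcal X)=\bigoplus_{g\in\mathbb T,\ \mathcal U_\eta^g\ne\emptyset}\ \bigoplus_{k \text{ even}} H^k(\mathcal U_\eta^g/\mathbb T,\mathbb C),$$ where $\mathcal U_\eta^g/\mathbb T$ is the topological orbit space and $H^k$ is singular cohomology. Let $\mathbf N=\mathbb Z^m/\mathbb L$ be the cokernel of $(D_1,\dots,D_m)\colon\mathbb L\to\mathbb Z^m$, $\mathbf N_{\rm tor}$ its torsion subgroup, $\mathbf N_{\rm free}=\mathbf N/\mathbf N_{\rm tor}$, and $b_1,\dots,b_m\in\mathbf N$ the images of the standard basis vectors (also regarded as elements of $\mathbf N\otimes\mathbb R$). Let $\Sigma$ be the fan in $\mathbf N\otimes\mathbb R$ whose cones are $\sigma_I=\sum_{i\notin I}\mathbb R_{\ge 0}b_i$, $I\in\mathcal A$; the vectors of the stacky fan are the $b_i$ with $\{1,\dots,m\}\setminus\{i\}\in\mathcal A$. For an $n$-dimensional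 cone $\sigma$ of $\Sigma$ let $$\hat S(\sigma)=\Big\{\sum_{b_i\in\sigma}c_ib_i : c_i\in[0,1],\ \sum_{b_i\in\sigma}c_i\le 1\Big\},$$ the sums being over the vectors $b_i$ of the stacky fan that lie in $\sigma$. Let $\hat S$ be the convex hull of $b_1,\dots,b_m$ in $\mathbf N\otimes\mathbb R$, and let $\operatorname{Vol}$ be Lebesgue measure on $\mathbf N\otimes\mathbb R\cong\mathbb R^n$ in the coordinates of a $\mathbb Z$-basis of $\mathbf N_{\rm free}$. Put $\hat\rho=D_1+\dots+D_m$ and $\widetilde C_{\mathcal X}=\bigcap_{I\in\mathcal A}\big(\sum_{i\in I}\mathbb R_{>0}D_i\big)$. Assume that $\hat\rho$ lies in the closure of $\widetilde C_{\mathcal X}$. Then for every $n$-dimensional cone $\sigma$ of $\Sigma$ the vectors $b_i$ of the stacky fan that lie in $\sigma$ are linearly independent (so that $\hat S(\sigma)$ is a simplex), $\hat S$ is the union of the simplices $\hat S(\sigma)$ over all $n$-dimensional cones $\sigma$ of $\Sigma$, the space $H^*_{\rm orb}(\mathcal X)$ is finite-dimensional, and $$|\mathbf N_{\rm tor}|\cdot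 n!\cdot\operatorname{Vol}(\hat S)=\dim_{\mathbb C} H^*_{\rm orb}(\mathcal X).$$ -/

import Mathlib

open scoped TensorProduct Nat ENNReal

noncomputable section

/-! ### Singular cohomology with complex coefficients -/

/-- The singular chain complex of a topological space with coefficients in `ℂ`. -/
abbrev singChains (X : TopCat.{0}) : ChainComplex (ModuleCat.{0} ℂ) ℕ :=
  ((AlgebraicTopology.singularChainComplexFunctor (ModuleCat.{0} ℂ)).obj
    (ModuleCat.of ℂ ℂ)).obj X

/-- The transpose `Hom(C_i, ℂ) → Hom(C_j, ℂ)` of the differential `C_j → C_i` of the singular chain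
complex. It is the singular coboundary for `j = i + 1`, and it is zero for `j ≠ i + 1`. -/
def singCoboundary (X : TopCat.{0}) (i j : ℕ) :
    Module.Dual ℂ ((singChains X).X i) →ₗ[ℂ] Module.Dual ℂ ((singChains X).X j) :=
  ((singChains X).d j i).hom.dualMap

/-- The singular cohomology `H^k(X, ℂ)`: cocycles modulo coboundaries. For `k = 0` the map
`singCoboundary X (0 - 1) 0` is zero, so that `H^0` consists of the `0`-cocycles. -/
abbrev SingCohomology (X : TopCat.{0}) (k : ℕ) : Type :=
  ↥(LinearMap.ker (singCoboundary X k (k + 1))) ⧸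
    (LinearMap.range (singCoboundary X (k - 1) k)).submoduleOf
      (LinearMap.ker (singCoboundary X k (k + 1)))

/-! ### Toric orbifolds as quotients of `ℂ^m` by an algebraic torus -/

/-- The initial data of a toric orbifold: the torus is `𝕋 = (ℂˣ)^r`, so that
`𝕃 = Hom(ℂˣ, 𝕋) = ℤ^r` and `𝕃^∨ = Hom(𝕋, ℂˣ) = ℤ^r`. -/
structure ToricData (m r : ℕ) where
  /-- The characters `D_1, …, D_m ∈ 𝕃^∨`. -/
  D : Fin m → Fin r → ℤ
  /-- The stability vector `η ∈ 𝕃^∨ ⊗ ℝ`. -/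
  η : Fin r → ℝ
  /-- `D_1, …, D_m` span `𝕃^∨ ⊗ ℝ`. -/
  span_D : Submodule.span ℝ (Set.range fun (i : Fin m) (a : Fin r) => (D i a : ℝ)) = ⊤

namespace ToricData

variable {m r : ℕ} (X : ToricData m r)

/-- `D_i` as an element of `𝕃^∨ ⊗ ℝ = ℝ^r`. -/
def DR (i : Fin m) : Fin r → ℝ := fun a => (X.D i a : ℝ)

/-- The open cone `∑_{i ∈ I} ℝ_{>0} D_i`. -/
def posCone (I : Finset (Fin m)) : Set (Fin r → ℝ) :=
  {x | ∃ c : Fin m → ℝ, (∀ i ∈ I, 0 < c i) ∧ x = ∑ i ∈ I, c i • X.DR i}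

/-- The set `𝒜` of anticones. -/
def anticones : Set (Finset (Fin m)) := {I | X.η ∈ X.posCone I}

/-- Condition (A): `{1, …, m} ∈ 𝒜`. -/
def CondA : Prop := Finset.univ ∈ X.anticones

/-- Condition (B): `D_i`, `i ∈ I`, span `𝕃^∨ ⊗ ℝ` for every `I ∈ 𝒜`. -/
def CondB : Prop := ∀ I ∈ X.anticones, Submodule.span ℝ (X.DR '' (I : Set (Fin m))) = ⊤

/-- Condition (C): `∑ c_i D_i = 0` with all `c_i ≥ 0` only for `c = 0`. -/
def CondC : Prop := ∀ c : Fin m → ℝ, (∀ i, 0 ≤ c i) → ∑ i, c i • X.DR i = 0 → c = 0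

/-- The extended Kähler cone `⋂_{I ∈ 𝒜} ∑_{i ∈ I} ℝ_{>0} D_i`. -/
def extKahlerCone : Set (Fin r → ℝ) := ⋂ I ∈ X.anticones, X.posCone I

/-- The vector `D_1 + ⋯ + D_m`. -/
def rhoHat : Fin r → ℝ := ∑ i, X.DR i

/-! ### The lattice and the fan -/

/-- The map `(D_1, …, D_m) : 𝕃 → ℤ^m`. -/
def pairing : (Fin r → ℤ) →ₗ[ℤ] (Fin m → ℤ) := Matrix.mulVecLin (Matrix.of X.D)

/-- The finitely generated abelian group `N = ℤ^m / 𝕃`. -/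
abbrev N : Type := (Fin m → ℤ) ⧸ LinearMap.range X.pairing

/-- The torsion part of `N`. -/
abbrev Ntor : Submodule ℤ X.N := Submodule.torsion ℤ X.N

/-- The free part `N / N_tor`. -/
abbrev Nfree : Type := X.N ⧸ X.Ntor

/-- The real vector space `N ⊗ ℝ`. -/
abbrev NR : Type := ℝ ⊗[ℤ] X.N

/-- The images `b_i ∈ N` of the standard basis vectors of `ℤ^m`. -/
def b (i : Fin m) : X.N := Submodule.Quotient.mk (Pi.single i 1)

/-- `b_i` as an element of `N ⊗ ℝ`. -/
def bR (i : Fin m) : X.NR := (1 : ℝ) ⊗ₜ[ℤ] X.b i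

/-- The cone `σ_I = ∑_{i ∉ I} ℝ_{≥0} b_i`. -/
def cone (I : Finset (Fin m)) : Set X.NR :=
  {x | ∃ c : Fin m → ℝ, (∀ i, 0 ≤ c i) ∧ x = ∑ i ∈ Iᶜ, c i • X.bR i}

/-- The fan `Σ`. -/
def fan : Set (Set X.NR) := {σ | ∃ I ∈ X.anticones, σ = X.cone I}

/-- The maximal cones of the fan, i.e. those of dimension `n = m - r`. -/
def maxCones : Set (Set X.NR) :=
  {σ | σ ∈ X.fan ∧ Module.finrank ℝ (Submodule.span ℝ σ) = m - r}

/-- The indices `i` with `{1, …, m} \ {i} ∈ 𝒜` (numbered `1, …, m'` after renumbering): the `b_i`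
with these indices are the vectors of the stacky fan, which span the rays of `Σ`. -/
def rayIndices : Set (Fin m) := {i | Finset.univ.erase i ∈ X.anticones}

/-- The indices of the vectors of the stacky fan that lie in `σ`. -/
def gens (σ : Set X.NR) : Set (Fin m) := {i | i ∈ X.rayIndices ∧ X.bR i ∈ σ}

/-- The simplex `Ŝ(σ)` of all `∑_{b_i ∈ σ} c_i b_i` with `c_i ∈ [0,1]` and `∑ c_i ≤ 1`. -/
def simplex (σ : Set X.NR) : Set X.NR :=
  {x | ∃ c : Fin m → ℝ, (∀ i, c i ∈ Set.Icc (0 : ℝ) 1) ∧ (∀ i, i ∉ X.gens σ → c i = 0) ∧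
    ∑ i, c i ≤ 1 ∧ x = ∑ i, c i • X.bR i}

/-- The polytope `Ŝ`, the convex hull of `b_1, …, b_m` in `N ⊗ ℝ`. -/
def Shat : Set X.NR := convexHull ℝ (Set.range X.bR)

/-- The coordinates `N ⊗ ℝ → ℝ^n` given by a `ℤ`-basis of the free part of `N`. -/
def coords {n : ℕ} (e : Module.Basis (Fin n) ℤ X.Nfree) : X.NR →ₗ[ℝ] (Fin n → ℝ) :=
  LinearMap.liftBaseChange ℝ
    (LinearMap.pi fun j =>
      (Int.castAddHom ℝ).toIntLinearMap ∘ₗ e.coord j ∘ₗ X.Ntor.mkQ)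

/-- The volume on `N ⊗ ℝ`: Lebesgue measure in the coordinates of a `ℤ`-basis of the free part of
`N`. -/
def vol {n : ℕ} (e : Module.Basis (Fin n) ℤ X.Nfree) (S : Set X.NR) : ℝ≥0∞ :=
  MeasureTheory.volume (X.coords e '' S)

/-! ### The quotient, its inertia components, and the orbifold cohomology -/

/-- The homomorphism `𝕋 → (ℂˣ)^m` given by the characters `D_1, …, D_m`. -/
def torusHom : (Fin r → ℂˣ) →* (Fin m → ℂˣ) where
  toFun t i := ∏ a, t a ^ X.D i a
  map_one' := by funext i; simp
  map_mul' s t := by funext i; simp [mul_zpow, Finset.prod_mul_distrib]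

/-- The action of the torus on `ℂ^m`. -/
def act (t : Fin r → ℂˣ) (z : Fin m → ℂ) : Fin m → ℂ := fun i => (X.torusHom t i : ℂ) * z i

/-- The coordinate subspace `ℂ^I`. -/
def coordSubspace (I : Finset (Fin m)) : Set (Fin m → ℂ) := {z | ∀ i, i ∉ I → z i = 0}

/-- The stable locus `𝒰_η`; the toric orbifold is the quotient stack `[𝒰_η / 𝕋]`. -/
def stableLocus : Set (Fin m → ℂ) := (⋃ I ∈ X.anticonesᶜ, coordSubspace I)ᶜ

/-- The points of `𝒰_η` that are fixed by `g ∈ 𝕋`. -/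
def fixedLocus (g : Fin r → ℂˣ) : Set (Fin m → ℂ) := {z | z ∈ X.stableLocus ∧ X.act g z = z}

/-- Two points of `𝒰_η^g` are equivalent if they lie in the same orbit of the torus. -/
def orbitSetoid (g : Fin r → ℂˣ) : Setoid (X.fixedLocus g) where
  r z w := ∃ t : Fin r → ℂˣ, X.act t z.1 = w.1
  iseqv :=
    { refl := fun z => ⟨1, by funext i; simp [act]⟩
      symm := by
        rintro z w ⟨t, h⟩
        exact ⟨t⁻¹, by rw [← h]; funext i; simp [act]⟩
      trans := by
        rintro x y z ⟨s, h⟩ ⟨t, k⟩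
        exact ⟨t * s, by rw [← k, ← h]; funext i; simp [act, mul_assoc]⟩ }

/-- The index set of the components of the inertia stack. The objects of the inertia stack of
`[𝒰_η / 𝕋]` are the pairs `(z, g)` with `z ∈ 𝒰_η`, `g ∈ 𝕋`, `g z = z`; as `𝕋` is abelian, the
components are the quotients `[𝒰_η^g / 𝕋]` for the `g` that fix a point of `𝒰_η`. -/
def InertiaIndex : Type := {g : Fin r → ℂˣ // (X.fixedLocus g).Nonempty}

/-- The topological space `𝒰_η^g / 𝕋` underlying the component of the inertia stack with
stabilizer `g`, with the quotient of the usual topology. -/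
def inertiaSpace (g : X.InertiaIndex) : TopCat.{0} := TopCat.of (Quotient (X.orbitSetoid g.1))

/-- The (even parity) orbifold cohomology, without its grading: the direct sum of the
even-degree cohomology groups of all components of the inertia stack. -/
abbrev OrbCohomology : Type :=
  DirectSum (X.InertiaIndex × ℕ) fun p => SingCohomology (X.inertiaSpace p.1) (2 * p.2)

end ToricData

end

/-!
Both sides of the volume formula are equal to the sum of `|det (D_i)_{i ∈ I}|` over the minimal
anticones `I`, the anticones with `r` elements. These are the vertices of the polyhedron
`{c ≥ 0, ∑ c_i D_i = η}`, and `σ_I` runs through the maximal cones of the fan. A linear cost function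
`h` on the polyhedron has a reduced cost `h_l - D_l · u` at each vertex, and by the simplex method
(`exists_lower_vertex_iff`) a face containing a vertex contains one of lower cost exactly if it
contains an edge direction of negative reduced cost. This combinatorial fact is used on both sides.

*Cohomology.* The component of the inertia stack of `g ∈ 𝕋` is covered by the open charts of the
orbits that do not vanish in the coordinates of a vertex `I` fixed by `g`. Such a chart is the
quotient of a vector space by the finite stabilizer `G_I`, and it contracts to a point. Let the
charts be attached in the order of a cost that separates the vertices. By the simplex method, the
chart of `I` meets the union of the previous ones where some coordinate of negative reduced cost does
not vanish, which is homotopy equivalent to a finite quotient of an odd-dimensional sphere. So each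
chart after the first adds one class of positive even degree (`exists_betti`), and the total dimension
of the cohomology is the number of the vertices fixed by `g`. Summing over `g` gives
`∑_I |G_I|` (`rank_orbCohomology`), and `G_I` has order `|det (D_i)_{i ∈ I}|` (`CondB.card_charKer`).

The topology needed for this is developed for singular chains with complex coefficients which are
indexed by the number of vertices, so that the homology is reduced and the empty set is a sphere:
homotopy invariance, Mayer–Vietoris (`rank_H_union`, `HIso.union`), spheres (`rank_H_sphere`) and the
transfer for finite quotients (`HIso.of_finite_quotient`). The transfer is applied to the strata of the
orbit space, which are covered by tori; the quotients of spheres are obtained from them by gluing. The comparison with Mathlib's singular chain complex is `chainEquiv_d`, and cohomology is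
dual to homology by `nonempty_cohomology_equiv_dual`.

*Volume.* A point `∑ c_i b_i` of `Ŝ` lies in the maximal cone of the vertex `I` that minimizes the
cost `c`, because its coefficients there are the reduced costs `c_i - D_i · u ≥ 0`. Their sum is
`1 - ρ̂ · u`, and `ρ̂ · u ≥ 0` as `ρ̂` is a limit of non-negative combinations of `D_i`, `i ∈ I`. Hence
`Ŝ` is the union of the simplices `Ŝ(σ_I)` (`Shat_eq_iUnion_vertices`), which overlap in null sets. An
index computation in `N` identifies `|N_tor| n! Vol(Ŝ(σ_I))` with `|det (D_i)_{i ∈ I}|`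
(`CondB.card_torsion_mul`).
-/

noncomputable section

namespace AffChain

/-! ### Formal affine chains -/

/-- The free vector space on lists of `k` points of `E`: the formal affine `(k-1)`-simplices. -/
abbrev LC (k : ℕ) (E : Type*) : Type _ := (Fin k → E) →₀ ℂ

variable {E F : Type*} {k n : ℕ}

/-- The simplicial boundary of formal affine simplices; for one vertex it is the augmentation. -/
def d : LC (k + 1) E →ₗ[ℂ] LC k E :=
  Finsupp.linearCombination ℂ fun v =>
    ∑ i : Fin (k + 1), (-1 : ℂ) ^ (i : ℕ) • Finsupp.single (v ∘ i.succAbove) 1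

/-- The cone with apex `p`: adjoins `p` as first vertex. -/
def cone (p : E) : LC k E →ₗ[ℂ] LC (k + 1) E :=
  Finsupp.lmapDomain ℂ ℂ fun v => (Fin.cons p v : Fin (k + 1) → E)

/-- The map of formal simplices induced by a map of vertices. -/
def vmap (f : E → F) : LC k E →ₗ[ℂ] LC k F := Finsupp.lmapDomain ℂ ℂ fun v => f ∘ v

theorem d_single (v : Fin (k + 1) → E) : d (Finsupp.single v 1) =
    ∑ i : Fin (k + 1), (-1 : ℂ) ^ (i : ℕ) • Finsupp.single (v ∘ i.succAbove) 1 := by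
  simp [d]

@[simp] theorem cone_single (p : E) (v : Fin k → E) (a : ℂ) :
    cone p (Finsupp.single v a) = Finsupp.single (Fin.cons p v : Fin (k + 1) → E) a := by
  simp [cone, Finsupp.mapDomain_single]

@[simp] theorem vmap_single (f : E → F) (v : Fin k → E) (a : ℂ) :
    vmap f (Finsupp.single v a) = Finsupp.single (f ∘ v) a := by
  simp [vmap, Finsupp.mapDomain_single]

theorem lc_hom_ext {M : Type*} [AddCommGroup M] [Module ℂ M] {f g : LC k E →ₗ[ℂ] M}
    (h : ∀ v, f (Finsupp.single v 1) = g (Finsupp.single v 1)) : f = g := by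
  refine Finsupp.lhom_ext' fun v => LinearMap.ext_ring (by simpa using h v)

/-- Linear maps on formal simplices with at least one vertex are determined on cones. -/
theorem lc_hom_ext_cone {M : Type*} [AddCommGroup M] [Module ℂ M] {f g : LC (k + 1) E →ₗ[ℂ] M}
    (h : ∀ p v, f (cone p (Finsupp.single v 1)) = g (cone p (Finsupp.single v 1))) : f = g := by
  refine lc_hom_ext fun v => ?_
  have := h (v 0) (Fin.tail v)
  simpa only [cone_single, Fin.cons_self_tail] using this

theorem cons_comp_succAbove_zero (p : E) (v : Fin k → E) :
    (Fin.cons p v : Fin (k + 1) → E) ∘ (0 : Fin (k + 1)).succAbove = v := by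
  funext j; simp

theorem cons_comp_succAbove_succ (p : E) (v : Fin (k + 1) → E) (i : Fin (k + 1)) :
    (Fin.cons p v : Fin (k + 2) → E) ∘ i.succ.succAbove
      = (Fin.cons p (v ∘ i.succAbove) : Fin (k + 1) → E) := by
  funext j
  refine Fin.cases ?_ (fun j => ?_) j <;> simp

theorem d_cone (p : E) (c : LC (k + 1) E) : d (cone p c) = c - cone p (d c) := by
  have : d ∘ₗ cone p = LinearMap.id - cone p ∘ₗ (d : LC (k + 1) E →ₗ[ℂ] LC k E) := by
    refine lc_hom_ext fun v => ?_
    simp only [LinearMap.comp_apply, cone_single, d_single, LinearMap.sub_apply, LinearMap.id_apply]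
    rw [Fin.sum_univ_succ]
    simp only [cons_comp_succAbove_zero, cons_comp_succAbove_succ, map_sum, map_smul, cone_single]
    simp [pow_succ, sub_eq_add_neg]
  exact LinearMap.congr_fun this c

theorem d_cone_zero (p : E) (c : LC 0 E) : d (cone p c) = c := by
  have : d ∘ₗ cone p = (LinearMap.id : LC 0 E →ₗ[ℂ] LC 0 E) := by
    refine lc_hom_ext fun v => ?_
    simp only [LinearMap.comp_apply, cone_single, d_single, LinearMap.id_apply]
    simp
  exact LinearMap.congr_fun this c

theorem d_d (c : LC (k + 2) E) : d (d c) = 0 := by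
  have : d ∘ₗ d = (0 : LC (k + 2) E →ₗ[ℂ] LC k E) := by
    clear c
    induction k with
    | zero =>
      refine lc_hom_ext_cone fun p v => ?_
      simp only [LinearMap.comp_apply, d_cone, map_sub, d_cone_zero]
      simp
    | succ k ih =>
      refine lc_hom_ext_cone fun p v => ?_
      have := LinearMap.congr_fun ih (Finsupp.single v 1)
      simp only [LinearMap.comp_apply, LinearMap.zero_apply] at this ⊢
      simp only [d_cone, map_sub, this]
      simp
  exact LinearMap.congr_fun this c

theorem d_vmap (f : E → F) (c : LC (k + 1) E) : d (vmap f c) = vmap f (d c) := by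
  have : d ∘ₗ vmap f = vmap f ∘ₗ (d : LC (k + 1) E →ₗ[ℂ] LC k E) := by
    refine lc_hom_ext fun v => ?_
    simp [d_single, Function.comp_assoc]
  exact LinearMap.congr_fun this c

theorem vmap_cone (f : E → F) (p : E) (c : LC k E) :
    vmap f (cone p c) = cone (f p) (vmap f c) := by
  have : vmap f ∘ₗ cone p = cone (f p) ∘ₗ (vmap f : LC k E →ₗ[ℂ] LC k F) := by
    refine lc_hom_ext fun v => ?_
    simp only [LinearMap.comp_apply, cone_single, vmap_single, Fin.comp_cons]
  exact LinearMap.congr_fun this c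

/-! ### Subdivision of formal simplices -/

/-- Subdivision: the cone, with apex chosen by `b`, over the subdivided boundary. For the barycenter
`b` this is barycentric subdivision. -/
def sd (b : ∀ k, (Fin (k + 1) → E) → E) : ∀ k, LC k E →ₗ[ℂ] LC k E
  | 0 => LinearMap.id
  | k + 1 => Finsupp.linearCombination ℂ fun v => cone (b k v) (sd b k (d (Finsupp.single v 1)))

/-- The chain homotopy between the identity and subdivision, by the recursion dual to that of `sd`. -/
def sdHtpy (b : ∀ k, (Fin (k + 1) → E) → E) : ∀ k, LC k E →ₗ[ℂ] LC (k + 1) E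
  | 0 => 0
  | k + 1 => Finsupp.linearCombination ℂ fun v =>
      cone (b k v) (Finsupp.single v 1 - sdHtpy b k (d (Finsupp.single v 1)))

theorem sd_single (b : ∀ k, (Fin (k + 1) → E) → E) (v : Fin (k + 1) → E) :
    sd b (k + 1) (Finsupp.single v 1) = cone (b k v) (sd b k (d (Finsupp.single v 1))) := by
  simp [sd]

theorem sdHtpy_single (b : ∀ k, (Fin (k + 1) → E) → E) (v : Fin (k + 1) → E) :
    sdHtpy b (k + 1) (Finsupp.single v 1) =
      cone (b k v) (Finsupp.single v 1 - sdHtpy b k (d (Finsupp.single v 1))) := by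
  simp [sdHtpy]

theorem d_sd (b : ∀ k, (Fin (k + 1) → E) → E) (c : LC (k + 1) E) :
    d (sd b (k + 1) c) = sd b k (d c) := by
  have : d ∘ₗ sd b (k + 1) = sd b k ∘ₗ d := by
    clear c
    induction k with
    | zero =>
      refine lc_hom_ext fun v => ?_
      simp only [LinearMap.comp_apply, sd_single, d_cone_zero]
    | succ k ih =>
      refine lc_hom_ext fun v => ?_
      have := LinearMap.congr_fun ih (d (Finsupp.single v 1))
      simp only [LinearMap.comp_apply] at this ⊢
      rw [sd_single, d_cone, this, d_d]
      simp
  exact LinearMap.congr_fun this c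

theorem d_sdHtpy (b : ∀ k, (Fin (k + 1) → E) → E) (c : LC (k + 1) E) :
    d (sdHtpy b (k + 1) c) = c - sd b (k + 1) c - sdHtpy b k (d c) := by
  have : d ∘ₗ sdHtpy b (k + 1) = LinearMap.id - sd b (k + 1) - sdHtpy b k ∘ₗ d := by
    clear c
    induction k with
    | zero =>
      refine lc_hom_ext fun v => ?_
      simp only [LinearMap.comp_apply, LinearMap.sub_apply, LinearMap.id_apply, sd_single,
        sdHtpy_single, d_cone]
      simp [sdHtpy, sd]
    | succ k ih =>
      refine lc_hom_ext fun v => ?_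
      have := LinearMap.congr_fun ih (d (Finsupp.single v 1))
      simp only [LinearMap.comp_apply, LinearMap.sub_apply, LinearMap.id_apply] at this ⊢
      rw [sd_single, sdHtpy_single, d_cone, map_sub, this, d_d]
      simp only [map_zero, sub_zero, sub_sub_cancel]
      abel
  exact LinearMap.congr_fun this c

/-- Subdivision commutes with maps of the vertices that are compatible with the chosen apexes, such
as affine maps and barycenters. -/
theorem vmap_sd (b : ∀ k, (Fin (k + 1) → E) → E) (b' : ∀ k, (Fin (k + 1) → F) → F) (f : E → F)
    (h : ∀ k v, f (b k v) = b' k (f ∘ v)) (c : LC k E) :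
    vmap f (sd b k c) = sd b' k (vmap f c) := by
  have : vmap f ∘ₗ sd b k = sd b' k ∘ₗ vmap f := by
    clear c
    induction k with
    | zero => rfl
    | succ k ih =>
      refine lc_hom_ext fun v => ?_
      have := LinearMap.congr_fun ih (d (Finsupp.single v 1))
      simp only [LinearMap.comp_apply] at this ⊢
      rw [sd_single, vmap_cone, this, vmap_single, sd_single, ← d_vmap, vmap_single, h]
  exact LinearMap.congr_fun this c

theorem vmap_sdHtpy (b : ∀ k, (Fin (k + 1) → E) → E) (b' : ∀ k, (Fin (k + 1) → F) → F)
    (f : E → F) (h : ∀ k v, f (b k v) = b' k (f ∘ v)) (c : LC k E) :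
    vmap f (sdHtpy b k c) = sdHtpy b' k (vmap f c) := by
  have : vmap f ∘ₗ sdHtpy b k = sdHtpy b' k ∘ₗ vmap f := by
    clear c
    induction k with
    | zero => ext; simp [sdHtpy]
    | succ k ih =>
      refine lc_hom_ext fun v => ?_
      have := LinearMap.congr_fun ih (d (Finsupp.single v 1))
      simp only [LinearMap.comp_apply] at this ⊢
      rw [sdHtpy_single, vmap_cone, map_sub, this, vmap_single, sdHtpy_single, ← d_vmap,
        vmap_single, h]
  exact LinearMap.congr_fun this c

/-! ### The prism operator on formal simplices -/

/-- The prism over a formal simplex: a chain on the product of the vertices with `{0, 1}`, whose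
boundary is the top minus the bottom minus the prism over the boundary. -/
def prism (o l : F) : ∀ k, LC k E →ₗ[ℂ] LC (k + 1) (E × F)
  | 0 => 0
  | k + 1 => Finsupp.linearCombination ℂ fun v => cone (v 0, o)
      (Finsupp.single (fun i => (v i, l)) 1 - prism o l k (Finsupp.single (Fin.tail v) 1))

theorem prism_cone (o l : F) (p : E) (c : LC k E) :
    prism o l (k + 1) (cone p c) =
      cone (p, o) (cone (p, l) (vmap (fun x => (x, l)) c) - prism o l k c) := by
  have : prism o l (k + 1) ∘ₗ cone p =
      cone (p, o) ∘ₗ (cone (p, l) ∘ₗ vmap (fun x => (x, l)) - prism o l k) := by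
    refine lc_hom_ext fun v => ?_
    simp only [LinearMap.comp_apply, cone_single, LinearMap.sub_apply, vmap_single]
    rw [prism, Finsupp.linearCombination_single, one_smul, Fin.tail_cons, Fin.cons_zero]
    congr 3
    funext i
    refine Fin.cases ?_ (fun i => ?_) i <;> simp
  exact LinearMap.congr_fun this c

theorem d_prism (o l : F) (c : LC (k + 1) E) :
    d (prism o l (k + 1) c) =
      vmap (fun x => (x, l)) c - vmap (fun x => (x, o)) c - prism o l k (d c) := by
  have : d ∘ₗ prism o l (k + 1) =
      vmap (fun x => (x, l)) - vmap (fun x => (x, o)) -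
        prism o l k ∘ₗ (d : LC (k + 1) E →ₗ[ℂ] LC k E) := by
    clear c
    induction k with
    | zero =>
      refine lc_hom_ext_cone fun p v => ?_
      simp only [LinearMap.comp_apply, LinearMap.sub_apply, prism_cone, d_cone, d_cone_zero,
        vmap_cone, map_sub]
      simp only [prism, LinearMap.zero_apply, map_zero, sub_zero]
      congr 1
      simp only [vmap_single]
      congr 2
      exact Subsingleton.elim _ _
    | succ k ih =>
      refine lc_hom_ext_cone fun p v => ?_
      have := LinearMap.congr_fun ih (Finsupp.single v 1)
      simp only [LinearMap.comp_apply, LinearMap.sub_apply] at this ⊢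
      simp only [prism_cone, d_cone, map_sub, vmap_cone, this, d_vmap]
      abel
  exact LinearMap.congr_fun this c

theorem vmap_prism {E' : Type*} (o l : F) (f : E → E') (c : LC k E) :
    vmap (Prod.map f id) (prism o l k c) = prism o l k (vmap f c) := by
  have : vmap (Prod.map f id) ∘ₗ prism o l k = prism o l k ∘ₗ vmap f := by
    clear c
    induction k with
    | zero => ext; simp [prism]
    | succ k ih =>
      refine lc_hom_ext_cone fun p v => ?_
      have := LinearMap.congr_fun ih (Finsupp.single v 1)
      simp only [LinearMap.comp_apply] at this ⊢
      simp only [prism_cone, vmap_cone, map_sub, this, vmap_single]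
      rfl
  exact LinearMap.congr_fun this c

end AffChain

namespace SingChain
open AffChain

/-! ### Singular chains -/

/-- The standard simplex with `k` vertices, of dimension `k - 1`; it is empty for `k = 0`. -/
abbrev Splx (k : ℕ) : Type := stdSimplex ℝ (Fin k)

/-- Singular chains, indexed by the number of vertices. The empty simplex spans `Ch 0 X`, so that
this is the augmented singular chain complex and its homology is reduced. -/
abbrev Ch (k : ℕ) (X : Type*) [TopologicalSpace X] : Type _ := C(Splx k, X) →₀ ℂ

variable {X Y Z : Type*} [TopologicalSpace X] [TopologicalSpace Y] [TopologicalSpace Z] {k n j : ℕ}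

/-- The affine simplex with given vertices in a standard simplex. -/
def aff (v : Fin k → Splx n) : C(Splx k, Splx n) where
  toFun w := ⟨∑ i, w i • (v i).1,
    (convex_stdSimplex ℝ (Fin n)).sum_mem (fun i _ => stdSimplex.zero_le w i)
      (stdSimplex.sum_eq_one w) fun i _ => (v i).2⟩
  continuous_toFun := by
    refine Continuous.subtype_mk ?_ _
    refine continuous_finsetSum _ fun i _ => ?_
    have : Continuous fun w : Splx k => w i := (continuous_apply i).comp continuous_subtype_val
    exact this.smul continuous_const

theorem aff_val (v : Fin k → Splx n) (w : Splx k) : (aff v w).1 = ∑ i, w i • (v i).1 := rfl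

theorem aff_apply (v : Fin k → Splx n) (w : Splx k) (l : Fin n) :
    aff v w l = ∑ i, w i * v i l := by
  change (aff v w).1 l = _
  rw [aff_val, Finset.sum_apply]
  rfl

/-- The inclusion of the `i`-th face. -/
def face (i : Fin (k + 1)) : C(Splx k, Splx (k + 1)) :=
  ⟨stdSimplex.map i.succAbove, stdSimplex.continuous_map _⟩

theorem aff_comp (v : Fin k → Splx n) (u : Fin j → Splx k) :
    (aff v).comp (aff u) = aff (aff v ∘ u) := by
  ext1 w
  refine stdSimplex.ext (funext fun l => ?_)
  simp only [ContinuousMap.comp_apply, aff_apply, Function.comp, Finset.sum_mul, Finset.mul_sum]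
  rw [Finset.sum_comm]
  exact Finset.sum_congr rfl fun a _ => Finset.sum_congr rfl fun l _ => mul_assoc _ _ _

theorem aff_vertex_eq (f : Fin k → Fin n) (w : Splx k) :
    aff (fun i => stdSimplex.vertex (S := ℝ) (f i)) w = stdSimplex.map f w := by
  refine stdSimplex.ext (funext fun l => ?_)
  rw [aff_apply, stdSimplex.map_coe, FunOnFinite.linearMap_apply_apply, Finset.sum_filter]
  refine Finset.sum_congr rfl fun a _ => ?_
  rw [stdSimplex.vertex_coe, Pi.single_apply]
  split_ifs with h1 h2 h2 <;> simp_all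

theorem aff_vertex : aff (fun i : Fin k => stdSimplex.vertex (S := ℝ) i) = ContinuousMap.id _ := by
  ext1 w
  exact (aff_vertex_eq id w).trans (stdSimplex.map_id_apply w)

theorem aff_vertex_succAbove (i : Fin (k + 1)) :
    aff (fun l => stdSimplex.vertex (S := ℝ) (i.succAbove l)) = face i := by
  ext1 w
  exact aff_vertex_eq _ w

theorem aff_apply_vertex (v : Fin k → Splx n) (i : Fin k) :
    aff v (stdSimplex.vertex i) = v i := by
  refine stdSimplex.ext (funext fun l => ?_)
  rw [aff_apply, Finset.sum_eq_single i]
  · simp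
  · intro b _ hb
    simp [hb]
  · simp

theorem aff_comp_vertex (v : Fin k → Splx n) : (aff v ∘ fun i => stdSimplex.vertex i) = v :=
  funext (aff_apply_vertex v)

theorem aff_comp_face (v : Fin (k + 1) → Splx n) (i : Fin (k + 1)) :
    (aff v).comp (face i) = aff (v ∘ i.succAbove) := by
  rw [← aff_vertex_succAbove, aff_comp]
  congr 1
  funext l
  exact aff_apply_vertex v _

/-- The singular boundary. -/
def bd : Ch (k + 1) X →ₗ[ℂ] Ch k X :=
  Finsupp.linearCombination ℂ fun s =>
    ∑ i : Fin (k + 1), (-1 : ℂ) ^ (i : ℕ) • Finsupp.single (s.comp (face i)) 1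

/-- The chain map induced by a continuous map. -/
def push (f : C(X, Y)) : Ch k X →ₗ[ℂ] Ch k Y := Finsupp.lmapDomain ℂ ℂ fun s => f.comp s

theorem bd_single (s : C(Splx (k + 1), X)) : bd (Finsupp.single s 1) =
    ∑ i : Fin (k + 1), (-1 : ℂ) ^ (i : ℕ) • Finsupp.single (s.comp (face i)) 1 := by
  simp [bd]

@[simp] theorem push_single (f : C(X, Y)) (s : C(Splx k, X)) (a : ℂ) :
    push f (Finsupp.single s a) = Finsupp.single (f.comp s) a := by
  simp [push, Finsupp.mapDomain_single]

theorem ch_hom_ext {M : Type*} [AddCommGroup M] [Module ℂ M] {f g : Ch k X →ₗ[ℂ] M}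
    (h : ∀ s, f (Finsupp.single s 1) = g (Finsupp.single s 1)) : f = g := by
  refine Finsupp.lhom_ext' fun v => LinearMap.ext_ring (by simpa using h v)

theorem bd_push (f : C(X, Y)) (c : Ch (k + 1) X) : bd (push f c) = push f (bd c) := by
  have : bd ∘ₗ push f = push f ∘ₗ (bd : Ch (k + 1) X →ₗ[ℂ] Ch k X) := by
    refine ch_hom_ext fun s => ?_
    simp [bd_single, ContinuousMap.comp_assoc]
  exact LinearMap.congr_fun this c

theorem push_push (f : C(X, Y)) (g : C(Y, Z)) (c : Ch k X) :
    push g (push f c) = push (g.comp f) c := by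
  have : push g ∘ₗ push f = (push (g.comp f) : Ch k X →ₗ[ℂ] Ch k Z) := by
    refine ch_hom_ext fun s => ?_
    simp [ContinuousMap.comp_assoc]
  exact LinearMap.congr_fun this c

theorem push_id (c : Ch k X) : push (ContinuousMap.id X) c = c := by
  have : push (ContinuousMap.id X) = (LinearMap.id : Ch k X →ₗ[ℂ] Ch k X) := by
    refine ch_hom_ext fun s => ?_
    simp
  exact LinearMap.congr_fun this c

/-- The singular chain of a formal affine chain in a standard simplex. -/
def real : LC k (Splx n) →ₗ[ℂ] Ch k (Splx n) := Finsupp.lmapDomain ℂ ℂ aff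

@[simp] theorem real_single (v : Fin k → Splx n) (a : ℂ) :
    real (Finsupp.single v a) = Finsupp.single (aff v) a := by
  simp [real, Finsupp.mapDomain_single]

theorem bd_real (c : LC (k + 1) (Splx n)) : bd (real c) = real (d c) := by
  have : bd ∘ₗ real = real ∘ₗ (d : LC (k + 1) (Splx n) →ₗ[ℂ] LC k (Splx n)) := by
    refine lc_hom_ext fun s => ?_
    simp [bd_single, d_single, aff_comp_face]
  exact LinearMap.congr_fun this c

/-- The formal simplex on all the vertices of the standard simplex. -/
def iota (k : ℕ) : LC k (Splx k) := Finsupp.single (fun i => stdSimplex.vertex i) 1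

/-- The operator on singular chains given by a formal chain in the standard simplex. -/
def act (u : LC j (Splx k)) : Ch k X →ₗ[ℂ] Ch j X :=
  Finsupp.linearCombination ℂ fun s => push s (real u)

@[simp] theorem act_single (u : LC j (Splx k)) (s : C(Splx k, X)) :
    act u (Finsupp.single s 1) = push s (real u) := by simp [act]

theorem act_iota (c : Ch k X) : act (iota k) c = c := by
  have : act (iota k) = (LinearMap.id : Ch k X →ₗ[ℂ] Ch k X) := by
    refine ch_hom_ext fun s => ?_
    simp [iota, aff_vertex]
  exact LinearMap.congr_fun this c

theorem bd_act (u : LC (j + 1) (Splx k)) (c : Ch k X) : bd (act u c) = act (d u) c := by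
  have : bd ∘ₗ act u = (act (d u) : Ch k X →ₗ[ℂ] Ch j X) := by
    refine ch_hom_ext fun s => ?_
    simp [bd_push, bd_real]
  exact LinearMap.congr_fun this c

theorem act_sub (u u' : LC j (Splx k)) (c : Ch k X) : act (u - u') c = act u c - act u' c := by
  have : act (u - u') = (act u - act u' : Ch k X →ₗ[ℂ] Ch j X) := by
    refine ch_hom_ext fun s => ?_
    simp
  exact LinearMap.congr_fun this c

theorem act_zero (c : Ch k X) : act (0 : LC j (Splx k)) c = 0 := by
  simpa using act_sub (0 : LC j (Splx k)) 0 c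

theorem real_vmap_aff (v : Fin k → Splx n) (u : LC j (Splx k)) :
    real (vmap (aff v) u) = push (aff v) (real u) := by
  have : real ∘ₗ vmap (aff v) = push (aff v) ∘ₗ (real : LC j (Splx k) →ₗ[ℂ] Ch j (Splx k)) := by
    refine lc_hom_ext fun s => ?_
    simp [aff_comp]
  exact LinearMap.congr_fun this u

/-- Operators on formal chains which commute with affine maps of simplices give operators on
singular chains compatible with the boundary. -/
theorem act_natural (F : ∀ n, LC k (Splx n) →ₗ[ℂ] LC j (Splx n))
    (hF : ∀ n n' (v : Fin n → Splx n') c, vmap (aff v) (F n c) = F n' (vmap (aff v) c))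
    (c : Ch (k + 1) X) :
    act (F (k + 1) (d (iota (k + 1)))) c = act (F k (iota k)) (bd c) := by
  have : act (F (k + 1) (d (iota (k + 1)))) =
      act (F k (iota k)) ∘ₗ (bd : Ch (k + 1) X →ₗ[ℂ] Ch k X) := by
    refine ch_hom_ext fun s => ?_
    simp only [LinearMap.comp_apply, act_single, bd_single, iota, d_single, map_sum, map_smul]
    refine Finset.sum_congr rfl fun i _ => ?_
    congr 1
    rw [← push_push, ← aff_vertex_succAbove, ← real_vmap_aff, hF, vmap_single]
    rw [aff_comp_vertex]
    rfl
  exact LinearMap.congr_fun this c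

theorem bd_bd (c : Ch (k + 2) X) : bd (bd c) = 0 := by
  rw [← act_iota c, bd_act, bd_act, d_d, act_zero]

/-! ### Barycentric subdivision -/

/-- The barycenter of a tuple of points. -/
def bary (k : ℕ) (v : Fin (k + 1) → Splx n) : Splx n := aff v (stdSimplex.barycenter)

theorem aff_bary (v : Fin n → Splx j) (k : ℕ) (u : Fin (k + 1) → Splx n) :
    aff v (bary k u) = bary k (aff v ∘ u) := by
  rw [bary, bary, ← aff_comp]; rfl

/-- Barycentric subdivision of singular chains. -/
def sub (k : ℕ) : Ch k X →ₗ[ℂ] Ch k X := act (sd bary k (iota k))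

/-- The chain homotopy between the identity and barycentric subdivision. -/
def subHtpy (k : ℕ) : Ch k X →ₗ[ℂ] Ch (k + 1) X := act (sdHtpy bary k (iota k))

theorem bd_sub (c : Ch (k + 1) X) : bd (sub (k + 1) c) = sub k (bd c) := by
  rw [sub, bd_act, d_sd]
  exact act_natural (fun n => sd bary k) (fun n n' v c => vmap_sd _ _ _ (aff_bary v) c) c

theorem bd_subHtpy (c : Ch (k + 1) X) :
    bd (subHtpy (k + 1) c) = c - sub (k + 1) c - subHtpy k (bd c) := by
  rw [subHtpy, bd_act, d_sdHtpy, act_sub, act_sub, act_iota]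
  congr 1
  exact act_natural (fun n => sdHtpy bary k) (fun n n' v c => vmap_sdHtpy _ _ _ (aff_bary v) c) c

theorem sub_push (f : C(X, Y)) (c : Ch k X) : sub k (push f c) = push f (sub k c) := by
  have : sub k ∘ₗ push f = push f ∘ₗ (sub k : Ch k X →ₗ[ℂ] Ch k X) := by
    refine ch_hom_ext fun s => ?_
    simp [sub, push_push]
  exact LinearMap.congr_fun this c

theorem sub_real (u : LC k (Splx n)) : sub k (real u) = real (sd bary k u) := by
  have : sub k ∘ₗ real = real ∘ₗ (sd bary k : LC k (Splx n) →ₗ[ℂ] _) := by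
    refine lc_hom_ext fun v => ?_
    simp only [LinearMap.comp_apply, real_single, sub, act_single]
    rw [← real_vmap_aff, vmap_sd _ _ _ (aff_bary v), iota, vmap_single,
      aff_comp_vertex]
  exact LinearMap.congr_fun this u

/-! ### The prism operator -/

/-- The affine simplex with given vertices in a product of standard simplices. -/
def aff₂ (v : Fin k → Splx n × Splx j) : C(Splx k, Splx n × Splx j) :=
  (aff (Prod.fst ∘ v)).prodMk (aff (Prod.snd ∘ v))

/-- The singular chain of a formal affine chain in a product of standard simplices. -/
def real₂ : LC k (Splx n × Splx j) →ₗ[ℂ] Ch k (Splx n × Splx j) := Finsupp.lmapDomain ℂ ℂ aff₂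

@[simp] theorem real₂_single (v : Fin k → Splx n × Splx j) (a : ℂ) :
    real₂ (Finsupp.single v a) = Finsupp.single (aff₂ v) a := by
  simp [real₂, Finsupp.mapDomain_single]

theorem bd_real₂ (c : LC (k + 1) (Splx n × Splx j)) : bd (real₂ c) = real₂ (d c) := by
  have : bd ∘ₗ real₂ = real₂ ∘ₗ (d : LC (k + 1) (Splx n × Splx j) →ₗ[ℂ] _) := by
    refine lc_hom_ext fun s => ?_
    simp only [LinearMap.comp_apply, real₂_single, bd_single, d_single, map_sum, map_smul]
    refine Finset.sum_congr rfl fun i _ => ?_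
    congr 2
    ext1 w
    exact Prod.ext (congrArg (fun f => f w) (aff_comp_face (Prod.fst ∘ s) i))
      (congrArg (fun f => f w) (aff_comp_face (Prod.snd ∘ s) i))
  exact LinearMap.congr_fun this c

theorem real₂_vmap (v : Fin k → Splx n) (u : LC j (Splx k × Splx 2)) :
    real₂ (vmap (Prod.map (aff v) id) u) =
      push ((aff v).prodMap (ContinuousMap.id _)) (real₂ u) := by
  have : real₂ ∘ₗ vmap (Prod.map (aff v) id) =
      push ((aff v).prodMap (ContinuousMap.id (Splx 2))) ∘ₗ
        (real₂ : LC j (Splx k × Splx 2) →ₗ[ℂ] _) := by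
    refine lc_hom_ext fun s => ?_
    simp only [LinearMap.comp_apply, real₂_single, vmap_single, push_single]
    congr 1
    ext1 w
    refine Prod.ext ?_ rfl
    exact (congrArg (fun f => f w) (aff_comp v (Prod.fst ∘ s))).symm
  exact LinearMap.congr_fun this u

/-- The formal prism over the standard simplex. -/
def prismIota (k : ℕ) : LC (k + 1) (Splx k × Splx 2) :=
  prism (stdSimplex.vertex 0) (stdSimplex.vertex 1) k (iota k)

/-- The prism operator on singular chains. -/
def pr (k : ℕ) : Ch k X →ₗ[ℂ] Ch (k + 1) (X × Splx 2) :=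
  Finsupp.linearCombination ℂ fun s =>
    push (s.prodMap (ContinuousMap.id _)) (real₂ (prismIota k))

/-- The inclusion of `X` in `X × Splx 2` at an end point. -/
def level (i : Fin 2) : C(X, X × Splx 2) :=
  (ContinuousMap.id X).prodMk (ContinuousMap.const X (stdSimplex.vertex i))

theorem aff_const (p : Splx n) : aff (fun _ : Fin k => p) = ContinuousMap.const _ p := by
  ext1 w
  refine stdSimplex.ext (funext fun l => ?_)
  rw [aff_apply, ← Finset.sum_mul, stdSimplex.sum_eq_one, one_mul]; rfl

theorem bd_pr (c : Ch (k + 1) X) :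
    bd (pr (k + 1) c) = push (level 1) c - push (level 0) c - pr k (bd c) := by
  have : bd ∘ₗ pr (k + 1) = push (level 1) - push (level 0) -
      pr k ∘ₗ (bd : Ch (k + 1) X →ₗ[ℂ] Ch k X) := by
    refine ch_hom_ext fun s => ?_
    have hlev : ∀ i : Fin 2, push (s.prodMap (ContinuousMap.id _))
        (real₂ (vmap (fun x => (x, stdSimplex.vertex i)) (iota (k + 1)))) =
        push (level i) (Finsupp.single s 1) := by
      intro i
      rw [iota, vmap_single, real₂_single, push_single, push_single]
      congr 1
      ext1 w
      refine Prod.ext ?_ ?_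
      · change s (aff (fun i : Fin (k + 1) => stdSimplex.vertex (S := ℝ) i) w) = s w
        rw [aff_vertex]; rfl
      · change aff (fun _ : Fin (k + 1) => stdSimplex.vertex (S := ℝ) i) w = stdSimplex.vertex i
        rw [aff_const]; rfl
    simp only [LinearMap.comp_apply, LinearMap.sub_apply]
    rw [pr, Finsupp.linearCombination_single, one_smul, bd_push, bd_real₂, prismIota, d_prism,
      map_sub, map_sub, map_sub, map_sub, hlev, hlev]
    congr 1
    simp only [bd_single, iota, d_single, map_sum, map_smul]
    refine Finset.sum_congr rfl fun i _ => ?_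
    congr 1
    rw [pr, Finsupp.linearCombination_single, one_smul]
    have : (s.comp (face i)).prodMap (ContinuousMap.id (Splx 2)) =
        (s.prodMap (ContinuousMap.id _)).comp ((face i).prodMap (ContinuousMap.id _)) := rfl
    rw [this, ← push_push, ← aff_vertex_succAbove, ← real₂_vmap, prismIota, vmap_prism, iota,
      vmap_single]
    rw [aff_comp_vertex]
    rfl
  exact LinearMap.congr_fun this c

theorem pr_zero (c : Ch 0 X) : pr 0 c = 0 := by
  have : pr 0 = (0 : Ch 0 X →ₗ[ℂ] _) := by
    refine ch_hom_ext fun s => ?_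
    simp [pr, prismIota, prism]
  exact LinearMap.congr_fun this c

end SingChain

namespace SingChain
open AffChain

variable {X Y W : Type} [TopologicalSpace X] [TopologicalSpace Y] [TopologicalSpace W] {k n j : ℕ}

/-! ### Homology of subsets -/

/-- The singular chains of the subset `A` of `X`, as a space of chains of `X`. -/
def ChS (k : ℕ) (A : Set X) : Submodule ℂ (Ch k X) :=
  Finsupp.supported ℂ ℂ {s : C(Splx k, X) | ∀ w, s w ∈ A}

/-- The cycles of the subset `A` in the augmented complex. In the lowest place, spanned by the empty
simplex, every chain is a cycle. -/
def Z : ∀ (k : ℕ) (_ : Set X), Submodule ℂ (Ch k X)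
  | 0, A => ChS 0 A
  | k + 1, A => ChS (k + 1) A ⊓ LinearMap.ker bd

/-- The boundaries of the subset `A`. -/
def B (k : ℕ) (A : Set X) : Submodule ℂ (Ch k X) := (ChS (k + 1) A).map bd

/-- The reduced singular homology of the subset `A`, in degree `k - 1`. -/
abbrev H (k : ℕ) (A : Set X) : Type := ↥((Z k A).map (B k A).mkQ)

theorem supported_map_mem {α M : Type*} [AddCommGroup M] [Module ℂ M] (f : (α →₀ ℂ) →ₗ[ℂ] M)
    {S : Set α} {p : Submodule ℂ M} (h : ∀ s ∈ S, f (Finsupp.single s 1) ∈ p) {c : α →₀ ℂ}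
    (hc : c ∈ Finsupp.supported ℂ ℂ S) : f c ∈ p := by
  have : Finsupp.supported ℂ ℂ S ≤ p.comap f := by
    rw [Finsupp.supported_eq_span_single, Submodule.span_le]
    rintro _ ⟨s, hs, rfl⟩
    exact h s hs
  exact this hc

theorem single_mem_ChS {A : Set X} {s : C(Splx k, X)} (h : ∀ w, s w ∈ A) (a : ℂ) :
    Finsupp.single s a ∈ ChS k A := Finsupp.single_mem_supported ℂ a h

theorem map_mem_of_single {M : Type*} [AddCommGroup M] [Module ℂ M] (f : Ch k X →ₗ[ℂ] M)
    {A : Set X} {p : Submodule ℂ M}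
    (h : ∀ s : C(Splx k, X), (∀ w, s w ∈ A) → f (Finsupp.single s 1) ∈ p) {c : Ch k X}
    (hc : c ∈ ChS k A) : f c ∈ p :=
  supported_map_mem f h hc

theorem ChS_mono {A A' : Set X} (h : A ⊆ A') : ChS k A ≤ ChS k A' :=
  Finsupp.supported_mono fun _ hs w => h (hs w)

theorem mem_ChS_inter {A A' : Set X} {c : Ch k X} (h : c ∈ ChS k A) (h' : c ∈ ChS k A') :
    c ∈ ChS k (A ∩ A') := by
  rw [ChS, Finsupp.mem_supported] at *
  exact fun s hs w => ⟨h hs w, h' hs w⟩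

theorem mem_ChS_univ (c : Ch k X) : c ∈ ChS k (Set.univ : Set X) := by
  rw [ChS, Finsupp.mem_supported]
  exact fun s hs w => trivial

theorem mem_ChS_zero (A : Set X) (c : Ch 0 X) : c ∈ ChS 0 A := by
  rw [ChS, Finsupp.mem_supported]
  intro s _ w
  exact absurd (stdSimplex.sum_eq_one w) (by simp)

theorem bd_mem {A : Set X} {c : Ch (k + 1) X} (h : c ∈ ChS (k + 1) A) : bd c ∈ ChS k A := by
  refine map_mem_of_single bd (fun s hs => ?_) h
  rw [bd_single]
  exact Submodule.sum_mem _ fun i _ =>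
    Submodule.smul_mem _ _ (single_mem_ChS (s := s.comp (face i)) (fun w => hs (face i w)) _)

theorem push_mem {f : C(X, Y)} {A : Set X} {A' : Set Y} (hf : Set.MapsTo f A A') {c : Ch k X}
    (h : c ∈ ChS k A) : push f c ∈ ChS k A' := by
  refine map_mem_of_single (push f) (fun s hs => ?_) h
  rw [push_single]
  exact single_mem_ChS (fun w => hf (hs w)) _

theorem act_mem (u : LC j (Splx k)) {A : Set X} {c : Ch k X}
    (h : c ∈ ChS k A) : act u c ∈ ChS j A := by
  refine map_mem_of_single (act u) (fun s hs => ?_) h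
  rw [act_single]
  exact push_mem (A := Set.univ) (fun w _ => hs w) (mem_ChS_univ _)

theorem pr_mem {A : Set X} {c : Ch k X} (h : c ∈ ChS k A) :
    pr k c ∈ ChS (k + 1) (A ×ˢ (Set.univ : Set (Splx 2))) := by
  refine map_mem_of_single (pr k) (fun s hs => ?_) h
  rw [pr, Finsupp.linearCombination_single, one_smul]
  refine push_mem (A := Set.univ) (fun w _ => ?_) (mem_ChS_univ _)
  exact ⟨hs w.1, Set.mem_univ _⟩

theorem Z_le (A : Set X) : Z k A ≤ ChS k A := by
  cases k with
  | zero => exact le_rfl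
  | succ k => exact inf_le_left

theorem mem_Z_succ {A : Set X} {c : Ch (k + 1) X} :
    c ∈ Z (k + 1) A ↔ c ∈ ChS (k + 1) A ∧ bd c = 0 := Iff.rfl

theorem mem_B {A : Set X} {c : Ch k X} : c ∈ B k A ↔ ∃ w ∈ ChS (k + 1) A, bd w = c := Iff.rfl

theorem B_le_Z (A : Set X) : B k A ≤ Z k A := by
  rintro _ ⟨w, hw, rfl⟩
  cases k with
  | zero => exact bd_mem hw
  | succ k => exact mem_Z_succ.2 ⟨bd_mem hw, bd_bd w⟩

theorem Z_mono {A A' : Set X} (h : A ⊆ A') : Z k A ≤ Z k A' := by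
  cases k with
  | zero => exact ChS_mono h
  | succ k => exact inf_le_inf_right _ (ChS_mono h)

theorem B_mono {A A' : Set X} (h : A ⊆ A') : B k A ≤ B k A' := Submodule.map_mono (ChS_mono h)

theorem push_Z {f : C(X, Y)} {A : Set X} {A' : Set Y} (hf : Set.MapsTo f A A') {c : Ch k X}
    (h : c ∈ Z k A) : push f c ∈ Z k A' := by
  cases k with
  | zero => exact push_mem hf h
  | succ k => exact mem_Z_succ.2 ⟨push_mem hf h.1, by
      rw [bd_push, (mem_Z_succ.1 h).2, map_zero]⟩

theorem push_B {f : C(X, Y)} {A : Set X} {A' : Set Y} (hf : Set.MapsTo f A A') {c : Ch k X}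
    (h : c ∈ B k A) : push f c ∈ B k A' := by
  obtain ⟨w, hw, rfl⟩ := h
  exact ⟨push f w, push_mem hf hw, bd_push f w⟩

/-! ### Homology isomorphisms and homotopy invariance -/

/-- The map `f` induces an isomorphism from the homology of `A` to the homology of `A'`. This is
stated on cycles and boundaries, which avoids quotients in the diagram chases. -/
structure HIso (f : C(X, Y)) (A : Set X) (A' : Set Y) : Prop where
  mapsTo : Set.MapsTo f A A'
  inj : ∀ k, ∀ z ∈ Z k A, push f z ∈ B k A' → z ∈ B k A
  surj : ∀ k, ∀ w ∈ Z k A', ∃ z ∈ Z k A, w - push f z ∈ B k A'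

theorem HIso.comp {f : C(X, Y)} {g : C(Y, W)} {A : Set X} {A' : Set Y} {A'' : Set W}
    (hg : HIso g A' A'') (hf : HIso f A A') : HIso (g.comp f) A A'' where
  mapsTo := hg.mapsTo.comp hf.mapsTo
  inj k z hz h := hf.inj k z hz (hg.inj k _ (push_Z hf.mapsTo hz) (by rwa [push_push]))
  surj k w hw := by
    obtain ⟨y, hy, hy'⟩ := hg.surj k w hw
    obtain ⟨z, hz, hz'⟩ := hf.surj k y hy
    refine ⟨z, hz, ?_⟩
    have := Submodule.add_mem _ hy' (push_B hg.mapsTo hz')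
    rwa [map_sub, push_push, sub_add_sub_cancel] at this

theorem HIso.of_comp_right {f : C(X, Y)} {g : C(Y, W)} {A : Set X} {A' : Set Y} {A'' : Set W}
    (h : HIso (g.comp f) A A'') (hf : HIso f A A') (hg : Set.MapsTo g A' A'') :
    HIso g A' A'' where
  mapsTo := hg
  inj k y hy h' := by
    obtain ⟨z, hz, hz'⟩ := hf.surj k y hy
    have h1 := push_B hg hz'
    rw [map_sub, push_push] at h1
    have h2 := h.inj k z hz (by simpa using Submodule.sub_mem _ h' h1)
    have h3 := Submodule.add_mem _ hz' (push_B hf.mapsTo h2)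
    simpa using h3
  surj k w hw := by
    obtain ⟨z, hz, hz'⟩ := h.surj k w hw
    exact ⟨push f z, push_Z hf.mapsTo hz, by rwa [push_push]⟩

/-- The end point map from the `1`-simplex to the unit interval. -/
def toInterval : C(Splx 2, unitInterval) :=
  ⟨stdSimplexHomeomorphUnitInterval, stdSimplexHomeomorphUnitInterval.continuous⟩

/-- Homotopic maps agree on homology. -/
theorem push_sub_push_mem_B (F : C(X × unitInterval, Y)) {f g : C(X, Y)}
    (h0 : ∀ x, F (x, 0) = f x) (h1 : ∀ x, F (x, 1) = g x) {A : Set X} {A' : Set Y}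
    (hF : ∀ x ∈ A, ∀ t, F (x, t) ∈ A') {z : Ch k X} (hz : z ∈ Z k A) :
    push g z - push f z ∈ B k A' := by
  let G : C(X × Splx 2, Y) := F.comp ((ContinuousMap.id X).prodMap toInterval)
  have e0 : G.comp (level 0) = f := by
    ext1 x
    rw [← h0]
    exact congrArg (fun t => F (x, t)) stdSimplexHomeomorphUnitInterval_zero
  have e1 : G.comp (level 1) = g := by
    ext1 x
    rw [← h1]
    exact congrArg (fun t => F (x, t)) stdSimplexHomeomorphUnitInterval_one
  have hG : Set.MapsTo G (A ×ˢ (Set.univ : Set (Splx 2))) A' :=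
    fun x hx => hF x.1 hx.1 (toInterval x.2)
  refine mem_B.2 ⟨push G (pr k z), push_mem hG (pr_mem (Z_le A hz)), ?_⟩
  cases k with
  | zero =>
    have : push g = (push f : Ch 0 X →ₗ[ℂ] Ch 0 Y) := by
      refine ch_hom_ext fun s => ?_
      rw [push_single, push_single]
      congr 1
      ext1 w
      exact absurd (stdSimplex.sum_eq_one w) (by simp)
    rw [pr_zero, map_zero, map_zero, this, sub_self]
  | succ k =>
    rw [bd_push, bd_pr, (mem_Z_succ.1 hz).2, map_zero, sub_zero, map_sub, push_push, push_push, e0,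
      e1]

/-- A deformation of `A` into `A₀` which preserves `A₀` shows that the inclusion is an isomorphism
on homology. -/
theorem HIso.of_deformation (F : C(X × unitInterval, X)) (h0 : ∀ x, F (x, 0) = x) {A₀ A : Set X}
    (hs : A₀ ⊆ A) (hA : ∀ x ∈ A, ∀ t, F (x, t) ∈ A) (hA₀ : ∀ x ∈ A₀, ∀ t, F (x, t) ∈ A₀)
    (h1 : ∀ x ∈ A, F (x, 1) ∈ A₀) : HIso (ContinuousMap.id X) A₀ A := by
  let g : C(X, X) := F.comp ((ContinuousMap.id X).prodMk (ContinuousMap.const X 1))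
  have hg : Set.MapsTo g A A₀ := fun x hx => h1 x hx
  refine ⟨hs, fun k z hz h => ?_, fun k w hw => ?_⟩
  · rw [push_id] at h
    have e := push_sub_push_mem_B F (f := ContinuousMap.id X) (g := g) h0 (fun _ => rfl) hA₀ hz
    rw [push_id] at e
    simpa using Submodule.sub_mem _ (push_B hg h) e
  · have e := push_sub_push_mem_B F (f := ContinuousMap.id X) (g := g) h0 (fun _ => rfl) hA hw
    refine ⟨push g w, push_Z hg hw, ?_⟩
    rw [push_id] at e ⊢
    simpa using Submodule.neg_mem _ e

/-- The reduced homology of `A` vanishes. -/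
def Acyclic (A : Set X) : Prop := ∀ k, Z k A ≤ B k A

theorem acyclic_singleton (x : X) : Acyclic ({x} : Set X) := by
  have key : ∀ k, ∀ c ∈ ChS k ({x} : Set X), ∃ a : ℂ,
      c = Finsupp.single (ContinuousMap.const _ x) a := by
    intro k c hc
    refine ⟨c (ContinuousMap.const _ x), ?_⟩
    refine (Finsupp.eq_single_iff.2 ⟨fun s hs => ?_, rfl⟩)
    rw [ChS, Finsupp.mem_supported] at hc
    rw [Finset.mem_singleton]
    ext1 w
    exact hc hs w
  have hbd : ∀ k, ∀ a : ℂ, bd (Finsupp.single (ContinuousMap.const (Splx (k + 1)) x) a) =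
      (if Even (k + 1) then (0 : ℂ) else 1) • Finsupp.single (ContinuousMap.const (Splx k) x) a := by
    intro k a
    have : Finsupp.single (ContinuousMap.const (Splx (k + 1)) x) a =
      a • Finsupp.single (ContinuousMap.const (Splx (k + 1)) x) 1 := by simp
    rw [this, map_smul, bd_single]
    have h2 : ∀ i : Fin (k + 1), (ContinuousMap.const (Splx (k + 1)) x).comp (face i) =
      ContinuousMap.const _ x := fun i => rfl
    simp only [h2, ← Finset.sum_smul]
    rw [Fin.sum_univ_eq_sum_range (fun i => (-1 : ℂ) ^ i) (k + 1), neg_one_geom_sum]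
    rw [smul_comm]
    simp
  intro k z hz
  obtain ⟨a, rfl⟩ := key k z (Z_le _ hz)
  by_cases hk : Even k
  · refine ⟨Finsupp.single (ContinuousMap.const _ x) a, single_mem_ChS (fun w => rfl) _, ?_⟩
    rw [hbd, if_neg (by simpa [Nat.even_add_one] using hk), one_smul]
  · cases k with
    | zero => exact absurd Even.zero hk
    | succ k =>
      have h := (mem_Z_succ.1 hz).2
      rw [hbd, if_neg hk, one_smul, Finsupp.single_eq_zero] at h
      rw [h]; simp

theorem Acyclic.of_hIso {f : C(X, Y)} {A : Set X} {A' : Set Y} (h : HIso f A A')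
    (hA : Acyclic A) : Acyclic A' := by
  intro k w hw
  obtain ⟨z, hz, hz'⟩ := h.surj k w hw
  simpa using Submodule.add_mem _ hz' (push_B h.mapsTo (hA k hz))

/-- A set which contracts to one of its points is acyclic. -/
theorem Acyclic.of_contraction (F : C(X × unitInterval, X)) (h0 : ∀ x, F (x, 0) = x) {A : Set X}
    {a : X} (ha : a ∈ A) (hA : ∀ x ∈ A, ∀ t, F (x, t) ∈ A) (hFa : ∀ t, F (a, t) = a)
    (h1 : ∀ x ∈ A, F (x, 1) = a) : Acyclic A :=
  Acyclic.of_hIso (HIso.of_deformation F h0 (Set.singleton_subset_iff.2 ha) hA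
    (by rintro x rfl t; exact hFa t) h1) (acyclic_singleton a)

/-! ### Small chains -/

theorem dist_aff_le {v : Fin k → Splx n} {p : Splx n} {r : ℝ} (h : ∀ i, dist (v i) p ≤ r)
    (w : Splx k) : dist (aff v w) p ≤ r := by
  have := (convex_closedBall (p.1) r).sum_mem (t := Finset.univ) (w := fun i => w i)
    (z := fun i => (v i).1) (fun i _ => stdSimplex.zero_le w i) (stdSimplex.sum_eq_one w)
    (fun i _ => h i)
  exact this

/-- The barycenter of `k + 1` points of mutual distance at most `r` has distance at most `(1 - 1 /
(k + 1)) r` from each of them. -/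
theorem dist_bary_le {v : Fin (k + 1) → Splx n} {r : ℝ} (h : ∀ i l, dist (v i) (v l) ≤ r)
    (l : Fin (k + 1)) : dist (v l) (bary k v) ≤ (1 - 1 / ((k + 1 : ℕ) : ℝ)) * r := by
  have hk : (0 : ℝ) < ((k + 1 : ℕ) : ℝ) := by positivity
  have e : (v l).1 - (bary k v).1 =
      ∑ i ∈ Finset.univ.erase l, (1 / ((k + 1 : ℕ) : ℝ)) • ((v l).1 - (v i).1) := by
    rw [Finset.sum_erase _ (by simp), bary, aff_val]
    simp only [smul_sub, Finset.sum_sub_distrib, Finset.sum_const,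
      Finset.card_univ, Fintype.card_fin, ← Nat.cast_smul_eq_nsmul ℝ, smul_smul]
    rw [mul_one_div_cancel hk.ne', one_smul]
    congr 1
    refine Finset.sum_congr rfl fun i _ => ?_
    change ((Fintype.card (Fin (k + 1)) : ℝ)⁻¹) • _ = _
    rw [Fintype.card_fin, one_div]
  rw [Subtype.dist_eq, dist_eq_norm]
  change ‖(v l).1 - (bary k v).1‖ ≤ _
  rw [e]
  refine (norm_sum_le _ _).trans ?_
  refine (Finset.sum_le_card_nsmul _ _ ((1 / ((k + 1 : ℕ) : ℝ)) * r) fun i _ => ?_).trans ?_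
  · rw [norm_smul, Real.norm_of_nonneg (by positivity)]
    refine mul_le_mul_of_nonneg_left ?_ (by positivity)
    have := h l i
    rwa [Subtype.dist_eq, dist_eq_norm] at this
  · rw [Finset.card_erase_of_mem (Finset.mem_univ _), Finset.card_univ, Fintype.card_fin,
      nsmul_eq_mul, Nat.add_sub_cancel]
    refine le_of_eq ?_
    field_simp
    push_cast
    ring

/-- The simplices of the barycentric subdivision stay in the convex hull of the vertices, and their
mesh is smaller by the factor `1 - 1 / k`. -/
theorem sd_bary_mem (v : Fin k → Splx n) : sd bary k (Finsupp.single v 1) ∈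
    Finsupp.supported ℂ ℂ {u : Fin k → Splx n |
      (∀ p r, (∀ i, dist (v i) p ≤ r) → ∀ i, dist (u i) p ≤ r) ∧
      ∀ r, (∀ i l, dist (v i) (v l) ≤ r) → ∀ i l, dist (u i) (u l) ≤ (1 - 1 / (k : ℝ)) * r} := by
  induction k with
  | zero => exact Finsupp.single_mem_supported ℂ _ ⟨fun _ _ _ i => i.elim0, fun _ _ i => i.elim0⟩
  | succ k ih =>
    rw [sd_single, d_single, map_sum, map_sum]
    refine Submodule.sum_mem _ fun i _ => ?_
    rw [map_smul, map_smul]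
    refine Submodule.smul_mem _ _ ?_
    have := ih (v ∘ i.succAbove)
    have hc : ∀ c ∈ Finsupp.supported ℂ ℂ {u : Fin k → Splx n |
      (∀ p r, (∀ l, dist ((v ∘ i.succAbove) l) p ≤ r) → ∀ l, dist (u l) p ≤ r) ∧
      ∀ r, (∀ a l, dist ((v ∘ i.succAbove) a) ((v ∘ i.succAbove) l) ≤ r) →
        ∀ a l, dist (u a) (u l) ≤ (1 - 1 / (k : ℝ)) * r},
        cone (bary k v) c ∈ Finsupp.supported ℂ ℂ {u : Fin (k + 1) → Splx n |
      (∀ p r, (∀ i, dist (v i) p ≤ r) → ∀ i, dist (u i) p ≤ r) ∧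
      ∀ r, (∀ i l, dist (v i) (v l) ≤ r) →
        ∀ i l, dist (u i) (u l) ≤ (1 - 1 / ((k + 1 : ℕ) : ℝ)) * r} := by
      intro c hc
      refine supported_map_mem _ ?_ hc
      rintro u ⟨hu1, hu2⟩
      rw [cone_single]
      refine Finsupp.single_mem_supported ℂ _ ⟨fun p r h l => ?_, fun r h => ?_⟩
      · refine Fin.cases ?_ (fun l => ?_) l
        · rw [Fin.cons_zero]
          exact dist_aff_le h _
        · rw [Fin.cons_succ]
          exact hu1 p r (fun l => h _) l
      · have hb : ∀ l, dist (u l) (bary k v) ≤ (1 - 1 / ((k + 1 : ℕ) : ℝ)) * r :=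
          hu1 _ _ fun l => dist_bary_le h _
        have hr : 0 ≤ r := by simpa using h 0 0
        have h1 : 1 / ((k + 1 : ℕ) : ℝ) ≤ 1 := by
          rw [div_le_one (by positivity)]; push_cast; linarith [Nat.cast_nonneg (α := ℝ) k]
        intro a l
        refine Fin.cases ?_ (fun a => ?_) a <;> refine Fin.cases ?_ (fun l => ?_) l
        · simp only [Fin.cons_zero, dist_self]
          exact mul_nonneg (by linarith) hr
        · simp only [Fin.cons_zero, Fin.cons_succ]
          rw [dist_comm]; exact hb l
        · simp only [Fin.cons_zero, Fin.cons_succ]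
          exact hb a
        · simp only [Fin.cons_succ]
          refine (hu2 r (fun _ _ => h _ _) a l).trans (mul_le_mul_of_nonneg_right ?_ hr)
          have hk : (0 : ℝ) < k := Nat.cast_pos.2 (Fin.pos a)
          have : 1 / ((k + 1 : ℕ) : ℝ) ≤ 1 / (k : ℝ) :=
            one_div_le_one_div_of_le hk (by push_cast; linarith)
          linarith
    exact hc _ this

/-- The mesh of iterated barycentric subdivisions tends to zero. -/
theorem sd_bary_iterate_mem (v : Fin k → Splx n) {r : ℝ} (h : ∀ i l, dist (v i) (v l) ≤ r)
    (N : ℕ) : ((sd bary k)^[N]) (Finsupp.single v 1) ∈ Finsupp.supported ℂ ℂ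
      {u : Fin k → Splx n | ∀ i l, dist (u i) (u l) ≤ (1 - 1 / (k : ℝ)) ^ N * r} := by
  induction N with
  | zero => exact Finsupp.single_mem_supported ℂ _ (by simpa using h)
  | succ N ih =>
    rw [Function.iterate_succ_apply']
    refine supported_map_mem (sd bary k) (fun u hu => ?_) ih
    refine Finsupp.supported_mono ?_ (sd_bary_mem u)
    intro u' hu' i l
    have := hu'.2 _ hu i l
    rw [pow_succ', mul_assoc]
    exact this

/-- Sums of a chain of `A` and a chain of `A'`. -/
def Small (k : ℕ) (A A' : Set X) : Submodule ℂ (Ch k X) := ChS k A ⊔ ChS k A'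

theorem sub_iterate_push_real (s : C(Splx n, X)) (u : LC k (Splx n)) (N : ℕ) :
    (sub k)^[N] (push s (real u)) = push s (real ((sd bary k)^[N] u)) := by
  induction N with
  | zero => rfl
  | succ N ih =>
    simp only [Function.iterate_succ_apply', ih, sub_push, sub_real]

theorem sub_mem_Small {A A' : Set X} {c : Ch k X} (h : c ∈ Small k A A') :
    sub k c ∈ Small k A A' := by
  obtain ⟨a, ha, b, hb, rfl⟩ := Submodule.mem_sup.1 h
  rw [map_add]
  exact Submodule.add_mem_sup (act_mem _ ha) (act_mem _ hb)

theorem sub_iterate_mem_Small {A A' : Set X} {c : Ch k X} (h : c ∈ Small k A A') (N : ℕ) :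
    (sub k)^[N] c ∈ Small k A A' := by
  induction N with
  | zero => exact h
  | succ N ih => rw [Function.iterate_succ_apply']; exact sub_mem_Small ih

/-- The sets `A` and `A'` are open in their union. -/
def RelOpen (A A' : Set X) : Prop :=
  ∃ U V : Set X, IsOpen U ∧ IsOpen V ∧ A = U ∩ (A ∪ A') ∧ A' = V ∩ (A ∪ A')

/-- By the Lebesgue number lemma, sufficiently fine subdivisions of a singular simplex are small
with respect to two relatively open sets. -/
theorem exists_sub_iterate_single_mem {A A' : Set X} (ho : RelOpen A A') (s : C(Splx k, X))
    (hs : ∀ w, s w ∈ A ∪ A') : ∃ N, (sub k)^[N] (Finsupp.single s 1) ∈ Small k A A' := by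
  obtain ⟨U, V, hU, hV, hA, hA'⟩ := ho
  obtain ⟨δ, hδ, hL⟩ := lebesgue_number_lemma_of_metric (s := (Set.univ : Set (Splx k)))
    (c := fun b : Bool => if b then s ⁻¹' U else s ⁻¹' V) isCompact_univ
    (by intro b; cases b <;> simp [hU.preimage s.continuous, hV.preimage s.continuous])
    (by
      intro w _
      rcases hs w with h | h
      · rw [hA] at h; exact Set.mem_iUnion.2 ⟨true, by simpa using h.1⟩
      · rw [hA'] at h; exact Set.mem_iUnion.2 ⟨false, by simpa using h.1⟩)
  obtain ⟨r, hr⟩ : ∃ r : ℝ, ∀ i l : Fin k,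
      dist (stdSimplex.vertex (S := ℝ) i) (stdSimplex.vertex l) ≤ r :=
    ⟨Metric.diam (Set.univ : Set (Splx k)), fun i l =>
      Metric.dist_le_diam_of_mem isCompact_univ.isBounded trivial trivial⟩
  obtain ⟨N, hN⟩ : ∃ N : ℕ, k ≠ 0 → (1 - 1 / (k : ℝ)) ^ N * r < δ := by
    by_cases hk : k = 0
    · exact ⟨0, fun h => absurd hk h⟩
    have hk' : (1 : ℝ) ≤ k := by exact_mod_cast Nat.one_le_iff_ne_zero.2 hk
    have h1 : 0 < 1 / (k : ℝ) := by positivity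
    have h2 : 1 / (k : ℝ) ≤ 1 := by rw [div_le_one (by linarith)]; exact hk'
    have ht := (tendsto_pow_atTop_nhds_zero_of_lt_one (r := 1 - 1 / (k : ℝ)) (by linarith)
      (by linarith)).mul_const r
    rw [zero_mul] at ht
    obtain ⟨N, hN⟩ := (ht.eventually (gt_mem_nhds hδ)).exists
    exact ⟨N, fun _ => hN⟩
  refine ⟨N, ?_⟩
  have e : Finsupp.single s (1 : ℂ) = push s (real (iota k)) := by
    rw [← act_single, act_iota]
  rw [e, sub_iterate_push_real]
  have hm := sd_bary_iterate_mem (fun i : Fin k => stdSimplex.vertex (S := ℝ) i) hr N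
  refine supported_map_mem (push s ∘ₗ real) (fun u hu => ?_) hm
  rw [LinearMap.comp_apply, real_single, push_single]
  by_cases hk : k = 0
  · subst hk
    exact Submodule.mem_sup_left (mem_ChS_zero _ _)
  · let i0 : Fin k := ⟨0, Nat.pos_of_ne_zero hk⟩
    obtain ⟨b, hb⟩ := hL (u i0) trivial
    have hball : ∀ w, aff u w ∈ (if b then s ⁻¹' U else s ⁻¹' V) := fun w =>
      hb (lt_of_le_of_lt (dist_aff_le (fun i => hu i i0) w) (hN hk))
    cases b with
    | true =>
      refine Submodule.mem_sup_left (single_mem_ChS (fun w => ?_) _)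
      rw [hA]
      exact ⟨by simpa using hball w, hs _⟩
    | false =>
      refine Submodule.mem_sup_right (single_mem_ChS (fun w => ?_) _)
      rw [hA']
      exact ⟨by simpa using hball w, hs _⟩

theorem exists_sub_iterate_mem {A A' : Set X} (ho : RelOpen A A') {c : Ch k X}
    (hc : c ∈ ChS k (A ∪ A')) : ∃ N, (sub k)^[N] c ∈ Small k A A' := by
  have hlin : ∀ N c, ((sub k : Ch k X →ₗ[ℂ] Ch k X) ^ N : Ch k X →ₗ[ℂ] Ch k X) c =
      (sub k)^[N] c := fun N c => Module.End.pow_apply _ _ _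
  rw [ChS, Finsupp.supported_eq_span_single] at hc
  induction hc using Submodule.span_induction with
  | mem x hx =>
    obtain ⟨s, hs, rfl⟩ := hx
    exact exists_sub_iterate_single_mem ho s hs
  | zero => exact ⟨0, Submodule.zero_mem _⟩
  | add x y _ _ hx hy =>
    obtain ⟨N, hN⟩ := hx
    obtain ⟨M, hM⟩ := hy
    refine ⟨N + M, ?_⟩
    rw [← hlin, map_add, hlin, hlin]
    refine Submodule.add_mem _ ?_ ?_
    · rw [add_comm, Function.iterate_add_apply]; exact sub_iterate_mem_Small hN M
    · rw [Function.iterate_add_apply]; exact sub_iterate_mem_Small hM N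
  | smul a x _ hx =>
    obtain ⟨N, hN⟩ := hx
    refine ⟨N, ?_⟩
    rw [← hlin, map_smul, hlin]
    exact Submodule.smul_mem _ _ hN

theorem sub_zero_apply (c : Ch 0 X) : sub 0 c = c := act_iota c

theorem sub_iterate_Z {A : Set X} {z : Ch k X} (hz : z ∈ Z k A) (N : ℕ) :
    (sub k)^[N] z ∈ Z k A ∧ z - (sub k)^[N] z ∈ B k A := by
  induction N with
  | zero => exact ⟨hz, by simp⟩
  | succ N ih =>
    rw [Function.iterate_succ_apply']
    set y := (sub k)^[N] z with hy
    have h1 : y - sub k y ∈ B k A := by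
      cases k with
      | zero => rw [sub_zero_apply]; simp
      | succ k =>
        refine ⟨subHtpy (k + 1) y, act_mem _ ih.1.1, ?_⟩
        rw [bd_subHtpy, (mem_Z_succ.1 ih.1).2, map_zero, sub_zero]
    have h2 : sub k y ∈ Z k A := by
      have := Submodule.sub_mem _ ih.1 (B_le_Z A h1)
      rwa [sub_sub_cancel] at this
    exact ⟨h2, by simpa using Submodule.add_mem _ ih.2 h1⟩

/-- Every cycle of a union of two relatively open sets is homologous to a sum of chains of the two
sets. -/
theorem exists_small_cycle {A A' : Set X} (ho : RelOpen A A') {z : Ch k X}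
    (hz : z ∈ Z k (A ∪ A')) : ∃ a ∈ ChS k A, ∃ b ∈ ChS k A',
      a + b ∈ Z k (A ∪ A') ∧ z - (a + b) ∈ B k (A ∪ A') := by
  obtain ⟨N, hN⟩ := exists_sub_iterate_mem ho (Z_le _ hz)
  obtain ⟨a, ha, b, hb, hab⟩ := Submodule.mem_sup.1 hN
  obtain ⟨h1, h2⟩ := sub_iterate_Z hz N
  exact ⟨a, ha, b, hb, hab ▸ h1, hab ▸ h2⟩

/-- If a sum of chains of two relatively open sets is a boundary in the union, then it is the
boundary of a sum of chains of the two sets. -/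
theorem exists_small_bd {A A' : Set X} (ho : RelOpen A A') {a b : Ch k X} (ha : a ∈ ChS k A)
    (hb : b ∈ ChS k A') (h : a + b ∈ B k (A ∪ A')) :
    ∃ a' ∈ ChS (k + 1) A, ∃ b' ∈ ChS (k + 1) A', bd (a' + b') = a + b := by
  obtain ⟨w, hw, hwab⟩ := h
  obtain ⟨N, hN⟩ := exists_sub_iterate_mem ho hw
  have hbd : ∀ N, bd ((sub (k + 1))^[N] w) = (sub k)^[N] (a + b) := by
    intro N
    induction N with
    | zero => exact hwab
    | succ N ih => rw [Function.iterate_succ_apply', bd_sub, ih, Function.iterate_succ_apply']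
  have key : ∀ N, ∃ c ∈ Small (k + 1) A A', bd w - bd ((sub (k + 1))^[N] w) = bd c := by
    intro N
    induction N with
    | zero => exact ⟨0, Submodule.zero_mem _, by simp⟩
    | succ N ih =>
      obtain ⟨c, hc, hc'⟩ := ih
      have hs : (sub k)^[N] (a + b) ∈ Small k A A' :=
        sub_iterate_mem_Small (Submodule.add_mem_sup ha hb) N
      obtain ⟨a1, ha1, b1, hb1, hab1⟩ := Submodule.mem_sup.1 hs
      refine ⟨c + subHtpy k ((sub k)^[N] (a + b)), Submodule.add_mem _ hc ?_, ?_⟩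
      · rw [← hab1, map_add]
        exact Submodule.add_mem_sup (act_mem _ ha1) (act_mem _ hb1)
      · have h3 := congrArg bd (bd_subHtpy ((sub (k + 1))^[N] w))
        rw [bd_bd, map_sub, map_sub, hbd N] at h3
        rw [map_add, ← hc', Function.iterate_succ_apply', hbd N]
        have h4 := sub_eq_zero.1 h3.symm
        rw [← h4]
        abel
  obtain ⟨c, hc, hc'⟩ := key N
  obtain ⟨a', ha', b', hb', hab'⟩ := Submodule.mem_sup.1 (Submodule.add_mem _ hc hN)
  refine ⟨a', ha', b', hb', ?_⟩
  rw [hab', map_add, ← hc', ← hwab]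
  abel

end SingChain

namespace SingChain
open AffChain

/-! ### Dimensions of subquotients -/

section Subquotient
variable {V W : Type} [AddCommGroup V] [Module ℂ V] [AddCommGroup W] [Module ℂ W]

/-- A linear relation which is total on both sides and matches the subspaces `V₀` and `W₀` induces
an isomorphism of the subquotients `V₁ / V₀` and `W₁ / W₀`. -/
theorem nonempty_equiv_of_rel (V₁ V₀ : Submodule ℂ V) (W₁ W₀ : Submodule ℂ W)
    (R : Submodule ℂ (V × W)) (h1 : ∀ v ∈ V₁, ∃ w ∈ W₁, (v, w) ∈ R)
    (h2 : ∀ w ∈ W₁, ∃ v ∈ V₁, (v, w) ∈ R)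
    (h3 : ∀ v ∈ V₁, ∀ w ∈ W₁, (v, w) ∈ R → (v ∈ V₀ ↔ w ∈ W₀)) :
    Nonempty (↥(V₁.map V₀.mkQ) ≃ₗ[ℂ] ↥(W₁.map W₀.mkQ)) := by
  let M : Submodule ℂ (V × W) := R ⊓ V₁.prod W₁
  let f : M →ₗ[ℂ] V ⧸ V₀ := V₀.mkQ ∘ₗ LinearMap.fst ℂ V W ∘ₗ M.subtype
  let g : M →ₗ[ℂ] W ⧸ W₀ := W₀.mkQ ∘ₗ LinearMap.snd ℂ V W ∘ₗ M.subtype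
  have hf : LinearMap.range f = V₁.map V₀.mkQ := by
    ext x
    constructor
    · rintro ⟨⟨⟨v, w⟩, hR, hv, hw⟩, rfl⟩
      exact ⟨v, hv, rfl⟩
    · rintro ⟨v, hv, rfl⟩
      obtain ⟨w, hw, hR⟩ := h1 v hv
      exact ⟨⟨(v, w), hR, hv, hw⟩, rfl⟩
  have hg : LinearMap.range g = W₁.map W₀.mkQ := by
    ext x
    constructor
    · rintro ⟨⟨⟨v, w⟩, hR, hv, hw⟩, rfl⟩
      exact ⟨w, hw, rfl⟩
    · rintro ⟨w, hw, rfl⟩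
      obtain ⟨v, hv, hR⟩ := h2 w hw
      exact ⟨⟨(v, w), hR, hv, hw⟩, rfl⟩
  have hk : LinearMap.ker f = LinearMap.ker g := by
    ext ⟨⟨v, w⟩, hR, hv, hw⟩
    simp only [f, g, LinearMap.mem_ker, LinearMap.comp_apply, Submodule.subtype_apply,
      LinearMap.fst_apply, LinearMap.snd_apply, Submodule.mkQ_apply, Submodule.Quotient.mk_eq_zero]
    exact h3 v hv w hw hR
  exact ⟨(LinearEquiv.ofEq _ _ hf.symm).trans (f.quotKerEquivRange.symm.trans
    ((Submodule.quotEquivOfEq _ _ hk).trans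
      (g.quotKerEquivRange.trans (LinearEquiv.ofEq _ _ hg))))⟩

/-- Dimensions of subquotients add up along `V₀ ≤ U ≤ V₁`. -/
theorem rank_subquotient_add (V₁ U V₀ : Submodule ℂ V) (h : V₀ ≤ U) (h' : U ≤ V₁) :
    Module.rank ℂ ↥(V₁.map V₀.mkQ) =
      Module.rank ℂ ↥(V₁.map U.mkQ) + Module.rank ℂ ↥(U.map V₀.mkQ) := by
  let p : (V ⧸ V₀) →ₗ[ℂ] V ⧸ U := Submodule.factor h
  let f : ↥(V₁.map V₀.mkQ) →ₗ[ℂ] V ⧸ U := p ∘ₗ Submodule.subtype _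
  have hr : LinearMap.range f = V₁.map U.mkQ := by
    rw [LinearMap.range_comp, Submodule.range_subtype, ← Submodule.map_comp]
    congr 1
  have hk : (LinearMap.ker f).map (Submodule.subtype _) = U.map V₀.mkQ := by
    ext x
    constructor
    · rintro ⟨⟨_, v, hv, rfl⟩, hx, rfl⟩
      refine ⟨v, ?_, rfl⟩
      exact (Submodule.Quotient.mk_eq_zero U).1 hx
    · rintro ⟨v, hv, rfl⟩
      exact ⟨⟨_, v, h' hv, rfl⟩, (Submodule.Quotient.mk_eq_zero U).2 hv, rfl⟩
  rw [← LinearMap.rank_range_add_rank_ker f, hr, ← hk]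
  congr 1
  exact (LinearEquiv.rank_eq
    (Submodule.equivMapOfInjective _ (Submodule.subtype_injective _) (LinearMap.ker f)))

theorem rank_subquotient_eq_zero (V₁ V₀ : Submodule ℂ V) (h : V₁ ≤ V₀) :
    Module.rank ℂ ↥(V₁.map V₀.mkQ) = 0 := by
  have : V₁.map V₀.mkQ = ⊥ := by
    rw [eq_bot_iff]
    rintro _ ⟨v, hv, rfl⟩
    exact (Submodule.Quotient.mk_eq_zero V₀).2 (h hv)
  rw [this, rank_bot]

theorem rank_subquotient_bot (V₁ V₀ : Submodule ℂ V) (h : V₀ = ⊥) :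
    Module.rank ℂ ↥(V₁.map V₀.mkQ) = Module.rank ℂ V₁ := by
  subst h
  exact (LinearEquiv.rank_eq (Submodule.equivMapOfInjective _
    (by rw [← LinearMap.ker_eq_bot, Submodule.ker_mkQ]) V₁)).symm

end Subquotient

variable {X Y : Type} [TopologicalSpace X] [TopologicalSpace Y] {k : ℕ}

theorem rank_H_eq_zero {A : Set X} (h : Z k A ≤ B k A) : Module.rank ℂ (H k A) = 0 :=
  rank_subquotient_eq_zero _ _ h

theorem HIso.rank_eq {f : C(X, Y)} {A : Set X} {A' : Set Y} (h : HIso f A A') (k : ℕ) :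
    Module.rank ℂ (H k A) = Module.rank ℂ (H k A') := by
  let R : Submodule ℂ (Ch k X × Ch k Y) :=
    (B k A').comap (LinearMap.snd ℂ _ _ - push f ∘ₗ LinearMap.fst ℂ _ _)
  have hR : ∀ z w, (z, w) ∈ R ↔ w - push f z ∈ B k A' := fun z w => Iff.rfl
  obtain ⟨e⟩ := nonempty_equiv_of_rel (Z k A) (B k A) (Z k A') (B k A') R
    (fun z hz => ⟨push f z, push_Z h.mapsTo hz, by rw [hR, sub_self]; exact zero_mem _⟩)
    (fun w hw => (h.surj k w hw).imp fun z hz => ⟨hz.1, (hR _ _).2 hz.2⟩)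
    (fun z hz w hw hzw => by
      rw [hR] at hzw
      constructor
      · intro h1
        simpa using Submodule.add_mem _ hzw (push_B h.mapsTo h1)
      · intro h1
        exact h.inj k z hz (by simpa using Submodule.sub_mem _ h1 hzw))
  exact e.rank_eq

/-! ### Mayer–Vietoris -/

/-- Homology isomorphisms glue along relatively open covers by two sets. -/
theorem HIso.union {f : C(X, Y)} {A₁ B₁ : Set X} {A₂ B₂ : Set Y} (ho₁ : RelOpen A₁ B₁)
    (ho₂ : RelOpen A₂ B₂) (hA : HIso f A₁ A₂) (hB : HIso f B₁ B₂)
    (hAB : HIso f (A₁ ∩ B₁) (A₂ ∩ B₂)) : HIso f (A₁ ∪ B₁) (A₂ ∪ B₂) where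
  mapsTo := hA.mapsTo.union_union hB.mapsTo
  inj k z hz h := by
    have hm : Set.MapsTo f (A₁ ∪ B₁) (A₂ ∪ B₂) := hA.mapsTo.union_union hB.mapsTo
    obtain ⟨a, ha, b, hb, hab, hzab⟩ := exists_small_cycle ho₁ hz
    suffices a + b ∈ B k (A₁ ∪ B₁) by simpa using Submodule.add_mem _ hzab this
    have h1 : push f a + push f b ∈ B k (A₂ ∪ B₂) := by
      have := Submodule.sub_mem _ h (push_B hm hzab)
      rwa [← map_sub, sub_sub_cancel, map_add] at this
    obtain ⟨wa, hwa, wb, hwb, hw⟩ := exists_small_bd ho₂ (push_mem hA.mapsTo ha)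
      (push_mem hB.mapsTo hb) h1
    rw [map_add] at hw
    -- The chain `c` of the intersection is a homology between `push f (bd a)` and zero; by
    -- injectivity on the intersection, `bd a` bounds a chain `e` there, and `a - e` and `b + e`
    -- are cycles.
    set c := push f a - bd wa with hc
    have hc' : c = bd wb - push f b := by
      rw [hc, sub_eq_sub_iff_add_eq_add, ← hw, add_comm]
    have hcm : c ∈ ChS k (A₂ ∩ B₂) := mem_ChS_inter
      (Submodule.sub_mem _ (push_mem hA.mapsTo ha) (bd_mem hwa))
      (hc' ▸ Submodule.sub_mem _ (bd_mem hwb) (push_mem hB.mapsTo hb))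
    obtain ⟨e, he, hae, hbe, hce⟩ : ∃ e ∈ ChS k (A₁ ∩ B₁), a - e ∈ Z k A₁ ∧ b + e ∈ Z k B₁ ∧
        c - push f e ∈ Z k (A₂ ∩ B₂) := by
      cases k with
      | zero =>
        exact ⟨0, zero_mem _, mem_ChS_zero _ _, mem_ChS_zero _ _, mem_ChS_zero _ _⟩
      | succ k =>
        have hbd : bd a + bd b = 0 := by rw [← map_add]; exact (mem_Z_succ.1 hab).2
        have hba : bd a ∈ Z k (A₁ ∩ B₁) := by
          have h2 : bd a ∈ ChS k (A₁ ∩ B₁) := mem_ChS_inter (bd_mem ha) (by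
            rw [eq_neg_of_add_eq_zero_left hbd]; exact Submodule.neg_mem _ (bd_mem hb))
          cases k with
          | zero => exact h2
          | succ k => exact mem_Z_succ.2 ⟨h2, bd_bd _⟩
        have hfc : push f (bd a) = bd c := by
          rw [hc, map_sub, bd_bd, sub_zero, bd_push]
        obtain ⟨e, he, he'⟩ := hAB.inj k _ hba (mem_B.2 ⟨c, hcm, hfc.symm⟩)
        refine ⟨e, he, ?_, ?_, ?_⟩
        · exact mem_Z_succ.2 ⟨Submodule.sub_mem _ ha (ChS_mono Set.inter_subset_left he), by
            rw [map_sub, he', sub_self]⟩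
        · exact mem_Z_succ.2 ⟨Submodule.add_mem _ hb (ChS_mono Set.inter_subset_right he), by
            rw [map_add, he', add_comm, hbd]⟩
        · exact mem_Z_succ.2 ⟨Submodule.sub_mem _ hcm (push_mem hAB.mapsTo he), by
            rw [map_sub, bd_push, he', hfc, sub_self]⟩
    -- The cycle `c - push f e` is corrected by the image of a cycle `g` of the intersection.
    obtain ⟨g, hg, h', hh', hgh⟩ := hAB.surj k _ hce
    have h2 : a - e - g ∈ B k A₁ := by
      refine hA.inj k _ (Submodule.sub_mem _ hae (Z_mono Set.inter_subset_left hg)) ?_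
      refine mem_B.2 ⟨wa + h', Submodule.add_mem _ hwa (ChS_mono Set.inter_subset_left hh'), ?_⟩
      rw [map_add, hgh, hc, map_sub, map_sub]
      abel
    have h3 : b + e + g ∈ B k B₁ := by
      refine hB.inj k _ (Submodule.add_mem _ hbe (Z_mono Set.inter_subset_right hg)) ?_
      refine mem_B.2 ⟨wb - h', Submodule.sub_mem _ hwb (ChS_mono Set.inter_subset_right hh'), ?_⟩
      rw [map_sub, hgh, hc', map_add, map_add]
      abel
    have h4 := Submodule.add_mem _ (B_mono (A' := A₁ ∪ B₁) Set.subset_union_left h2)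
      (B_mono (A' := A₁ ∪ B₁) Set.subset_union_right h3)
    have h5 : a - e - g + (b + e + g) = a + b := by abel
    rwa [h5] at h4
  surj k w hw := by
    cases k with
    | zero =>
      obtain ⟨z, hz, hz'⟩ := hA.surj 0 w (mem_ChS_zero _ _)
      exact ⟨z, mem_ChS_zero _ _, B_mono Set.subset_union_left hz'⟩
    | succ k =>
      obtain ⟨a, ha, b, hb, hab, hwab⟩ := exists_small_cycle ho₂ hw
      have hbd : bd a + bd b = 0 := by rw [← map_add]; exact (mem_Z_succ.1 hab).2
      have hba : bd a ∈ Z k (A₂ ∩ B₂) := by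
        have h2 : bd a ∈ ChS k (A₂ ∩ B₂) := mem_ChS_inter (bd_mem ha) (by
          rw [eq_neg_of_add_eq_zero_left hbd]; exact Submodule.neg_mem _ (bd_mem hb))
        cases k with
        | zero => exact h2
        | succ k => exact mem_Z_succ.2 ⟨h2, bd_bd _⟩
      -- The boundary `bd a` is homologous to the image of a cycle `e` of the intersection, which
      -- bounds chains `u` of `A₁` and `v` of `B₁`.
      obtain ⟨e, he, h, hh, heh⟩ := hAB.surj k _ hba
      obtain ⟨u, hu, hue⟩ := hA.inj k e (Z_mono Set.inter_subset_left he) (mem_B.2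
        ⟨a - h, Submodule.sub_mem _ ha (ChS_mono Set.inter_subset_left hh), by
          rw [map_sub, heh, sub_sub_cancel]⟩)
      obtain ⟨v, hv, hve⟩ := hB.inj k e (Z_mono Set.inter_subset_right he) (mem_B.2
        ⟨-(b + h), Submodule.neg_mem _
          (Submodule.add_mem _ hb (ChS_mono Set.inter_subset_right hh)), by
          rw [map_neg, map_add, heh, neg_add, eq_neg_of_add_eq_zero_left hbd]; abel⟩)
      obtain ⟨p, hp, hp'⟩ := hA.surj (k + 1) (a - h - push f u) (mem_Z_succ.2
        ⟨Submodule.sub_mem _ (Submodule.sub_mem _ ha (ChS_mono Set.inter_subset_left hh))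
          (push_mem hA.mapsTo hu), by
          rw [map_sub, map_sub, heh, bd_push, hue]; abel⟩)
      obtain ⟨q, hq, hq'⟩ := hB.surj (k + 1) (b + h + push f v) (mem_Z_succ.2
        ⟨Submodule.add_mem _ (Submodule.add_mem _ hb (ChS_mono Set.inter_subset_right hh))
          (push_mem hB.mapsTo hv), by
          rw [map_add, map_add, heh, bd_push, hve, eq_neg_of_add_eq_zero_left hbd]; abel⟩)
      refine ⟨u + p - v + q, mem_Z_succ.2 ⟨?_, ?_⟩, ?_⟩
      · exact Submodule.add_mem _ (Submodule.sub_mem _ (Submodule.add_mem _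
          (ChS_mono Set.subset_union_left hu) (ChS_mono Set.subset_union_left (Z_le _ hp)))
          (ChS_mono Set.subset_union_right hv)) (ChS_mono Set.subset_union_right (Z_le _ hq))
      · rw [map_add, map_sub, map_add, hue, hve, (mem_Z_succ.1 hp).2, (mem_Z_succ.1 hq).2]
        abel
      · have h4 := Submodule.add_mem _ hwab (Submodule.add_mem _
          (B_mono (A' := A₂ ∪ B₂) Set.subset_union_left hp')
          (B_mono (A' := A₂ ∪ B₂) Set.subset_union_right hq'))
        convert h4 using 1
        rw [map_add, map_sub, map_add]
        abel

/-- The Mayer–Vietoris sequence when one of the two sets is acyclic and the homology of the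
intersection maps to zero in the homology of the other set. -/
theorem rank_H_union {A A' : Set X} (ho : RelOpen A A') (hA' : Acyclic A')
    (h0 : ∀ k, Z k (A ∩ A') ≤ B k A) (k : ℕ) :
    Module.rank ℂ (H (k + 1) (A ∪ A')) =
      Module.rank ℂ (H k (A ∩ A')) + Module.rank ℂ (H (k + 1) A) := by
  have hU : Z (k + 1) A ⊔ B (k + 1) (A ∪ A') ≤ Z (k + 1) (A ∪ A') :=
    sup_le (Z_mono Set.subset_union_left) (B_le_Z _)
  rw [rank_subquotient_add (Z (k + 1) (A ∪ A')) (Z (k + 1) A ⊔ B (k + 1) (A ∪ A'))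
    (B (k + 1) (A ∪ A')) le_sup_right hU]
  congr 1
  · -- The connecting homomorphism, as a relation between cycles of the union and of the
    -- intersection.
    let R : Submodule ℂ (Ch (k + 1) X × Ch k X) :=
      { carrier := {x | ∃ a ∈ ChS (k + 1) A, ∃ b ∈ ChS (k + 1) A',
          x.1 - (a + b) ∈ B (k + 1) (A ∪ A') ∧ x.2 = bd a}
        add_mem' := by
          rintro ⟨x1, x2⟩ ⟨y1, y2⟩ ⟨a, ha, b, hb, h, h'⟩ ⟨c, hc, d, hd, g, g'⟩
          refine ⟨a + c, add_mem ha hc, b + d, add_mem hb hd, ?_, ?_⟩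
          · have := add_mem h g
            rwa [show x1 - (a + b) + (y1 - (c + d)) = x1 + y1 - (a + c + (b + d)) by abel] at this
          · change x2 + y2 = _
            rw [map_add]; exact congrArg₂ _ h' g'
        zero_mem' := ⟨0, zero_mem _, 0, zero_mem _, by simp, by simp⟩
        smul_mem' := by
          rintro r ⟨x1, x2⟩ ⟨a, ha, b, hb, h, h'⟩
          refine ⟨r • a, Submodule.smul_mem _ _ ha, r • b, Submodule.smul_mem _ _ hb, ?_, ?_⟩
          · have := Submodule.smul_mem _ r h
            rwa [smul_sub, smul_add] at this
          · change r • x2 = _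
            rw [map_smul]; exact congrArg _ h' }
    refine (nonempty_equiv_of_rel (Z (k + 1) (A ∪ A')) (Z (k + 1) A ⊔ B (k + 1) (A ∪ A'))
      (Z k (A ∩ A')) (B k (A ∩ A')) R ?_ ?_ ?_).elim fun e => e.rank_eq
    · intro w hw
      obtain ⟨a, ha, b, hb, hab, hwab⟩ := exists_small_cycle ho hw
      have hbd : bd a + bd b = 0 := by rw [← map_add]; exact (mem_Z_succ.1 hab).2
      have h2 : bd a ∈ ChS k (A ∩ A') := mem_ChS_inter (bd_mem ha) (by
        rw [eq_neg_of_add_eq_zero_left hbd]; exact Submodule.neg_mem _ (bd_mem hb))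
      refine ⟨bd a, ?_, a, ha, b, hb, hwab, rfl⟩
      cases k with
      | zero => exact h2
      | succ k => exact mem_Z_succ.2 ⟨h2, bd_bd _⟩
    · intro z hz
      obtain ⟨a, ha, haz⟩ := h0 k hz
      obtain ⟨b, hb, hbz⟩ := hA' k (Z_mono Set.inter_subset_right hz)
      refine ⟨a - b, mem_Z_succ.2 ⟨sub_mem (ChS_mono Set.subset_union_left ha)
        (ChS_mono Set.subset_union_right hb), by rw [map_sub, haz, hbz, sub_self]⟩,
        a, ha, -b, neg_mem hb, ?_, haz.symm⟩
      change a - b - (a + -b) ∈ _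
      rw [← sub_eq_add_neg, sub_self]; exact zero_mem _
    · rintro w hw z hz ⟨a, ha, b, hb, hab, hza⟩
      change w - (a + b) ∈ _ at hab
      change z = bd a at hza
      have hbz : bd (a + b) = 0 := by
        have h1 := (mem_Z_succ.1 (B_le_Z _ hab)).2
        rw [map_sub, (mem_Z_succ.1 hw).2, zero_sub, neg_eq_zero] at h1
        exact h1
      rw [map_add] at hbz
      constructor
      · intro h
        obtain ⟨a₀, ha₀, u, hu, rfl⟩ := Submodule.mem_sup.1 h
        have h1 : (a - a₀) + b ∈ B (k + 1) (A ∪ A') := by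
          have := sub_mem hu hab
          rwa [show u - (a₀ + u - (a + b)) = a - a₀ + b by abel] at this
        obtain ⟨a', ha', b', hb', h2⟩ := exists_small_bd ho (sub_mem ha (Z_le _ ha₀)) hb h1
        rw [map_add] at h2
        have h3 : a - a₀ - bd a' = bd b' - b := by
          rw [sub_eq_sub_iff_add_eq_add, ← h2]; exact add_comm _ _
        refine mem_B.2 ⟨a - a₀ - bd a', mem_ChS_inter
          (sub_mem (sub_mem ha (Z_le _ ha₀)) (bd_mem ha'))
          (h3 ▸ sub_mem (bd_mem hb') hb), ?_⟩
        rw [map_sub, map_sub, bd_bd, (mem_Z_succ.1 ha₀).2, sub_zero, sub_zero, hza]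
      · rintro ⟨e, he, hez⟩
        have h1 : a - e ∈ Z (k + 1) A := mem_Z_succ.2
          ⟨sub_mem ha (ChS_mono Set.inter_subset_left he), by rw [map_sub, hez, hza, sub_self]⟩
        have h2 : b + e ∈ Z (k + 1) A' := mem_Z_succ.2
          ⟨add_mem hb (ChS_mono Set.inter_subset_right he), by
            rw [map_add, hez, hza, add_comm, hbz]⟩
        have h3 := B_mono (A' := A ∪ A') Set.subset_union_right (hA' _ h2)
        refine Submodule.mem_sup.2 ⟨a - e, h1, w - (a + b) + (b + e), add_mem hab h3, ?_⟩
        abel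
  -- The homology of `A` maps injectively to that of the union, as that of the intersection maps to
  -- zero in it.
  · let R : Submodule ℂ (Ch (k + 1) X × Ch (k + 1) X) :=
      (B (k + 1) (A ∪ A')).comap (LinearMap.snd ℂ _ _ - LinearMap.fst ℂ _ _)
    have hR : ∀ z w, (z, w) ∈ R ↔ w - z ∈ B (k + 1) (A ∪ A') := fun z w => Iff.rfl
    have hinj : ∀ a ∈ Z (k + 1) A, a ∈ B (k + 1) (A ∪ A') → a ∈ B (k + 1) A := by
      intro a ha h
      obtain ⟨a', ha', b', hb', h2⟩ := exists_small_bd ho (Z_le _ ha) (zero_mem (ChS (k + 1) A'))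
        (by simpa using h)
      rw [map_add, add_zero] at h2
      have h3 : a - bd a' = bd b' := by rw [← h2]; abel
      have h4 : a - bd a' ∈ Z (k + 1) (A ∩ A') := mem_Z_succ.2
        ⟨mem_ChS_inter (sub_mem (Z_le _ ha) (bd_mem ha')) (h3 ▸ bd_mem hb'), by
          rw [h3, bd_bd]⟩
      have := add_mem (h0 _ h4) (mem_B.2 ⟨a', ha', rfl⟩)
      simpa using this
    refine (nonempty_equiv_of_rel (Z (k + 1) A ⊔ B (k + 1) (A ∪ A')) (B (k + 1) (A ∪ A'))
      (Z (k + 1) A) (B (k + 1) A) R ?_ ?_ ?_).elim fun e => e.rank_eq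
    · intro w hw
      obtain ⟨a, ha, u, hu, rfl⟩ := Submodule.mem_sup.1 hw
      refine ⟨a, ha, (hR _ _).2 ?_⟩
      simpa using neg_mem hu
    · intro a ha
      exact ⟨a, Submodule.mem_sup_left ha, (hR _ _).2 (by simp)⟩
    · intro w hw a ha h
      rw [hR] at h
      constructor
      · intro h1
        exact hinj a ha (by simpa using add_mem h h1)
      · intro h1
        have := sub_mem (B_mono (A' := A ∪ A') Set.subset_union_left h1) h
        simpa using this

/-! ### Spheres -/

/-- The empty set is the sphere of dimension `-1`. -/
theorem rank_H_empty (k : ℕ) :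
    Module.rank ℂ (H k (∅ : Set X)) = if k = 0 then 1 else 0 := by
  have hbot : ∀ k, ChS (k + 1) (∅ : Set X) = ⊥ := by
    intro k
    rw [ChS, Finsupp.supported_eq_span_single, Submodule.span_eq_bot]
    rintro _ ⟨s, hs, rfl⟩
    exact (hs (stdSimplex.vertex 0)).elim
  cases k with
  | zero =>
    have hB : B 0 (∅ : Set X) = ⊥ := by rw [B, hbot, Submodule.map_bot]
    rw [rank_subquotient_bot _ _ hB, if_pos rfl]
    have htop : Z 0 (∅ : Set X) = ⊤ := by
      rw [eq_top_iff]; exact fun c _ => mem_ChS_zero _ _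
    have hE : IsEmpty (Splx 0) := ⟨fun w => absurd (stdSimplex.sum_eq_one w) (by simp)⟩
    let e : Unique C(Splx 0, X) :=
      { default := ⟨fun w => hE.elim w, continuous_of_const fun w _ => hE.elim w⟩
        uniq := fun s => by ext1 w; exact hE.elim w }
    rw [htop, rank_top, rank_finsupp_self']
    simp
  | succ k =>
    rw [if_neg (Nat.succ_ne_zero k)]
    refine rank_H_eq_zero ((Z_le _).trans ?_)
    rw [hbot]; exact bot_le

/-- The locus where one of finitely many independent linear functionals does not vanish has the
reduced homology of a sphere. The index `k = E.card` means degree `E.card - 1`. -/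
theorem rank_H_sphere [AddCommGroup X] [Module ℝ X] [ContinuousAdd X] [ContinuousSMul ℝ X]
    {ι : Type*} [DecidableEq ι] (L : ι → X →L[ℝ] ℝ) (e : ι → X)
    (hLe : ∀ i j, L i (e j) = if i = j then 1 else 0) (E : Finset ι) (k : ℕ) :
    Module.rank ℂ (H k {x : X | ∃ i ∈ E, L i x ≠ 0}) = if k = E.card then 1 else 0 := by
  induction E using Finset.induction_on generalizing k with
  | empty =>
    have : {x : X | ∃ i ∈ (∅ : Finset ι), L i x ≠ 0} = ∅ := by ext; simp
    rw [this, rank_H_empty, Finset.card_empty]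
  | insert i E hi ih =>
    set N : Set X := {x : X | ∃ i ∈ E, L i x ≠ 0} with hN
    have hNo : IsOpen N := by
      have : N = ⋃ j ∈ E, {x | L j x ≠ 0} := by ext; simp [hN]
      rw [this]
      exact isOpen_biUnion fun j _ => isOpen_ne_fun (L j).continuous continuous_const
    -- Half-sphere on the side of `c • e i`, for `c = 1` or `c = -1`. It contracts to `c • e i`, and the
    -- two half-spheres meet in the sphere of the remaining functionals.
    let Hf : ℝ → Set X := fun c => {x | x ∈ N ∨ 0 < c * L i x}
    have hHo : ∀ c, IsOpen (Hf c) := fun c =>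
      hNo.union (isOpen_lt continuous_const (continuous_const.mul (L i).continuous))
    have hac : ∀ c : ℝ, c * c = 1 → Acyclic (Hf c) := by
      intro c hc
      let F : C(X × unitInterval, X) :=
        ⟨fun p => (1 - (p.2 : ℝ)) • p.1 + (p.2 : ℝ) • c • e i, by fun_prop⟩
      have hFv : ∀ x t, F (x, t) = (1 - (t : ℝ)) • x + (t : ℝ) • c • e i := fun _ _ => rfl
      refine Acyclic.of_contraction F (a := c • e i) ?_ ?_ ?_ ?_ ?_
      · intro x; rw [hFv]; simp
      · right; simp [hLe, hc]
      · rintro x hx t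
        have hti : L i (F (x, t)) = (1 - (t : ℝ)) * L i x + t * c := by
          rw [hFv]; simp [hLe]
        rcases eq_or_lt_of_le t.2.2 with ht | ht
        · right
          rw [hti, ht]; simp [hc]
        · rcases hx with ⟨j, hj, hjx⟩ | hx
          · left
            refine ⟨j, hj, ?_⟩
            have hji : j ≠ i := fun h => hi (h ▸ hj)
            have : L j (F (x, t)) = (1 - (t : ℝ)) * L j x := by
              rw [hFv]; simp [hLe, hji]
            rw [this]
            exact mul_ne_zero (by linarith) hjx
          · right
            rw [hti, mul_add]
            have h1 : c * ((1 - (t : ℝ)) * L i x) = (1 - (t : ℝ)) * (c * L i x) := by ring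
            have h2 : c * ((t : ℝ) * c) = t := by
              rw [mul_left_comm, hc, mul_one]
            rw [h1, h2]
            exact add_pos_of_pos_of_nonneg (mul_pos (by linarith) hx) t.2.1
      · intro t; rw [hFv, ← add_smul]; simp
      · intro x _; rw [hFv]; simp
    have hU : {x : X | ∃ j ∈ insert i E, L j x ≠ 0} = Hf 1 ∪ Hf (-1) := by
      ext x
      simp only [Finset.mem_insert, exists_eq_or_imp, Set.mem_ofPred_eq, Set.mem_union, Hf, hN]
      constructor
      · rintro (h | h)
        · rcases lt_or_gt_of_ne h with h | h
          · exact Or.inr (Or.inr (by linarith))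
          · exact Or.inl (Or.inr (by linarith))
        · exact Or.inl (Or.inl h)
      · rintro ((h | h) | (h | h))
        · exact Or.inr h
        · exact Or.inl (by intro h'; rw [h'] at h; simp at h)
        · exact Or.inr h
        · exact Or.inl (by intro h'; rw [h'] at h; simp at h)
    have hI : Hf 1 ∩ Hf (-1) = N := by
      ext x
      simp only [Set.mem_inter_iff, Set.mem_ofPred_eq, Hf]
      constructor
      · rintro ⟨h | h, h' | h'⟩
        · exact h
        · exact h
        · exact h'
        · linarith
      · exact fun h => ⟨Or.inl h, Or.inl h⟩
    have hro : RelOpen (Hf 1) (Hf (-1)) := ⟨_, _, hHo 1, hHo (-1),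
      (Set.inter_eq_left.2 Set.subset_union_left).symm,
      (Set.inter_eq_left.2 Set.subset_union_right).symm⟩
    have ha1 := hac 1 (by norm_num)
    have ha2 := hac (-1) (by norm_num)
    rw [hU, Finset.card_insert_of_notMem hi]
    cases k with
    | zero =>
      rw [if_neg (by omega)]
      exact rank_H_eq_zero (fun c _ => B_mono Set.subset_union_left (ha1 0 (mem_ChS_zero _ c)))
    | succ k =>
      rw [rank_H_union hro ha2 (fun k => (Z_mono Set.inter_subset_left).trans (ha1 k)), hI, ih,
        rank_H_eq_zero (ha1 _), add_zero]
      simp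

/-! ### Finite quotients -/

theorem eq_of_mem_ChS {M : Type*} [AddCommGroup M] [Module ℂ M] {f g : Ch k X →ₗ[ℂ] M} {A : Set X}
    (h : ∀ s : C(Splx k, X), (∀ w, s w ∈ A) → f (Finsupp.single s 1) = g (Finsupp.single s 1))
    {c : Ch k X} (hc : c ∈ ChS k A) : f c = g c := by
  have : (f - g) c ∈ (⊥ : Submodule ℂ M) :=
    map_mem_of_single (f - g) (fun s hs => by simp [h s hs]) hc
  simpa [sub_eq_zero] using this

open Classical in
/-- The transfer: a simplex goes to the sum of its lifts to `A`, which are the translates of one lift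
by the maps `g a`. Simplices without a lift go to zero. -/
def transfer {G : Type*} [Fintype G] (f : C(X, Y)) (A : Set X) (g : G → C(X, X)) :
    Ch k Y →ₗ[ℂ] Ch k X :=
  Finsupp.linearCombination ℂ fun s =>
    if h : ∃ l : C(Splx k, X), (∀ w, l w ∈ A) ∧ f.comp l = s then
      ∑ a, Finsupp.single ((g a).comp h.choose) 1 else 0

/-- If simplices lift along `f`, uniquely up to a finite group whose elements act trivially on
homology, then `f` is an isomorphism on homology with complex coefficients. -/
theorem HIso.of_finite_quotient {G : Type*} [Group G] [Fintype G] (f : C(X, Y)) {A : Set X}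
    {A' : Set Y} (hf : Set.MapsTo f A A') (g : G → C(X, X)) (hgA : ∀ a, Set.MapsTo (g a) A A)
    (hmul : ∀ a b, g (a * b) = (g a).comp (g b)) (hfg : ∀ a, f.comp (g a) = f)
    (hlift : ∀ k, ∀ s : C(Splx k, Y), (∀ w, s w ∈ A') →
      ∃ l : C(Splx k, X), (∀ w, l w ∈ A) ∧ f.comp l = s)
    (huniq : ∀ k, ∀ l l' : C(Splx k, X), (∀ w, l w ∈ A) → (∀ w, l' w ∈ A) →
      f.comp l = f.comp l' → ∃ a, l' = (g a).comp l)
    (htriv : ∀ a k, ∀ z ∈ Z k A, push (g a) z - z ∈ B k A) : HIso f A A' := by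
  have hN : (Fintype.card G : ℂ) ≠ 0 := Nat.cast_ne_zero.2 Fintype.card_ne_zero
  have tr_single : ∀ k, ∀ l : C(Splx k, X), (∀ w, l w ∈ A) →
      transfer f A g (Finsupp.single (f.comp l) 1) = ∑ a, Finsupp.single ((g a).comp l) 1 := by
    intro k l hl
    have hex : ∃ l' : C(Splx k, X), (∀ w, l' w ∈ A) ∧ f.comp l' = f.comp l := ⟨l, hl, rfl⟩
    rw [transfer, Finsupp.linearCombination_single, one_smul, dif_pos hex]
    obtain ⟨b, hb⟩ := huniq k _ _ hex.choose_spec.1 hl hex.choose_spec.2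
    have : ∀ a, (g a).comp l = (g (a * b)).comp hex.choose := by
      intro a
      rw [hmul, ContinuousMap.comp_assoc, ← hb]
    simp only [this]
    exact (Equiv.sum_comp (Equiv.mulRight b)
      fun a => Finsupp.single ((g a).comp hex.choose) (1 : ℂ)).symm
  have tr_mem : ∀ k, ∀ c ∈ ChS k A', transfer f A g c ∈ ChS k A := by
    intro k c hc
    refine map_mem_of_single _ (fun s hs => ?_) hc
    obtain ⟨l, hl, rfl⟩ := hlift k s hs
    rw [tr_single k l hl]
    exact Submodule.sum_mem _ fun a _ => single_mem_ChS (s := (g a).comp l)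
      (fun w => hgA a (hl w)) _
  have tr_bd : ∀ k, ∀ c ∈ ChS (k + 1) A', bd (transfer f A g c) = transfer f A g (bd c) := by
    intro k c hc
    refine eq_of_mem_ChS (f := bd ∘ₗ transfer f A g) (g := transfer f A g ∘ₗ bd) (fun s hs => ?_) hc
    obtain ⟨l, hl, rfl⟩ := hlift _ s hs
    simp only [LinearMap.comp_apply]
    rw [tr_single _ l hl, bd_single, map_sum, map_sum]
    simp only [bd_single, map_smul]
    rw [Finset.sum_comm]
    refine Finset.sum_congr rfl fun i _ => ?_
    rw [ContinuousMap.comp_assoc, tr_single k (l.comp (face i)) (fun w => hl (face i w)),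
      Finset.smul_sum]
    rfl
  have push_tr : ∀ k, ∀ c ∈ ChS k A', push f (transfer f A g c) = (Fintype.card G : ℂ) • c := by
    intro k c hc
    refine eq_of_mem_ChS (f := push f ∘ₗ transfer f A g)
      (g := (Fintype.card G : ℂ) • LinearMap.id) (fun s hs => ?_) hc
    obtain ⟨l, hl, rfl⟩ := hlift _ s hs
    simp only [LinearMap.comp_apply]
    rw [tr_single _ l hl, map_sum]
    simp only [push_single, ← ContinuousMap.comp_assoc, hfg]
    simp
  have tr_push : ∀ k, ∀ c ∈ ChS k A, transfer f A g (push f c) = ∑ a, push (g a) c := by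
    intro k c hc
    have := eq_of_mem_ChS (f := transfer f A g ∘ₗ push f)
      (g := ∑ a, (push (g a) : Ch k X →ₗ[ℂ] Ch k X)) (fun s hs => ?_) hc
    · simpa using this
    · simp only [LinearMap.comp_apply, push_single, LinearMap.sum_apply]
      exact tr_single _ s hs
  have tr_Z : ∀ k, ∀ c ∈ Z k A', transfer f A g c ∈ Z k A := by
    intro k c hc
    cases k with
    | zero => exact mem_ChS_zero _ _
    | succ k =>
      obtain ⟨h1, h2⟩ := mem_Z_succ.1 hc
      exact mem_Z_succ.2 ⟨tr_mem _ _ h1, by rw [tr_bd _ _ h1, h2, map_zero]⟩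
  refine ⟨hf, fun k z hz h => ?_, fun k w hw => ?_⟩
  · obtain ⟨w, hw, hwz⟩ := h
    have h1 : ∑ a, push (g a) z ∈ B k A := by
      rw [← tr_push _ _ (Z_le _ hz), ← hwz, ← tr_bd _ _ hw]
      exact mem_B.2 ⟨_, tr_mem _ _ hw, rfl⟩
    have h2 : ∑ a, (push (g a) z - z) ∈ B k A := Submodule.sum_mem _ fun a _ => htriv a k z hz
    have h3 := Submodule.smul_mem _ (Fintype.card G : ℂ)⁻¹ (sub_mem h1 h2)
    rw [Finset.sum_sub_distrib, sub_sub_cancel, Finset.sum_const, Finset.card_univ,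
      ← Nat.cast_smul_eq_nsmul ℂ, smul_smul, inv_mul_cancel₀ hN, one_smul] at h3
    exact h3
  · refine ⟨(Fintype.card G : ℂ)⁻¹ • transfer f A g w, Submodule.smul_mem _ _ (tr_Z k w hw), ?_⟩
    rw [map_smul, push_tr _ _ (Z_le _ hw), smul_smul, inv_mul_cancel₀ hN, one_smul, sub_self]
    exact zero_mem _

end SingChain

namespace SingChain
open AffChain CategoryTheory Limits

/-! ### Singular cohomology over a field -/

section Dual
variable {C₂ C₁ C₀ : Type} [AddCommGroup C₂] [Module ℂ C₂] [AddCommGroup C₁] [Module ℂ C₁]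
  [AddCommGroup C₀] [Module ℂ C₀]

/-- The cohomology of the dual of a complex over a field is the dual of its homology. -/
theorem nonempty_cohomology_equiv_dual (d₂ : C₂ →ₗ[ℂ] C₁) (d₁ : C₁ →ₗ[ℂ] C₀) :
    Nonempty ((↥(LinearMap.ker d₂.dualMap) ⧸
      (LinearMap.range d₁.dualMap).submoduleOf (LinearMap.ker d₂.dualMap)) ≃ₗ[ℂ]
      Module.Dual ℂ ↥((LinearMap.ker d₁).map (LinearMap.range d₂).mkQ)) := by
  let K := LinearMap.ker d₁
  let Wr : Submodule ℂ K := (LinearMap.range d₂).submoduleOf K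
  let Ψ : ↥(LinearMap.ker d₂.dualMap) →ₗ[ℂ] Module.Dual ℂ K :=
    K.subtype.dualMap ∘ₗ Submodule.subtype _
  have hΨ : ∀ f x, Ψ f x = f.1 x.1 := fun _ _ => rfl
  have hker : (LinearMap.range d₁.dualMap).submoduleOf (LinearMap.ker d₂.dualMap) =
      LinearMap.ker Ψ := by
    ext f
    rw [Submodule.submoduleOf, Submodule.mem_comap, LinearMap.range_dualMap_eq_dualAnnihilator_ker,
      Submodule.mem_dualAnnihilator, LinearMap.mem_ker]
    constructor
    · intro h
      ext x
      exact h x.1 x.2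
    · intro h x hx
      exact LinearMap.congr_fun h ⟨x, hx⟩
  have hrange : LinearMap.range Ψ = Wr.dualAnnihilator := by
    ext g
    rw [Submodule.mem_dualAnnihilator]
    constructor
    · rintro ⟨f, rfl⟩ x hx
      obtain ⟨y, hy⟩ := hx
      rw [hΨ]
      change d₂ y = x.1 at hy
      rw [← hy]
      exact LinearMap.congr_fun (LinearMap.mem_ker.1 f.2) y
    · intro h
      -- extend by zero on the boundaries outside of the kernel
      let p : K →ₗ[ℂ] C₁ ⧸ LinearMap.range d₂ := (LinearMap.range d₂).mkQ ∘ₗ K.subtype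
      have hp : LinearMap.ker p ≤ LinearMap.ker g := by
        intro x hx
        refine h x ?_
        exact (Submodule.Quotient.mk_eq_zero (LinearMap.range d₂)).1 (LinearMap.mem_ker.1 hx)
      have hg : g ∈ LinearMap.range p.dualMap := by
        rw [LinearMap.range_dualMap_eq_dualAnnihilator_ker, Submodule.mem_dualAnnihilator]
        exact fun x hx => hp hx
      obtain ⟨q, rfl⟩ := hg
      refine ⟨⟨q ∘ₗ (LinearMap.range d₂).mkQ, ?_⟩, ?_⟩
      · rw [LinearMap.mem_ker]
        ext y
        change q ((LinearMap.range d₂).mkQ (d₂ y)) = 0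
        rw [Submodule.mkQ_apply, (Submodule.Quotient.mk_eq_zero (LinearMap.range d₂)).2
          (LinearMap.mem_range_self d₂ y), map_zero]
      · rfl
  have hquot : Nonempty ((K ⧸ Wr) ≃ₗ[ℂ] ↥(K.map (LinearMap.range d₂).mkQ)) := by
    let p : K →ₗ[ℂ] C₁ ⧸ LinearMap.range d₂ := (LinearMap.range d₂).mkQ ∘ₗ K.subtype
    have h1 : Wr = LinearMap.ker p := by
      ext x
      exact (Submodule.Quotient.mk_eq_zero (LinearMap.range d₂)).symm
    have h2 : LinearMap.range p = K.map (LinearMap.range d₂).mkQ := by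
      rw [LinearMap.range_comp, Submodule.range_subtype]
    exact ⟨(Submodule.quotEquivOfEq _ _ h1).trans
      (p.quotKerEquivRange.trans (LinearEquiv.ofEq _ _ h2))⟩
  obtain ⟨e⟩ := hquot
  exact ⟨(Submodule.quotEquivOfEq _ _ hker).trans (Ψ.quotKerEquivRange.trans
    ((LinearEquiv.ofEq _ _ hrange).trans (Wr.dualQuotEquivDualAnnihilator.symm.trans
      e.symm.dualMap)))⟩

theorem finrank_cohomology (d₂ : C₂ →ₗ[ℂ] C₁) (d₁ : C₁ →ₗ[ℂ] C₀) {n : ℕ}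
    (h : Module.rank ℂ ↥((LinearMap.ker d₁).map (LinearMap.range d₂).mkQ) = n) :
    Module.Finite ℂ (↥(LinearMap.ker d₂.dualMap) ⧸
      (LinearMap.range d₁.dualMap).submoduleOf (LinearMap.ker d₂.dualMap)) ∧
    Module.finrank ℂ (↥(LinearMap.ker d₂.dualMap) ⧸
      (LinearMap.range d₁.dualMap).submoduleOf (LinearMap.ker d₂.dualMap)) = n := by
  obtain ⟨e⟩ := nonempty_cohomology_equiv_dual d₂ d₁
  have : Module.Finite ℂ ↥((LinearMap.ker d₁).map (LinearMap.range d₂).mkQ) := by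
    rw [← Module.rank_lt_aleph0_iff, h]
    exact Cardinal.natCast_lt_aleph0
  refine ⟨Module.Finite.equiv e.symm, ?_⟩
  rw [e.finrank_eq, Subspace.dual_finrank_eq]
  exact Module.finrank_eq_of_rank_eq h

end Dual

/-! ### Comparison with the singular chain complex of Mathlib -/

variable (X : TopCat.{0})

/-- The singular chains of Mathlib are the free module on the singular simplices. -/
def chainIso (k : ℕ) : ((singChains X).X k) ≅
    ModuleCat.of ℂ (((TopCat.toSSet.obj X).obj (Opposite.op (SimplexCategory.mk k))) →₀ ℂ) :=
  IsColimit.coconePointUniqueUpToIso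
    ((TopCat.toSSet.obj X).isColimitChainComplexXCofan (ModuleCat.of ℂ ℂ) k)
    (ModuleCat.finsuppCoconeIsColimit ℂ ℂ _)

/-- The singular chains of Mathlib in degree `k` are the chains `Ch (k + 1)`. -/
def chainEquiv (k : ℕ) : ((singChains X).X k) ≃ₗ[ℂ] Ch (k + 1) X :=
  (chainIso X k).toLinearEquiv.trans
    (Finsupp.domLCongr (X.toSSetObjEquiv (Opposite.op (SimplexCategory.mk k))))

theorem chainEquiv_ι (k : ℕ) (x : (TopCat.toSSet.obj X).obj (Opposite.op (SimplexCategory.mk k)))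
    (a : ℂ) :
    chainEquiv X k (((TopCat.toSSet.obj X).ιChainComplex (R := ModuleCat.of ℂ ℂ) x).hom a) =
      Finsupp.single (X.toSSetObjEquiv _ x) a := by
  have h := IsColimit.comp_coconePointUniqueUpToIso_hom
    ((TopCat.toSSet.obj X).isColimitChainComplexXCofan (ModuleCat.of ℂ ℂ) k)
    (ModuleCat.finsuppCoconeIsColimit ℂ ℂ
      ((TopCat.toSSet.obj X).obj (Opposite.op (SimplexCategory.mk k)))) ⟨x⟩
  have h'' : (chainIso X k).hom.hom
      (((TopCat.toSSet.obj X).ιChainComplex (R := ModuleCat.of ℂ ℂ) x).hom a) =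
      Finsupp.single x a := LinearMap.congr_fun (congrArg ModuleCat.Hom.hom h) a
  refine (congrArg (Finsupp.domLCongr (R := ℂ) (M := ℂ)
    (X.toSSetObjEquiv (Opposite.op (SimplexCategory.mk k)))) h'').trans ?_
  exact Finsupp.domLCongr_single _ _ _

theorem toSSetObjEquiv_δ (k : ℕ) (i : Fin (k + 2))
    (x : (TopCat.toSSet.obj X).obj (Opposite.op (SimplexCategory.mk (k + 1)))) :
    X.toSSetObjEquiv (Opposite.op (SimplexCategory.mk k)) ((TopCat.toSSet.obj X).δ i x) =
      (X.toSSetObjEquiv (Opposite.op (SimplexCategory.mk (k + 1))) x).comp (face i) := by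
  rfl

theorem chainEquiv_d (k : ℕ) (c : (singChains X).X (k + 1)) :
    chainEquiv X k (((singChains X).d (k + 1) k).hom c) = bd (chainEquiv X (k + 1) c) := by
  let f : (singChains X).X (k + 1) ⟶ ModuleCat.of ℂ (Ch (k + 1) X) :=
    ModuleCat.ofHom ((chainEquiv X k).toLinearMap ∘ₗ ((singChains X).d (k + 1) k).hom)
  let g : (singChains X).X (k + 1) ⟶ ModuleCat.of ℂ (Ch (k + 1) X) :=
    ModuleCat.ofHom (bd ∘ₗ (chainEquiv X (k + 1)).toLinearMap)
  have : f = g := by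
    refine SSet.chainComplex_hom_ext fun x => ?_
    refine ModuleCat.hom_ext (LinearMap.ext_ring ?_)
    change chainEquiv X k (((singChains X).d (k + 1) k).hom
      (((TopCat.toSSet.obj X).ιChainComplex (R := ModuleCat.of ℂ ℂ) x).hom 1)) =
      bd (chainEquiv X (k + 1)
        (((TopCat.toSSet.obj X).ιChainComplex (R := ModuleCat.of ℂ ℂ) x).hom 1))
    have h := LinearMap.congr_fun (congrArg ModuleCat.Hom.hom
      ((TopCat.toSSet.obj X).ιChainComplex_d (R := ModuleCat.of ℂ ℂ) x)) (1 : ℂ)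
    have h' : ((singChains X).d (k + 1) k).hom
      (((TopCat.toSSet.obj X).ιChainComplex (R := ModuleCat.of ℂ ℂ) x).hom 1) =
        ∑ i : Fin (k + 2), (-1 : ℂ) ^ (i : ℕ) •
          ((TopCat.toSSet.obj X).ιChainComplex (R := ModuleCat.of ℂ ℂ)
            ((TopCat.toSSet.obj X).δ i x)).hom 1 := by
      refine h.trans ?_
      simp only [ModuleCat.hom_sum, LinearMap.sum_apply]
      refine Finset.sum_congr rfl fun i _ => ?_
      rcases Nat.even_or_odd (i : ℕ) with hi | hi <;> simp [hi.neg_one_pow]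
    refine (congrArg (chainEquiv X k) h').trans ((map_sum (chainEquiv X k) _ _).trans ?_)
    rw [chainEquiv_ι, bd_single]
    refine Finset.sum_congr rfl fun i _ => ?_
    refine ((chainEquiv X k).map_smul _ _).trans ?_
    rw [chainEquiv_ι, toSSetObjEquiv_δ]
  exact LinearMap.congr_fun (congrArg ModuleCat.Hom.hom this) c

theorem rank_homology_succ (k : ℕ) :
    Module.rank ℂ ↥((LinearMap.ker ((singChains X).d (k + 1) k).hom).map
      (LinearMap.range ((singChains X).d (k + 2) (k + 1)).hom).mkQ) =
      Module.rank ℂ (H (k + 2) (Set.univ : Set X)) := by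
  refine (nonempty_equiv_of_rel _ _ (Z (k + 2) (Set.univ : Set X)) (B (k + 2) Set.univ)
    ((chainEquiv X (k + 1)).toLinearMap.graph) ?_ ?_ ?_).elim fun e => e.rank_eq
  · intro v hv
    refine ⟨chainEquiv X (k + 1) v, mem_Z_succ.2 ⟨mem_ChS_univ _, ?_⟩, rfl⟩
    rw [← chainEquiv_d, LinearMap.mem_ker.1 hv, map_zero]
  · intro w hw
    refine ⟨(chainEquiv X (k + 1)).symm w, ?_, ?_⟩
    · rw [LinearMap.mem_ker, ← (chainEquiv X k).map_eq_zero_iff, chainEquiv_d,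
        LinearEquiv.apply_symm_apply]
      exact (mem_Z_succ.1 hw).2
    · exact (LinearEquiv.apply_symm_apply _ _).symm
  · intro v _ w _ h
    have h : w = chainEquiv X (k + 1) v := h
    subst h
    constructor
    · rintro ⟨u, rfl⟩
      exact mem_B.2 ⟨chainEquiv X (k + 2) u, mem_ChS_univ _, (chainEquiv_d X (k + 1) u).symm⟩
    · rintro ⟨u, _, hu⟩
      refine ⟨(chainEquiv X (k + 2)).symm u, (chainEquiv X (k + 1)).injective ?_⟩
      rw [chainEquiv_d, LinearEquiv.apply_symm_apply, hu]

/-- In degree zero, the homology of Mathlib's complex is not reduced, which accounts for one more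
dimension. -/
theorem rank_homology_zero [Nonempty X] :
    Module.rank ℂ ↥((LinearMap.ker ((singChains X).d 0 0).hom).map
      (LinearMap.range ((singChains X).d 1 0).hom).mkQ) =
      1 + Module.rank ℂ (H 1 (Set.univ : Set X)) := by
  have h1 : Module.rank ℂ ↥((LinearMap.ker ((singChains X).d 0 0).hom).map
      (LinearMap.range ((singChains X).d 1 0).hom).mkQ) =
      Module.rank ℂ ↥((⊤ : Submodule ℂ (Ch 1 X)).map (B 1 (Set.univ : Set X)).mkQ) := by
    refine (nonempty_equiv_of_rel _ _ _ _
      ((chainEquiv X 0).toLinearMap.graph) ?_ ?_ ?_).elim fun e => e.rank_eq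
    · intro v hv
      exact ⟨chainEquiv X 0 v, trivial, rfl⟩
    · intro w hw
      refine ⟨(chainEquiv X 0).symm w, ?_, ?_⟩
      · rw [(singChains X).shape 0 0 (by simp)]
        simp
      · exact (LinearEquiv.apply_symm_apply _ _).symm
    · intro v _ w _ h
      have h : w = chainEquiv X 0 v := h
      subst h
      constructor
      · rintro ⟨u, rfl⟩
        exact mem_B.2 ⟨chainEquiv X 1 u, mem_ChS_univ _, (chainEquiv_d X 0 u).symm⟩
      · rintro ⟨u, _, hu⟩
        refine ⟨(chainEquiv X 1).symm u, (chainEquiv X 0).injective ?_⟩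
        rw [chainEquiv_d, LinearEquiv.apply_symm_apply, hu]
  -- The chains modulo the kernel of the augmentation `bd : Ch 1 X → Ch 0 X` are one-dimensional.
  rw [h1, rank_subquotient_add ⊤ (Z 1 (Set.univ : Set X)) (B 1 Set.univ) (B_le_Z _) le_top]
  congr 1
  have h2 : Module.rank ℂ ↥((⊤ : Submodule ℂ (Ch 1 X)).map (Z 1 (Set.univ : Set X)).mkQ) =
      Module.rank ℂ (H 0 (∅ : Set X)) := by
    obtain ⟨x⟩ := ‹Nonempty X›
    have hB : ∀ y ∈ B 0 (∅ : Set X), y = 0 := by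
      rintro _ ⟨w, hw, rfl⟩
      have : w ∈ (⊥ : Submodule ℂ (Ch 1 X)) := by
        refine map_mem_of_single LinearMap.id (fun s hs => ?_) hw
        exact (hs (stdSimplex.vertex 0)).elim
      rw [(Submodule.mem_bot ℂ).1 this, map_zero]
    refine (nonempty_equiv_of_rel _ _ _ _
      ((bd : Ch 1 X →ₗ[ℂ] Ch 0 X).graph) ?_ ?_ ?_).elim fun e => e.rank_eq
    · intro v _
      exact ⟨bd v, mem_ChS_zero _ _, rfl⟩
    · intro w _
      have := acyclic_singleton x 0 (mem_ChS_zero _ w)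
      obtain ⟨v, _, hv⟩ := mem_B.1 this
      exact ⟨v, trivial, hv.symm⟩
    · intro v _ w _ h
      have h : w = bd v := h
      rw [mem_Z_succ]
      constructor
      · rintro ⟨_, h'⟩
        rw [h, h']; exact zero_mem _
      · intro h'
        exact ⟨mem_ChS_univ _, by rw [← h]; exact hB _ h'⟩
  rw [h2, rank_H_empty, if_pos rfl]

theorem finrank_singCohomology_succ {k n : ℕ}
    (h : Module.rank ℂ (H (k + 2) (Set.univ : Set X)) = n) :
    Module.Finite ℂ (SingCohomology X (k + 1)) ∧
      Module.finrank ℂ (SingCohomology X (k + 1)) = n :=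
  finrank_cohomology ((singChains X).d (k + 2) (k + 1)).hom ((singChains X).d (k + 1) k).hom
    ((rank_homology_succ X k).trans h)

theorem finrank_singCohomology_zero [Nonempty X] {n : ℕ}
    (h : Module.rank ℂ (H 1 (Set.univ : Set X)) = n) :
    Module.Finite ℂ (SingCohomology X 0) ∧ Module.finrank ℂ (SingCohomology X 0) = 1 + n :=
  finrank_cohomology ((singChains X).d 1 0).hom ((singChains X).d 0 0).hom
    ((rank_homology_zero X).trans (by rw [h]; norm_cast))

end SingChain

namespace SingChain

/-! ### Lifting singular simplices along covering maps -/

instance preconnectedSpace_splx (k : ℕ) : PreconnectedSpace (Splx k) :=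
  Subtype.preconnectedSpace (convex_stdSimplex ℝ (Fin k)).isPreconnected

/-- A singular simplex lifts along a covering: contracting the standard simplex to a vertex turns
the lifting problem into one for a homotopy. -/
theorem exists_lift {E X : Type*} [TopologicalSpace E] [TopologicalSpace X] {p : E → X}
    (cov : IsCoveringMap p) (hp : Function.Surjective p) {k : ℕ} (s : C(Splx k, X)) :
    ∃ l : C(Splx k, E), ∀ w, p (l w) = s w := by
  rcases isEmpty_or_nonempty (Splx k) with hk | ⟨⟨v⟩⟩
  · exact ⟨⟨fun w => hk.elim w, by rw [continuous_iff_continuousAt]; exact fun w => hk.elim w⟩,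
      fun w => hk.elim w⟩
  obtain ⟨e, he⟩ := hp (s v)
  let c : C(unitInterval × Splx k, Splx k) :=
    { toFun := fun x => ⟨(1 - (x.1 : ℝ)) • v.1 + (x.1 : ℝ) • x.2.1,
        convex_stdSimplex ℝ (Fin k) v.2 x.2.2 (by linarith [x.1.2.2]) x.1.2.1 (by ring)⟩
      continuous_toFun := by
        refine Continuous.subtype_mk ?_ _
        fun_prop }
  have h0 : ∀ w, (s.comp c) (0, w) = p ((ContinuousMap.const (Splx k) e) w) := by
    intro w
    rw [ContinuousMap.const_apply, he, ContinuousMap.comp_apply]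
    congr 1
    exact Subtype.ext (by simp [c])
  refine ⟨⟨fun w => cov.liftHomotopy (s.comp c) (ContinuousMap.const _ e) h0 (1, w),
    by fun_prop⟩, fun w => ?_⟩
  refine (congrFun (cov.liftHomotopy_lifts (s.comp c) (ContinuousMap.const _ e) h0) (1, w)).trans ?_
  rw [ContinuousMap.comp_apply]
  congr 1
  exact Subtype.ext (by simp [c])

theorem RelOpen.of_inter {X : Type} [TopologicalSpace X] {U V W : Set X} (hU : IsOpen U)
    (hV : IsOpen V) : RelOpen (U ∩ W) (V ∩ W) := by
  refine ⟨U, V, hU, hV, ?_, ?_⟩ <;> ext x <;> simp only [Set.mem_inter_iff, Set.mem_union] <;> tauto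

end SingChain

namespace ToricData
open SingChain

variable {m r : ℕ} (X : ToricData m r)

/-! ### The quotient of `ℂ^m` by the torus -/

open scoped Classical in
/-- The set of the indices of the non-zero coordinates. -/
def csupp (z : Fin m → ℂ) : Finset (Fin m) := Finset.univ.filter fun i => z i ≠ 0

@[simp] theorem mem_csupp {z : Fin m → ℂ} {i : Fin m} : i ∈ csupp z ↔ z i ≠ 0 := by
  simp [csupp]

theorem act_mul (s t : Fin r → ℂˣ) (z : Fin m → ℂ) : X.act (s * t) z = X.act s (X.act t z) := by
  funext i; simp [act, mul_assoc]

theorem act_one (z : Fin m → ℂ) : X.act 1 z = z := by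
  funext i; simp [act]

@[simp] theorem csupp_act (t : Fin r → ℂˣ) (z : Fin m → ℂ) : csupp (X.act t z) = csupp z := by
  ext i; simp [act]

theorem continuous_act (t : Fin r → ℂˣ) : Continuous (X.act t) :=
  continuous_pi fun i => continuous_const.mul (continuous_apply i)

/-- Two points of `ℂ^m` are equivalent if they lie in the same orbit of the torus. -/
def orbits : Setoid (Fin m → ℂ) where
  r z w := ∃ t : Fin r → ℂˣ, X.act t z = w
  iseqv :=
    { refl := fun z => ⟨1, X.act_one z⟩
      symm := by
        rintro z w ⟨t, rfl⟩
        exact ⟨t⁻¹, by rw [← X.act_mul, inv_mul_cancel, X.act_one]⟩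
      trans := by
        rintro x y z ⟨s, rfl⟩ ⟨t, rfl⟩
        exact ⟨t * s, X.act_mul t s x⟩ }

/-- The (non-Hausdorff) space of all orbits of the torus in `ℂ^m`. -/
abbrev OrbitSpace : Type := Quotient X.orbits

/-- The orbit of a point. -/
def orbit (z : Fin m → ℂ) : X.OrbitSpace := Quotient.mk X.orbits z

variable {X} in
theorem orbit_eq_iff {z w : Fin m → ℂ} : X.orbit z = X.orbit w ↔ ∃ t, X.act t z = w :=
  Quotient.eq (r := X.orbits)

theorem orbit_act (t : Fin r → ℂˣ) (z : Fin m → ℂ) : X.orbit (X.act t z) = X.orbit z :=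
  (orbit_eq_iff.2 ⟨t, rfl⟩).symm

theorem isOpenQuotientMap_orbit : IsOpenQuotientMap X.orbit where
  surjective := Quotient.mk_surjective
  continuous := continuous_quotient_mk'
  isOpenMap := by
    intro U hU
    rw [← isQuotientMap_quotient_mk'.isOpen_preimage]
    have : (Quotient.mk X.orbits) ⁻¹' (X.orbit '' U) = ⋃ t, X.act t ⁻¹' U := by
      ext z
      simp only [Set.mem_preimage, Set.mem_image, Set.mem_iUnion]
      constructor
      · rintro ⟨w, hw, h⟩
        obtain ⟨t, rfl⟩ := orbit_eq_iff.1 h.symm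
        exact ⟨t, hw⟩
      · rintro ⟨t, ht⟩
        exact ⟨_, ht, X.orbit_act t z⟩
    change IsOpen ((Quotient.mk X.orbits) ⁻¹' (X.orbit '' U))
    rw [this]
    exact isOpen_iUnion fun t => hU.preimage (X.continuous_act t)

/-- The indices of the coordinates that do not vanish on an orbit. -/
def qsupp (q : X.OrbitSpace) : Finset (Fin m) :=
  Quotient.lift csupp (by rintro z _ ⟨t, rfl⟩; exact (X.csupp_act t z).symm) q

@[simp] theorem qsupp_orbit (z : Fin m → ℂ) : X.qsupp (X.orbit z) = csupp z := rfl

theorem isOpen_mem_qsupp (i : Fin m) : IsOpen {q : X.OrbitSpace | i ∈ X.qsupp q} := by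
  rw [← X.isOpenQuotientMap_orbit.isQuotientMap.isOpen_preimage]
  have : X.orbit ⁻¹' {q | i ∈ X.qsupp q} = {z | z i ≠ 0} := by ext z; simp
  rw [this]
  exact isOpen_ne_fun (continuous_apply i) continuous_const

theorem isOpen_subset_qsupp (K : Finset (Fin m)) : IsOpen {q : X.OrbitSpace | K ⊆ X.qsupp q} := by
  have : {q : X.OrbitSpace | K ⊆ X.qsupp q} = ⋂ i ∈ K, {q | i ∈ X.qsupp q} := by
    ext q; simp [Finset.subset_iff]
  rw [this]
  exact isOpen_biInter_finset fun i _ => X.isOpen_mem_qsupp i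

/-- The coordinates outside `K` are multiplied by `1 - s`. -/
def shrink (K : Finset (Fin m)) (s : unitInterval) (z : Fin m → ℂ) : Fin m → ℂ :=
  fun i => if i ∈ K then z i else (1 - (s : ℝ) : ℝ) * z i

theorem shrink_zero (K : Finset (Fin m)) (z : Fin m → ℂ) : shrink K 0 z = z := by
  funext i; simp [shrink]

theorem continuous_shrink (K : Finset (Fin m)) :
    Continuous fun x : (Fin m → ℂ) × unitInterval => shrink K x.2 x.1 := by
  refine continuous_pi fun i => ?_
  by_cases hi : i ∈ K
  · simp only [shrink, hi, if_true]; fun_prop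
  · simp only [shrink, hi, if_false]
    exact (Complex.continuous_ofReal.comp (by fun_prop)).mul (by fun_prop)

theorem shrink_act (K : Finset (Fin m)) (s : unitInterval) (t : Fin r → ℂˣ) (z : Fin m → ℂ) :
    shrink K s (X.act t z) = X.act t (shrink K s z) := by
  funext i
  by_cases hi : i ∈ K
  · simp [shrink, act, hi]
  · simp only [shrink, act, hi, if_false]; ring

theorem csupp_shrink_subset (K : Finset (Fin m)) (s : unitInterval) (z : Fin m → ℂ) :
    csupp (shrink K s z) ⊆ csupp z := by
  intro i
  rw [mem_csupp, mem_csupp, not_imp_not]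
  intro h
  simp [shrink, h]

theorem subset_csupp_shrink {K : Finset (Fin m)} (s : unitInterval) {z : Fin m → ℂ}
    (h : K ⊆ csupp z) : K ⊆ csupp (shrink K s z) := by
  intro i hi
  have := h hi
  simp_all [shrink]

theorem csupp_shrink_one {K : Finset (Fin m)} {z : Fin m → ℂ} (h : K ⊆ csupp z) :
    csupp (shrink K 1 z) = K := by
  refine Finset.Subset.antisymm (fun i hi => ?_) (subset_csupp_shrink 1 h)
  by_contra hK
  simp [shrink, hK] at hi

/-- The deformation `shrink` on the space of orbits, to which it descends because the torus acts
coordinatewise. -/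
def qshrink (K : Finset (Fin m)) : C(X.OrbitSpace × unitInterval, X.OrbitSpace) where
  toFun x := Quotient.map (sa := X.orbits) (sb := X.orbits) (shrink K x.2)
    (by rintro z _ ⟨t, rfl⟩; exact ⟨t, (X.shrink_act K x.2 t z).symm⟩) x.1
  continuous_toFun := by
    have h := X.isOpenQuotientMap_orbit.prodMap (IsOpenQuotientMap.id (X := unitInterval))
    rw [h.isQuotientMap.continuous_iff]
    exact X.isOpenQuotientMap_orbit.continuous.comp (continuous_shrink K)

/-- The orbits with support between `K` and `J` deform to those with support exactly `K`. -/
theorem hIso_core {K J : Finset (Fin m)} (hKJ : K ⊆ J) :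
    HIso (ContinuousMap.id X.OrbitSpace) {q | X.qsupp q = K}
      {q | K ⊆ X.qsupp q ∧ X.qsupp q ⊆ J} := by
  refine HIso.of_deformation (X.qshrink K) ?_ ?_ ?_ ?_ ?_
  · rintro ⟨z⟩
    exact congrArg X.orbit (shrink_zero K z)
  · intro q hq
    have hq : X.qsupp q = K := hq
    exact ⟨hq.ge, hq.le.trans hKJ⟩
  · rintro ⟨z⟩ ⟨h1, h2⟩ t
    exact ⟨subset_csupp_shrink t h1, (csupp_shrink_subset K t z).trans h2⟩
  · rintro ⟨z⟩ h t
    have h : csupp z = K := h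
    exact Finset.Subset.antisymm ((csupp_shrink_subset K t z).trans h.le)
      (subset_csupp_shrink t h.ge)
  · rintro ⟨z⟩ ⟨h1, h2⟩
    exact csupp_shrink_one h1

theorem hIso_affine_core (K : Finset (Fin m)) :
    HIso (ContinuousMap.id (Fin m → ℂ)) {z | csupp z = K} {z | K ⊆ csupp z} := by
  refine HIso.of_deformation ⟨_, continuous_shrink K⟩ ?_ ?_ ?_ ?_ ?_
  · exact fun z => shrink_zero K z
  · intro z hz
    have hz : csupp z = K := hz
    exact hz.ge
  · exact fun z h t => subset_csupp_shrink t h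
  · intro z h t
    have h : csupp z = K := h
    exact Finset.Subset.antisymm ((csupp_shrink_subset K t z).trans h.le)
      (subset_csupp_shrink t h.ge)
  · exact fun z h => csupp_shrink_one h

/-! ### Strata of the orbit space are finite quotients of tori -/

/-- The subgroup of the torus on which the characters `D_i`, `i ∈ I`, are trivial. -/
def charKer (I : Finset (Fin m)) : Subgroup (Fin r → ℂˣ) where
  carrier := {t | ∀ i ∈ I, X.torusHom t i = 1}
  one_mem' i _ := by simp
  mul_mem' ha hb i hi := by simp [ha i hi, hb i hi]
  inv_mem' ha i hi := by simp [ha i hi]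

/-- The torus `(ℂˣ)^K` is the locus of the points of `ℂ^m` with support `K`. -/
def coreHomeo (K : Finset (Fin m)) : (K → ℂˣ) ≃ₜ {z : Fin m → ℂ // csupp z = K} where
  toFun u := ⟨fun i => if h : i ∈ K then (u ⟨i, h⟩ : ℂ) else 0, by
    ext i; by_cases h : i ∈ K <;> simp [h]⟩
  invFun z i := Units.mk0 (z.1 i) (mem_csupp.1 (z.2.ge i.2))
  left_inv u := by funext i; ext; simp
  right_inv z := by
    refine Subtype.ext (funext fun i => ?_)
    by_cases h : i ∈ K
    · simp [h]
    · have : z.1 i = 0 := by by_contra h'; exact h (z.2.le (mem_csupp.2 h'))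
      simp [h, this]
  continuous_toFun := by
    refine Continuous.subtype_mk (continuous_pi fun i => ?_) _
    by_cases h : i ∈ K
    · simp only [h, dif_pos]
      exact Units.continuous_val.comp (continuous_apply _)
    · simp only [h, dif_neg, not_false_iff]
      exact continuous_const
  continuous_invFun := by
    refine continuous_pi fun i => ?_
    rw [Units.continuous_iff]
    have hc : Continuous fun z : {z : Fin m → ℂ // csupp z = K} => z.1 i.1 :=
      (continuous_apply i.1).comp continuous_subtype_val
    refine ⟨hc, ?_⟩
    simp only [Units.val_inv_eq_inv_val, Units.val_mk0]
    exact hc.inv₀ fun z => mem_csupp.1 (z.2.ge i.2)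

theorem continuous_torusHom (i : Fin m) : Continuous fun t => X.torusHom t i := by
  change Continuous fun t : Fin r → ℂˣ => ∏ a, t a ^ X.D i a
  exact continuous_finsetProd _ fun a _ => (continuous_apply a).zpow _

/-- The characters `D_i`, `i ∈ I`, define a finite covering `𝕋 → (ℂˣ)^I`. Every orbit on which the
coordinates in `I` do not vanish then contains points with all these coordinates equal to `1`. -/
structure IsFrame (I : Finset (Fin m)) : Prop where
  surjective : ∀ y : Fin m → ℂˣ, ∃ t, ∀ i ∈ I, X.torusHom t i = y i
  finite : Finite (X.charKer I)

/-- The point with coordinates `1` in `I`, those of `y` in `J \ I`, and `0` elsewhere. -/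
def slice (I J : Finset (Fin m)) (y : Fin m → ℂ) : Fin m → ℂ :=
  fun i => if i ∈ I then 1 else if i ∈ J then y i else 0

theorem continuous_slice (I J : Finset (Fin m)) : Continuous (slice I J) := by
  refine continuous_pi fun i => ?_
  by_cases h : i ∈ I
  · simp only [slice, h, if_true]; fun_prop
  · by_cases h' : i ∈ J
    · simp only [slice, h, h', if_true, if_false]; fun_prop
    · simp only [slice, h, h', if_false]; fun_prop

theorem csupp_slice (I J : Finset (Fin m)) (y : Fin m → ℂ) :
    csupp (slice I J y) = I ∪ (csupp y ∩ J) := by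
  ext i
  by_cases h : i ∈ I <;> by_cases h' : i ∈ J <;> simp [slice, h, h']

theorem act_slice {I J : Finset (Fin m)} {t : Fin r → ℂˣ} (ht : t ∈ X.charKer I)
    (y : Fin m → ℂ) : slice I J (X.act t y) = X.act t (slice I J y) := by
  funext i
  by_cases h : i ∈ I
  · simp [slice, act, h, ht i h]
  · by_cases h' : i ∈ J <;> simp [slice, act, h, h']

/-- The orbits of the points `slice I J y`. -/
def orbitSlice (I J : Finset (Fin m)) : C(Fin m → ℂ, X.OrbitSpace) :=
  ⟨fun y => X.orbit (slice I J y),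
    X.isOpenQuotientMap_orbit.continuous.comp (continuous_slice I J)⟩

theorem qsupp_orbitSlice (I J : Finset (Fin m)) (y : Fin m → ℂ) :
    X.qsupp (X.orbitSlice I J y) = I ∪ (csupp y ∩ J) := csupp_slice I J y

section Covering
variable {I J' : Finset (Fin m)}

/-- The orbits of the points with coordinates `1` in `I` and `u` in `J'`. -/
def stratumMap (I J' : Finset (Fin m)) (u : J' → ℂˣ) : {q : X.OrbitSpace // X.qsupp q = I ∪ J'} :=
  ⟨X.orbitSlice I J' (coreHomeo J' u).1, by
    rw [qsupp_orbitSlice, (coreHomeo J' u).2, Finset.inter_self]⟩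

theorem continuous_stratumMap : Continuous (X.stratumMap I J') :=
  Continuous.subtype_mk ((X.orbitSlice I J').continuous.comp
    (continuous_subtype_val.comp (coreHomeo J').continuous)) _

/-- The homomorphism `𝕋 × (ℂˣ)^J' → (ℂˣ)^(I ∪ J')` that moves the points of the slice along their
orbits. -/
def frameHom (I J' : Finset (Fin m)) :
    ((Fin r → ℂˣ) × (J' → ℂˣ)) →* ((I ∪ J' : Finset (Fin m)) → ℂˣ) where
  toFun x i := X.torusHom x.1 i.1 * if h : i.1 ∈ J' then x.2 ⟨i.1, h⟩ else 1
  map_one' := by funext i; simp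
  map_mul' x y := by
    funext i
    by_cases h : i.1 ∈ J'
    · simp [h, mul_mul_mul_comm]
    · simp [h]

theorem continuous_frameHom : Continuous (X.frameHom I J') := by
  refine continuous_pi fun i => ?_
  refine ((X.continuous_torusHom i.1).comp continuous_fst).mul ?_
  by_cases h : i.1 ∈ J'
  · simp only [h, dif_pos]; fun_prop
  · simp only [h, dif_neg, not_false_iff]; fun_prop

theorem orbit_coreHomeo_frameHom (hd : Disjoint I J') (x : (Fin r → ℂˣ) × (J' → ℂˣ)) :
    X.orbit (coreHomeo (I ∪ J') (X.frameHom I J' x)).1 = (X.stratumMap I J' x.2).1 := by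
  refine (orbit_eq_iff.2 ⟨x.1, ?_⟩).symm
  funext i
  by_cases hi : i ∈ I
  · have : i ∉ J' := Finset.disjoint_left.1 hd hi
    simp [act, slice, coreHomeo, frameHom, hi, this]
  · by_cases hj : i ∈ J' <;> simp [act, slice, coreHomeo, frameHom, hi, hj]

theorem surjective_frameHom (hI : X.IsFrame I) :
    Function.Surjective (X.frameHom I J') := by
  intro y
  obtain ⟨t, ht⟩ := hI.surjective fun i => if h : i ∈ I ∪ J' then y ⟨i, h⟩ else 1
  refine ⟨(t, fun j => (X.torusHom t j.1)⁻¹ * y ⟨j.1, Finset.mem_union_right _ j.2⟩), ?_⟩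
  funext i
  by_cases hj : i.1 ∈ J'
  · simp [frameHom, hj]
  · have hi : i.1 ∈ I := (Finset.mem_union.1 i.2).resolve_right hj
    have := ht i hi
    rw [dif_pos i.2] at this
    simp [frameHom, hj, this]

/-- The open mapping theorem for `σ`-compact groups makes `frameHom` open, and hence also the map
from the slice to the stratum. -/
theorem isOpenQuotientMap_stratumMap (hI : X.IsFrame I) (hd : Disjoint I J') :
    IsOpenQuotientMap (X.stratumMap I J') := by
  let ρ : {z : Fin m → ℂ // csupp z = I ∪ J'} → {q : X.OrbitSpace // X.qsupp q = I ∪ J'} :=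
    fun z => ⟨X.orbit z.1, z.2⟩
  have hρ : IsOpenMap ρ :=
    X.isOpenQuotientMap_orbit.isOpenMap.restrictPreimage {q | X.qsupp q = I ∪ J'}
  have : SecondCountableTopology ℂˣ := Units.isEmbedding_embedProduct.secondCountableTopology
  have : SigmaCompactSpace ℂˣ := sigmaCompactSpace_of_locallyCompact_secondCountable
  have hΨ : IsOpenMap (X.frameHom I J') :=
    (X.frameHom I J').isOpenMap_of_sigmaCompact (X.surjective_frameHom hI)
      X.continuous_frameHom
  have hc : ρ ∘ coreHomeo (I ∪ J') ∘ X.frameHom I J' = X.stratumMap I J' ∘ Prod.snd := by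
    funext x
    exact Subtype.ext (X.orbit_coreHomeo_frameHom hd x)
  have ho : IsOpenMap (X.stratumMap I J' ∘ Prod.snd (α := Fin r → ℂˣ)) :=
    hc ▸ hρ.comp ((coreHomeo _).isOpenMap.comp hΨ)
  refine ⟨?_, X.continuous_stratumMap, ?_⟩
  · rintro ⟨⟨z⟩, hz⟩
    obtain ⟨u, hu⟩ := (coreHomeo (I ∪ J')).surjective ⟨z, hz⟩
    obtain ⟨x, rfl⟩ := X.surjective_frameHom hI u
    refine ⟨x.2, Subtype.ext ?_⟩
    rw [← X.orbit_coreHomeo_frameHom hd x, hu]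
    rfl
  · intro U hU
    have := ho _ (hU.preimage continuous_snd)
    rwa [Set.image_comp, Set.image_preimage_eq _ Prod.snd_surjective] at this

/-- The homomorphism `𝕋 → (ℂˣ)^J'` given by the characters `D_j`, `j ∈ J'`. -/
def charHom (J' : Finset (Fin m)) : (Fin r → ℂˣ) →* (J' → ℂˣ) where
  toFun t j := X.torusHom t j.1
  map_one' := by funext i; simp
  map_mul' x y := by funext i; simp

theorem act_coreHomeo (t : Fin r → ℂˣ) (u : J' → ℂˣ) :
    X.act t (coreHomeo J' u).1 = (coreHomeo J' (X.charHom J' t * u)).1 := by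
  funext i
  by_cases hi : i ∈ J' <;> simp [act, coreHomeo, charHom, hi]

theorem stratumMap_eq_iff (hd : Disjoint I J') {u v : J' → ℂˣ} :
    X.stratumMap I J' u = X.stratumMap I J' v ↔ ∃ t ∈ X.charKer I, X.charHom J' t * u = v := by
  rw [Subtype.ext_iff]
  refine orbit_eq_iff.trans (exists_congr fun t => ?_)
  constructor
  · intro h
    constructor
    · intro i hi
      have := congrFun h i
      simpa [act, slice, hi] using this
    · funext j
      have hj : j.1 ∉ I := fun h => Finset.disjoint_left.1 hd h j.2
      have := congrFun h j.1
      ext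
      simpa [act, slice, hj, coreHomeo, charHom] using this
  · rintro ⟨ht, rfl⟩
    rw [← X.act_slice ht, act_coreHomeo]

/-- A stratum is the quotient of a torus by translations by the finite image of `charKer I`. -/
theorem isCoveringMap_stratumMap (hI : X.IsFrame I) (hd : Disjoint I J') :
    IsCoveringMap (X.stratumMap I J') := by
  have := hI.finite
  let G : Subgroup (J' → ℂˣ) := (X.charKer I).map (X.charHom J')
  have hG : (G : Set (J' → ℂˣ)).Finite := (Set.toFinite (X.charKer I : Set (Fin r → ℂˣ))).image _
  refine ((X.isOpenQuotientMap_stratumMap hI hd).isQuotientMap.isQuotientCoveringMap_of_subgroup G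
    hG.isDiscrete fun {u v} => (X.stratumMap_eq_iff hd).trans ?_).isCoveringMap
  refine exists_congr fun t => and_congr_right fun _ => ?_
  rw [eq_mul_inv_iff_mul_eq]

/-- Every element of the torus acts by a map that is homotopic to the identity through maps preserving
the supports. -/
theorem exists_homotopy_act (t : Fin r → ℂˣ) :
    ∃ F : C((Fin m → ℂ) × unitInterval, Fin m → ℂ), (∀ y, F (y, 0) = y) ∧
      (∀ y, F (y, 1) = X.act t y) ∧ ∀ y s, csupp (F (y, s)) = csupp y := by
  refine ⟨⟨fun x i => Complex.exp ((x.2 : ℝ) * Complex.log (X.torusHom t i)) * x.1 i, ?_⟩,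
    fun y => ?_, fun y => ?_, fun y s => ?_⟩
  · fun_prop
  · funext i; simp
  · funext i
    simp [act, Complex.exp_log]
  · ext i; simp

/-- With complex coefficients, the stratum of the orbits with support `I ∪ J'` has the homology of
the torus `(ℂˣ)^J'`, of which it is a finite quotient. -/
theorem hIso_stratum (hI : X.IsFrame I) {J : Finset (Fin m)} (hJ : J' ⊆ J) (hd : Disjoint I J') :
    HIso (X.orbitSlice I J) {y | csupp y = J'} {q | X.qsupp q = I ∪ J'} := by
  have := hI.finite
  have := Fintype.ofFinite (X.charKer I)
  have hcov := X.isCoveringMap_stratumMap hI hd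
  have hsl : ∀ y : Fin m → ℂ, csupp y = J' → slice I J y = slice I J' y := by
    intro y hy
    funext i
    by_cases hi : i ∈ I
    · simp [slice, hi]
    · by_cases hj : i ∈ J'
      · simp [slice, hi, hj, hJ hj]
      · have : y i = 0 := by by_contra h; exact hj (hy ▸ mem_csupp.2 h)
        simp [slice, hi, hj, this]
  refine HIso.of_finite_quotient (G := X.charKer I) (X.orbitSlice I J) ?_
    (fun t => ⟨X.act t.1, X.continuous_act t.1⟩) ?_ ?_ ?_ ?_ ?_ ?_
  · intro y hy
    have hy : csupp y = J' := hy
    change X.qsupp _ = _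
    rw [qsupp_orbitSlice, hy, Finset.inter_eq_left.2 hJ]
  · intro t y hy
    exact (X.csupp_act t.1 y).trans hy
  · intro a b
    ext1 y
    exact X.act_mul a.1 b.1 y
  · intro t
    ext1 y
    change X.orbit (slice I J (X.act t.1 y)) = X.orbit (slice I J y)
    rw [X.act_slice t.2, X.orbit_act]
  · intro k s hs
    obtain ⟨l, hl⟩ := exists_lift hcov (X.isOpenQuotientMap_stratumMap hI hd).surjective
      ⟨fun w => ⟨s w, hs w⟩, by fun_prop⟩
    refine ⟨⟨fun w => (coreHomeo J' (l w)).1,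
      continuous_subtype_val.comp ((coreHomeo J').continuous.comp l.continuous)⟩,
      fun w => (coreHomeo J' (l w)).2, ?_⟩
    ext1 w
    refine Eq.trans ?_ (congrArg Subtype.val (hl w))
    exact congrArg X.orbit (hsl _ (coreHomeo J' (l w)).2)
  · intro k l l' hl hl' h
    have hL : ∀ l : C(Splx k, Fin m → ℂ), (∀ w, csupp (l w) = J') →
        ∃ L : C(Splx k, J' → ℂˣ), ∀ w, (coreHomeo J' (L w)).1 = l w := by
      intro l hl
      refine ⟨⟨fun w => (coreHomeo J').symm ⟨l w, hl w⟩,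
        (coreHomeo J').symm.continuous.comp (by fun_prop)⟩, fun w => ?_⟩
      simp
    obtain ⟨L, hL1⟩ := hL l hl
    obtain ⟨L', hL2⟩ := hL l' hl'
    have hp : ∀ w, X.stratumMap I J' (L w) = X.stratumMap I J' (L' w) := by
      intro w
      refine Subtype.ext ?_
      have := DFunLike.congr_fun h w
      change X.orbit (slice I J' _) = X.orbit (slice I J' _)
      rw [hL1, hL2, ← hsl _ (hl w), ← hsl _ (hl' w)]
      exact this
    rcases isEmpty_or_nonempty (Splx k) with hk | ⟨⟨v⟩⟩
    · exact ⟨1, by ext1 w; exact hk.elim w⟩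
    obtain ⟨t, ht, htv⟩ := (X.stratumMap_eq_iff hd).1 (hp v)
    have key : (fun w => X.charHom J' t * L w) = L' := by
      refine hcov.eq_of_comp_eq (continuous_const.mul L.continuous) L'.continuous ?_ v htv
      funext w
      rw [Function.comp_apply, Function.comp_apply, ← hp w]
      exact ((X.stratumMap_eq_iff hd).2 ⟨t, ht, rfl⟩).symm
    refine ⟨⟨t, ht⟩, ?_⟩
    ext1 w
    change l' w = X.act t (l w)
    rw [← hL1, ← hL2, act_coreHomeo, ← key]
  · intro t k z hz
    obtain ⟨F, h0, h1, h2⟩ := X.exists_homotopy_act t.1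
    have := push_sub_push_mem_B F (f := ContinuousMap.id _)
      (g := ⟨X.act t.1, X.continuous_act t.1⟩) h0 h1 (A := {y | csupp y = J'})
      (A' := {y | csupp y = J'}) (fun y hy s => (h2 y s).trans hy) hz
    rwa [push_id] at this

/-- Intersections of charts have the homology of the corresponding open subsets of the slice. Both
deform to a single stratum, where `hIso_stratum` applies. -/
theorem hIso_chart_inter (hI : X.IsFrame I) {J : Finset (Fin m)} (hJ : J' ⊆ J) (hIJ : I ⊆ J)
    (hd : Disjoint I J') :
    HIso (X.orbitSlice I J) {y | J' ⊆ csupp y} {q | I ∪ J' ⊆ X.qsupp q ∧ X.qsupp q ⊆ J} := by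
  refine HIso.of_comp_right (f := ContinuousMap.id _) ?_ (hIso_affine_core J') ?_
  · exact HIso.comp (f := X.orbitSlice I J) (g := ContinuousMap.id _)
      (X.hIso_core (Finset.union_subset hIJ hJ)) (X.hIso_stratum hI hJ hd)
  · intro y hy
    change _ ⊆ X.qsupp _ ∧ X.qsupp _ ⊆ J
    rw [qsupp_orbitSlice]
    exact ⟨Finset.union_subset_union_right (Finset.subset_inter hy hJ),
      Finset.union_subset hIJ Finset.inter_subset_right⟩

end Covering

end ToricData

/-! ### Attaching the charts of the vertices -/

namespace SingChain

variable {X : Type} [TopologicalSpace X]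

theorem Z_le_B_of_rank_eq_zero {k : ℕ} {A : Set X} (h : Module.rank ℂ (H k A) = 0) :
    Z k A ≤ B k A := by
  intro z hz
  have := (rank_zero_iff.1 h).elim ⟨(B k A).mkQ z, Submodule.mem_map_of_mem hz⟩ 0
  have := congrArg Subtype.val this
  exact (Submodule.Quotient.mk_eq_zero _).1 this

theorem rank_H_zero {A : Set X} (hA : A.Nonempty) : Module.rank ℂ (H 0 A) = 0 := by
  obtain ⟨x, hx⟩ := hA
  refine rank_H_eq_zero fun z _ => ?_
  exact B_mono (Set.singleton_subset_iff.2 hx) (acyclic_singleton x 0 (mem_ChS_zero _ z))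

end SingChain

namespace ToricData
open SingChain

variable {m r : ℕ} (X : ToricData m r)

/-- A chart `{I ⊆ qsupp ⊆ J}` of the orbit space contracts to a single orbit. -/
theorem acyclic_chart {I J : Finset (Fin m)} (hI : X.IsFrame I) (hIJ : I ⊆ J) :
    Acyclic {q | I ⊆ X.qsupp q ∧ X.qsupp q ⊆ J} := by
  refine Acyclic.of_hIso (X.hIso_core hIJ) ?_
  let p : X.OrbitSpace := X.orbit (slice I ∅ 0)
  have hp : {q | X.qsupp q = I} = {p} := by
    ext q
    obtain ⟨z, rfl⟩ := X.isOpenQuotientMap_orbit.surjective q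
    constructor
    · intro h
      have h : csupp z = I := h
      obtain ⟨t, ht⟩ := hI.surjective fun i => if h : z i ≠ 0 then Units.mk0 (z i) h else 1
      refine (orbit_eq_iff.2 ⟨t, ?_⟩).symm
      funext i
      by_cases hi : i ∈ I
      · have hz : z i ≠ 0 := mem_csupp.1 (h.ge hi)
        simp [act, slice, hi, ht i hi, hz]
      · have hz : z i = 0 := by by_contra h'; exact hi (h.le (mem_csupp.2 h'))
        simp [act, slice, hi, hz]
    · intro h
      have h : X.orbit z = p := h
      change X.qsupp _ = I
      rw [h, qsupp_orbit, csupp_slice, Finset.inter_empty, Finset.union_empty]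
  rw [hp]
  exact acyclic_singleton p

/-- In the chart of a frame `I`, the orbits whose support contains some member of the non-empty list
`K :: F` have the homology of the corresponding subset of the slice. This follows by Mayer–Vietoris
from the case of one member, since the locus of `K` meets the locus of the list `F` in the locus of
the list of all `K ∪ L` with `L ∈ F`, which is as long as `F`. -/
theorem hIso_chart_union {I J : Finset (Fin m)} (hI : X.IsFrame I) (hIJ : I ⊆ J)
    (K : Finset (Fin m)) (F : List (Finset (Fin m))) (hF : ∀ L ∈ K :: F, L ⊆ J ∧ Disjoint I L) :
    HIso (X.orbitSlice I J) {y | ∃ L ∈ K :: F, L ⊆ csupp y}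
      {q | (∃ L ∈ K :: F, I ∪ L ⊆ X.qsupp q) ∧ X.qsupp q ⊆ J} := by
  induction hn : F.length generalizing K F with
  | zero =>
    rw [List.length_eq_zero_iff] at hn
    subst hn
    have h := X.hIso_chart_inter hI (hF K (by simp)).1 hIJ (hF K (by simp)).2
    simpa using h
  | succ n ih =>
    obtain ⟨L, F, rfl⟩ := List.exists_cons_of_length_eq_add_one hn
    have hA := X.hIso_chart_inter hI (hF K (by simp)).1 hIJ (hF K (by simp)).2
    have hB := ih L F (fun L' hL' => hF L' (List.mem_cons_of_mem _ hL')) (by simpa using hn)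
    have hAB := ih (K ∪ L) (F.map (K ∪ ·)) (by
      intro M hM
      obtain ⟨L', hL', rfl⟩ : ∃ L' ∈ L :: F, K ∪ L' = M := by
        simpa [eq_comm (a := M)] using hM
      have h1 := hF K (by simp)
      have h2 := hF L' (List.mem_cons_of_mem _ hL')
      exact ⟨Finset.union_subset h1.1 h2.1, Finset.disjoint_union_right.2 ⟨h1.2, h2.2⟩⟩)
      (by simpa using hn)
    have e1 : {y : Fin m → ℂ | K ⊆ csupp y} ∩ {y | ∃ M ∈ L :: F, M ⊆ csupp y} =
        {y | ∃ M ∈ (K ∪ L) :: F.map (K ∪ ·), M ⊆ csupp y} := by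
      ext y
      simp [Finset.union_subset_iff]
      tauto
    have e2 : {q | I ∪ K ⊆ X.qsupp q ∧ X.qsupp q ⊆ J} ∩
        {q | (∃ M ∈ L :: F, I ∪ M ⊆ X.qsupp q) ∧ X.qsupp q ⊆ J} =
        {q | (∃ M ∈ (K ∪ L) :: F.map (K ∪ ·), I ∪ M ⊆ X.qsupp q) ∧ X.qsupp q ⊆ J} := by
      ext q
      simp [Finset.union_subset_iff]
      tauto
    have ho1 : ∀ M : Finset (Fin m), IsOpen {y : Fin m → ℂ | M ⊆ csupp y} := fun M =>
      (X.isOpen_subset_qsupp M).preimage X.isOpenQuotientMap_orbit.continuous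
    have ho1' : IsOpen {y : Fin m → ℂ | ∃ M ∈ L :: F, M ⊆ csupp y} := by
      have : {y : Fin m → ℂ | ∃ M ∈ L :: F, M ⊆ csupp y} = ⋃ M ∈ L :: F, {y | M ⊆ csupp y} := by
        ext; simp
      rw [this]
      exact isOpen_biUnion fun M _ => ho1 M
    have ho2' : IsOpen {q : X.OrbitSpace | ∃ M ∈ L :: F, I ∪ M ⊆ X.qsupp q} := by
      have : {q : X.OrbitSpace | ∃ M ∈ L :: F, I ∪ M ⊆ X.qsupp q} =
          ⋃ M ∈ L :: F, {q | I ∪ M ⊆ X.qsupp q} := by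
        ext; simp
      rw [this]
      exact isOpen_biUnion fun M _ => X.isOpen_subset_qsupp _
    have hr1 := RelOpen.of_inter (W := Set.univ) (ho1 K) ho1'
    rw [Set.inter_univ, Set.inter_univ] at hr1
    have hr2 := RelOpen.of_inter (W := {q | X.qsupp q ⊆ J}) (X.isOpen_subset_qsupp (I ∪ K)) ho2'
    have key := HIso.union hr1 hr2 hA hB (by rw [e1]; exact e2 ▸ hAB)
    convert! key using 1
    · ext y; simp
    · ext q
      simp
      tauto

/-- The real and imaginary parts of the coordinates. -/
def reim (i : Fin m × Bool) : (Fin m → ℂ) →L[ℝ] ℝ :=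
  (if i.2 then Complex.reCLM else Complex.imCLM).comp (ContinuousLinearMap.proj i.1)

/-- The space `ℂ^m` without the coordinate subspace `{y_i = 0 for i ∈ E}` has the reduced homology
of the sphere of dimension `2 |E| - 1`. -/
theorem rank_H_affine_sphere (E : Finset (Fin m)) (k : ℕ) :
    Module.rank ℂ (H k {y : Fin m → ℂ | ∃ i ∈ E, y i ≠ 0}) = if k = 2 * E.card then 1 else 0 := by
  have h := rank_H_sphere (X := Fin m → ℂ) (ι := Fin m × Bool) reim
    (fun i => Pi.single i.1 (if i.2 then 1 else Complex.I)) ?_ (E ×ˢ Finset.univ) k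
  · have e : {y : Fin m → ℂ | ∃ i ∈ E ×ˢ (Finset.univ : Finset Bool), reim i y ≠ 0} =
        {y : Fin m → ℂ | ∃ i ∈ E, y i ≠ 0} := by
      ext y
      constructor
      · rintro ⟨⟨i, b⟩, hi, h⟩
        refine ⟨i, (Finset.mem_product.1 hi).1, fun h0 => h ?_⟩
        cases b <;> simp [reim, h0]
      · rintro ⟨i, hi, h⟩
        by_cases hre : (y i).re = 0
        · refine ⟨(i, false), by simp [hi], fun him => h (Complex.ext hre ?_)⟩
          simpa [reim] using him
        · exact ⟨(i, true), by simp [hi], by simpa [reim] using hre⟩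
    rw [e] at h
    rw [h, Finset.card_product, mul_comm]
    simp
  · rintro ⟨i, a⟩ ⟨j, b⟩
    by_cases hij : i = j
    · subst hij
      cases a <;> cases b <;> simp [reim]
    · cases a <;> cases b <;> simp [reim, hij]

/-- The union of the charts of a set of frames. -/
def chartUnion (J : Finset (Fin m)) (S : Finset (Finset (Fin m))) : Set X.OrbitSpace :=
  {q | (∃ I ∈ S, I ⊆ X.qsupp q) ∧ X.qsupp q ⊆ J}

/-- If the frames `I` are ordered by a cost function in such a way that each chart `{I ⊆ qsupp ⊆ J}`
meets the union of the charts of lower cost in a set of the form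
`{I ⊆ qsupp ⊆ J, qsupp ∩ E ≠ ∅}`, a finite quotient of an odd-dimensional sphere up to homotopy,
then attaching the charts one by one creates one homology class of even degree for each of them.
The index `k` stands for the reduced homology of degree `k - 1`. -/
theorem exists_betti (J : Finset (Fin m)) (V : Finset (Finset (Fin m)))
    (cost : Finset (Fin m) → ℝ) (hV : ∀ I ∈ V, X.IsFrame I ∧ I ⊆ J)
    (hinj : ∀ I ∈ V, ∀ I' ∈ V, cost I = cost I' → I = I')
    (hE : ∀ I ∈ V, ∃ E ⊆ J \ I, ∀ K, I ⊆ K → K ⊆ J →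
      ((∃ I' ∈ V, cost I' < cost I ∧ I' ⊆ K) ↔ ∃ l ∈ E, l ∈ K))
    (hne : V.Nonempty) :
    ∃ β : ℕ →₀ ℕ, (∀ k, Module.rank ℂ (H k (X.chartUnion J V)) = β k) ∧
      (∀ k, Even k → β k = 0) ∧ (β.sum fun _ n => n) + 1 = V.card := by
  suffices h : ∀ S : Finset (Finset (Fin m)), S ⊆ V →
      (∀ I ∈ S, ∀ I' ∈ V, cost I' < cost I → I' ∈ S) → S.Nonempty →
      ∃ β : ℕ →₀ ℕ, (∀ k, Module.rank ℂ (H k (X.chartUnion J S)) = β k) ∧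
      (∀ k, Even k → β k = 0) ∧ (β.sum fun _ n => n) + 1 = S.card from
    h V le_rfl (fun _ _ I' hI' _ => hI') hne
  intro S
  -- Induction on the sets of frames that contain with each frame all frames of lower cost.
  induction S using Finset.induction_on_max_value cost with
  | empty => exact fun _ _ h => absurd h Finset.not_nonempty_empty
  | insert a s has hmax ih =>
    intro hsV hdown _
    have haV := hsV (Finset.mem_insert_self a s)
    obtain ⟨haf, haJ⟩ := hV a haV
    have hchart : X.chartUnion J (insert a s) =
        X.chartUnion J s ∪ {q | a ⊆ X.qsupp q ∧ X.qsupp q ⊆ J} := by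
      ext q
      simp only [chartUnion, Finset.exists_mem_insert, or_and_right, Set.mem_union,
        Set.mem_ofPred_eq]
      exact or_comm
    -- The first chart is contractible. It contributes the class of degree zero, which reduced
    -- homology does not see.
    rcases s.eq_empty_or_nonempty with rfl | hs
    · refine ⟨0, fun k => ?_, fun _ _ => rfl, by simp⟩
      have : X.chartUnion J (insert a ∅) = {q | a ⊆ X.qsupp q ∧ X.qsupp q ⊆ J} := by
        ext q; simp [chartUnion]
      rw [this, rank_H_eq_zero (X.acyclic_chart haf haJ k)]
      simp
    obtain ⟨β, hβ, heven, hsum⟩ := ih ((Finset.subset_insert a s).trans hsV)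
      (fun I hI I' hI' hlt => (Finset.mem_insert.1 (hdown I (Finset.mem_insert_of_mem hI) I' hI'
        hlt)).resolve_left fun h => (h ▸ hlt).not_ge (hmax I hI)) hs
    have hlow : ∀ I', (I' ∈ V ∧ cost I' < cost a) ↔ I' ∈ s := by
      intro I'
      constructor
      · rintro ⟨h1, h2⟩
        exact (Finset.mem_insert.1 (hdown a (Finset.mem_insert_self a s) I' h1 h2)).resolve_left
          fun h => (h ▸ h2).ne rfl
      · intro h
        have hIV := hsV (Finset.mem_insert_of_mem h)
        exact ⟨hIV, (hmax I' h).lt_of_ne fun he => has (hinj I' hIV a haV he ▸ h)⟩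
    obtain ⟨E, hEJ, hE⟩ := hE a haV
    have hE' : ∀ K, a ⊆ K → K ⊆ J → ((∃ I' ∈ s, I' ⊆ K) ↔ ∃ l ∈ E, l ∈ K) := by
      intro K h1 h2
      rw [← hE K h1 h2]
      refine exists_congr fun I' => ?_
      rw [← hlow]
      tauto
    have hinter : X.chartUnion J s ∩ {q | a ⊆ X.qsupp q ∧ X.qsupp q ⊆ J} =
        {q | (a ⊆ X.qsupp q ∧ ∃ l ∈ E, l ∈ X.qsupp q) ∧ X.qsupp q ⊆ J} := by
      ext q
      constructor
      · rintro ⟨⟨h1, _⟩, h2, h3⟩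
        exact ⟨⟨h2, (hE' _ h2 h3).1 h1⟩, h3⟩
      · rintro ⟨⟨h1, h2⟩, h3⟩
        exact ⟨⟨(hE' _ h1 h3).2 h2, h3⟩, h1, h3⟩
    obtain ⟨l₀, hl₀, -⟩ : ∃ l ∈ E, l ∈ J := by
      obtain ⟨I', hI'⟩ := hs
      exact (hE' J haJ le_rfl).1 ⟨I', hI', (hV I' (hlow I' |>.2 hI').1).2⟩
    have hrank : ∀ k, Module.rank ℂ (H k (X.chartUnion J s ∩
        {q | a ⊆ X.qsupp q ∧ X.qsupp q ⊆ J})) = if k = 2 * E.card then 1 else 0 := by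
      intro k
      rw [hinter, ← rank_H_affine_sphere E k]
      obtain ⟨l, L, hL⟩ : ∃ l L, E.toList = l :: L :=
        List.exists_cons_of_ne_nil (by
          rw [Ne, Finset.toList_eq_nil]
          exact Finset.ne_empty_of_mem hl₀)
      have hmem : ∀ M, M ∈ ({l} : Finset (Fin m)) :: L.map ({·}) ↔ ∃ j ∈ E, {j} = M := by
        intro M
        have : ({l} : Finset (Fin m)) :: L.map ({·}) = E.toList.map ({·}) := by rw [hL]; rfl
        rw [this]; simp
      have := X.hIso_chart_union haf haJ {l} (L.map ({·})) (by
        intro M hM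
        obtain ⟨j, hj, rfl⟩ := (hmem M).1 hM
        have := Finset.mem_sdiff.1 (hEJ hj)
        exact ⟨Finset.singleton_subset_iff.2 this.1, Finset.disjoint_singleton_right.2 this.2⟩)
      have h := (this.rank_eq k).symm
      have e1 : {q : X.OrbitSpace | (∃ M ∈ ({l} : Finset (Fin m)) :: L.map ({·}),
          a ∪ M ⊆ X.qsupp q) ∧ X.qsupp q ⊆ J} =
          {q | (a ⊆ X.qsupp q ∧ ∃ l ∈ E, l ∈ X.qsupp q) ∧ X.qsupp q ⊆ J} := by
        ext q
        simp only [hmem, exists_exists_and_eq_and, Finset.union_subset_iff,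
          Finset.singleton_subset_iff, Set.mem_ofPred_eq]
        exact and_congr_left fun _ => ⟨fun ⟨l, h2, h1, h3⟩ => ⟨h1, l, h2, h3⟩,
          fun ⟨h1, l, h2, h3⟩ => ⟨l, h2, h1, h3⟩⟩
      have e2 : {y : Fin m → ℂ | ∃ M ∈ ({l} : Finset (Fin m)) :: L.map ({·}), M ⊆ csupp y} =
          {y | ∃ i ∈ E, y i ≠ 0} := by
        ext y
        simp only [hmem, exists_exists_and_eq_and, Finset.singleton_subset_iff, mem_csupp,
          Set.mem_ofPred_eq]
      rwa [e1, e2] at h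
    have hne : (X.chartUnion J s).Nonempty := by
      obtain ⟨I', hI'⟩ := hs
      refine ⟨X.orbit (slice I' ∅ 0), ⟨I', hI', ?_⟩, ?_⟩ <;>
        rw [qsupp_orbit, csupp_slice, Finset.inter_empty, Finset.union_empty]
      exact (hV I' ((hlow I').2 hI').1).2
    have hopen : IsOpen {q : X.OrbitSpace | ∃ I ∈ s, I ⊆ X.qsupp q} := by
      have : {q : X.OrbitSpace | ∃ I ∈ s, I ⊆ X.qsupp q} = ⋃ I ∈ s, {q | I ⊆ X.qsupp q} := by
        ext; simp
      rw [this]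
      exact isOpen_biUnion fun I _ => X.isOpen_subset_qsupp I
    have hrec := rank_H_union (A := X.chartUnion J s)
      (RelOpen.of_inter (W := {q | X.qsupp q ⊆ J}) hopen (X.isOpen_subset_qsupp a))
      (X.acyclic_chart haf haJ) (by
        intro k
        -- The two groups live in indices of different parity, so the map between them is zero.
        rcases Nat.even_or_odd k with hk | hk
        · exact (Z_mono Set.inter_subset_left).trans
            (Z_le_B_of_rank_eq_zero (by rw [hβ, heven k hk, Nat.cast_zero]))
        · refine (Z_le_B_of_rank_eq_zero ?_).trans (B_mono Set.inter_subset_left)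
          refine (hrank k).trans (if_neg ?_)
          rintro rfl
          exact (Nat.not_even_iff_odd.2 hk) (even_two_mul _))
    refine ⟨β + Finsupp.single (2 * E.card + 1) 1, fun k => ?_, fun k hk => ?_, ?_⟩
    · rw [hchart]
      cases k with
      | zero =>
        rw [rank_H_zero (hne.mono Set.subset_union_left)]
        simp [heven 0]
      | succ k =>
        refine (hrec k).trans ?_
        rw [hβ]
        have := hrank k
        refine (congrArg (· + _) this).trans ?_
        rw [Finsupp.add_apply, Finsupp.single_apply, add_comm, Nat.cast_add]
        congr 1
        simp [eq_comm]
    · rw [Finsupp.add_apply, heven k hk, Finsupp.single_apply, if_neg]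
      · rfl
      · rintro rfl
        simp at hk
    · rw [Finsupp.sum_add_index (by simp) (by simp), Finsupp.sum_single_index rfl,
        Finset.card_insert_of_notMem has, ← hsum]

end ToricData

namespace ToricData

variable {m r : ℕ} (X : ToricData m r)

/-! ### Anticones and vertices -/

theorem dotProduct_single_eq {n : ℕ} (f : (Fin n → ℝ) →ₗ[ℝ] ℝ) (x : Fin n → ℝ) :
    x ⬝ᵥ (fun a => f (Pi.single a 1)) = f x := by
  rw [LinearMap.pi_apply_eq_sum_univ f x, dotProduct]
  refine Finset.sum_congr rfl fun a _ => ?_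
  rw [smul_eq_mul]
  congr 2
  funext j
  simp [Pi.single_apply, eq_comm]

/-- The map `c ↦ ∑ c_i D_i`. -/
def comb : (Fin m → ℝ) →ₗ[ℝ] (Fin r → ℝ) := Fintype.linearCombination ℝ X.DR

theorem comb_apply (c : Fin m → ℝ) : X.comb c = ∑ i, c i • X.DR i := rfl

theorem comb_eq_sum {I : Finset (Fin m)} {c : Fin m → ℝ} (h : ∀ i ∉ I, c i = 0) :
    X.comb c = ∑ i ∈ I, c i • X.DR i :=
  (Finset.sum_subset (Finset.subset_univ I) fun i _ hi => by rw [h i hi, zero_smul]).symm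

theorem comb_single (i : Fin m) : X.comb (Pi.single i 1) = X.DR i := by
  simp [comb]

theorem mem_posCone_iff {I : Finset (Fin m)} {x : Fin r → ℝ} :
    x ∈ X.posCone I ↔ ∃ c : Fin m → ℝ, (∀ i ∈ I, 0 < c i) ∧ (∀ i ∉ I, c i = 0) ∧ X.comb c = x := by
  constructor
  · rintro ⟨c, hc, hx⟩
    refine ⟨fun i => if i ∈ I then c i else 0, fun i hi => by simp [hi, hc i hi],
      fun i hi => by simp [hi], ?_⟩
    rw [X.comb_eq_sum (I := I) (fun i hi => by simp [hi]), hx]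
    exact Finset.sum_congr rfl fun i hi => by simp [hi]
  · rintro ⟨c, hc, h0, hx⟩
    exact ⟨c, hc, by rw [← hx, X.comb_eq_sum h0]⟩

theorem mem_anticones_iff {I : Finset (Fin m)} : I ∈ X.anticones ↔
    ∃ c : Fin m → ℝ, (∀ i ∈ I, 0 < c i) ∧ (∀ i ∉ I, c i = 0) ∧ X.comb c = X.η :=
  X.mem_posCone_iff

variable {X}

theorem CondB.exists_comb (hB : X.CondB) {I : Finset (Fin m)} (hI : I ∈ X.anticones)
    (x : Fin r → ℝ) : ∃ a : Fin m → ℝ, (∀ i ∉ I, a i = 0) ∧ X.comb a = x := by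
  have hx : x ∈ Submodule.span ℝ (X.DR '' (I : Set (Fin m))) := by rw [hB I hI]; trivial
  obtain ⟨a, ha⟩ := (Submodule.mem_span_image_finset_iff_exists_fun' ℝ).1 hx
  refine ⟨fun i => if i ∈ I then a i else 0, fun i hi => by simp [hi], ?_⟩
  rw [X.comb_eq_sum (I := I) (fun i hi => by simp [hi]), ← ha]
  exact Finset.sum_congr rfl fun i hi => by simp [hi]

/-- A small positive multiple of an arbitrary vector can be subtracted without losing positivity on
finitely many coordinates. -/
theorem exists_pos_smul_le {I : Finset (Fin m)} {c : Fin m → ℝ} (hc : ∀ i ∈ I, 0 < c i)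
    (a : Fin m → ℝ) : ∃ ε : ℝ, 0 < ε ∧ ∀ i ∈ I, 0 < c i - ε * a i := by
  have h : ∀ i ∈ I, ∀ᶠ ε : ℝ in nhdsWithin 0 (Set.Ioi 0), 0 < c i - ε * a i := by
    intro i hi
    have : Filter.Tendsto (fun ε : ℝ => c i - ε * a i) (nhds 0) (nhds (c i - 0 * a i)) :=
      Continuous.tendsto (by fun_prop) 0
    rw [zero_mul, sub_zero] at this
    exact (this.eventually (lt_mem_nhds (hc i hi))).filter_mono nhdsWithin_le_nhds
  obtain ⟨ε, h1, h2⟩ := (((Finset.eventually_all I).2 h).and self_mem_nhdsWithin).exists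
  exact ⟨ε, h2, h1⟩

/-- Anticones are closed under enlargement: a small positive amount of the new `D_i` is compensated
by the old ones, which span. -/
theorem CondB.anticones_mono (hB : X.CondB) {I K : Finset (Fin m)} (hI : I ∈ X.anticones)
    (hIK : I ⊆ K) : K ∈ X.anticones := by
  obtain ⟨c, hc, hc0, hη⟩ := X.mem_anticones_iff.1 hI
  let d : Fin m → ℝ := fun i => if i ∈ K \ I then 1 else 0
  obtain ⟨a, ha0, ha⟩ := hB.exists_comb hI (X.comb d)
  obtain ⟨ε, hε, h⟩ := exists_pos_smul_le hc a
  refine X.mem_anticones_iff.2 ⟨c - ε • a + ε • d, fun i hi => ?_, fun i hi => ?_, ?_⟩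
  · by_cases hi' : i ∈ I
    · simpa [d, hi'] using h i hi'
    · simpa [d, hi', hi, hc0 i hi', ha0 i hi'] using hε
  · have hi' : i ∉ I := fun h => hi (hIK h)
    simp [d, hi, hc0 i hi', ha0 i hi']
  · rw [map_add, map_sub, map_smul, map_smul, ha, hη]; abel

variable (X) in
open scoped Classical in
/-- The minimal anticones: the sets `I ∈ 𝒜` with `r` elements. They correspond to the vertices of
the polyhedron `{c ≥ 0, ∑ c_i D_i = η}`. -/
def vertices : Finset (Finset (Fin m)) :=
  Finset.univ.filter fun I => I ∈ X.anticones ∧ I.card = r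

theorem mem_vertices {I : Finset (Fin m)} :
    I ∈ X.vertices ↔ I ∈ X.anticones ∧ I.card = r := by simp [vertices]

theorem CondB.linearIndependent (hB : X.CondB) {I : Finset (Fin m)} (hI : I ∈ X.vertices) :
    LinearIndependent ℝ fun i : I => X.DR i := by
  obtain ⟨hA, hr⟩ := mem_vertices.1 hI
  refine linearIndependent_of_top_le_span_of_card_eq_finrank ?_ (by simp [hr])
  rw [← hB I hA]
  refine le_of_eq (congrArg _ ?_)
  ext x; simp

theorem CondB.exists_dual (hB : X.CondB) {I : Finset (Fin m)} (hI : I ∈ X.vertices)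
    (h : Fin m → ℝ) : ∃ u : Fin r → ℝ, ∀ i ∈ I, X.DR i ⬝ᵥ u = h i := by
  have hli := hB.linearIndependent hI
  obtain ⟨hA, hr⟩ := mem_vertices.1 hI
  let bs : Module.Basis I ℝ (Fin r → ℝ) := Module.Basis.mk hli (by
    rw [← hB I hA]
    refine le_of_eq (congrArg _ ?_)
    ext x; simp)
  let u : (Fin r → ℝ) →ₗ[ℝ] ℝ := bs.constr ℝ fun i => h i
  refine ⟨fun a => u (Pi.single a 1), fun i hi => ?_⟩
  have h1 : u (X.DR i) = h i := by
    have := bs.constr_basis ℝ (fun i => h i) ⟨i, hi⟩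
    rwa [Module.Basis.mk_apply] at this
  rw [← h1, dotProduct_single_eq]

/-- The vertex `v_I` of the polyhedron `{c ≥ 0, ∑ c_i D_i = η}`. -/
def vertex (I : Finset (Fin m)) (hI : I ∈ X.vertices) : Fin m → ℝ :=
  (X.mem_anticones_iff.1 (mem_vertices.1 hI).1).choose

section
variable {I : Finset (Fin m)} (hI : I ∈ X.vertices)

theorem vertex_pos {i : Fin m} (hi : i ∈ I) : 0 < vertex I hI i :=
  (X.mem_anticones_iff.1 (mem_vertices.1 hI).1).choose_spec.1 i hi

theorem vertex_eq_zero {i : Fin m} (hi : i ∉ I) : vertex I hI i = 0 :=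
  (X.mem_anticones_iff.1 (mem_vertices.1 hI).1).choose_spec.2.1 i hi

theorem comb_vertex : X.comb (vertex I hI) = X.η :=
  (X.mem_anticones_iff.1 (mem_vertices.1 hI).1).choose_spec.2.2

theorem vertex_nonneg (i : Fin m) : 0 ≤ vertex I hI i := by
  by_cases hi : i ∈ I
  · exact (vertex_pos hI hi).le
  · exact (vertex_eq_zero hI hi).ge

theorem vertex_injective {I' : Finset (Fin m)} (hI' : I' ∈ X.vertices)
    (h : vertex I hI = vertex I' hI') : I = I' := by
  ext i
  constructor <;> intro hi <;> by_contra hi'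
  · exact (vertex_pos hI hi).ne' (h ▸ vertex_eq_zero hI' hi')
  · exact (vertex_pos hI' hi).ne' (h ▸ vertex_eq_zero hI hi')

end

/-- A linear function on the polyhedron `{c ≥ 0, ∑ c_i D_i = η}` takes at some vertex a value at
most as large as at a given point, and the vertex can be chosen in the smallest face that contains
the point. -/
theorem exists_vertex_le (hB : X.CondB) (hC : X.CondC) (h c : Fin m → ℝ) (hc : ∀ i, 0 ≤ c i)
    (hη : X.comb c = X.η) :
    ∃ I, ∃ hI : I ∈ X.vertices, (∀ i ∈ I, 0 < c i) ∧ h ⬝ᵥ vertex I hI ≤ h ⬝ᵥ c := by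
  classical
  induction hn : (Finset.univ.filter fun i => 0 < c i).card using Nat.strong_induction_on
    generalizing c with
  | _ n ih =>
    set K := Finset.univ.filter fun i => 0 < c i with hK
    have hmem : ∀ i, i ∈ K ↔ 0 < c i := by simp [hK]
    have hc0 : ∀ i ∉ K, c i = 0 := fun i hi =>
      le_antisymm (not_lt.1 fun h => hi ((hmem i).2 h)) (hc i)
    have hKA : K ∈ X.anticones := X.mem_anticones_iff.2 ⟨c, fun i hi => (hmem i).1 hi, hc0, hη⟩
    by_cases hli : ∀ a : Fin m → ℝ, (∀ i ∉ K, a i = 0) → X.comb a = 0 → a = 0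
    -- If the `D_i` with `c_i > 0` are independent, then `c` itself is a vertex.
    · have hlin : LinearIndependent ℝ fun i : K => X.DR i := by
        rw [Fintype.linearIndependent_iff]
        intro a ha i
        have := hli (fun i => if h : i ∈ K then a ⟨i, h⟩ else 0) (fun i hi => by simp [hi]) (by
          rw [X.comb_eq_sum (I := K) (fun i hi => by simp [hi]), ← ha, ← Finset.sum_coe_sort K]
          exact Finset.sum_congr rfl fun i _ => by simp)
        simpa using congrFun this i
      have hcard : K.card = r := by
        have h1 := finrank_span_eq_card hlin
        have h2 : Set.range (fun i : K => X.DR i) = X.DR '' (K : Set (Fin m)) := by ext x; simp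
        rw [h2, hB K hKA] at h1
        simpa using h1.symm
      have hKV : K ∈ X.vertices := mem_vertices.2 ⟨hKA, hcard⟩
      refine ⟨K, hKV, fun i hi => (hmem i).1 hi, le_of_eq (congrArg _ ?_)⟩
      have := hli (vertex K hKV - c) (fun i hi => by simp [vertex_eq_zero hKV hi, hc0 i hi])
        (by rw [map_sub, comb_vertex, hη, sub_self])
      exact sub_eq_zero.1 this
    -- Otherwise there is a relation `a` among the `D_i` with `c_i > 0`, of non-positive cost. By
    -- condition (C), moving along `a` leaves the polyhedron; at the last point inside, the support
    -- is smaller.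
    · push Not at hli
      obtain ⟨a, ha0, ha, hne⟩ : ∃ a : Fin m → ℝ, (∀ i ∉ K, a i = 0) ∧ X.comb a = 0 ∧
          a ≠ 0 ∧ h ⬝ᵥ a ≤ 0 := by
        obtain ⟨a, ha0, ha, hne⟩ := hli
        rcases le_total (h ⬝ᵥ a) 0 with hle | hle
        · exact ⟨a, ha0, ha, hne, hle⟩
        · exact ⟨-a, fun i hi => by simp [ha0 i hi], by rw [map_neg, ha, neg_zero],
            neg_ne_zero.2 hne, by simpa using hle⟩
      obtain ⟨hne, hle⟩ := hne
      have hneg : (Finset.univ.filter fun i => a i < 0).Nonempty := by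
        by_contra hemp
        rw [Finset.not_nonempty_iff_eq_empty, Finset.filter_eq_empty_iff] at hemp
        exact hne (hC a (fun i => not_lt.1 (hemp (Finset.mem_univ i))) ha)
      obtain ⟨j, hj, hmin⟩ := Finset.exists_min_image _ (fun i => c i / (-a i)) hneg
      have hj' : a j < 0 := by simpa using hj
      have hjK : j ∈ K := by by_contra h; exact hj'.ne (ha0 j h)
      set t := c j / (-a j) with ht
      have ht0 : 0 < t := div_pos ((hmem j).1 hjK) (neg_pos.2 hj')
      let c' := c + t • a
      have hc' : ∀ i, 0 ≤ c' i := by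
        intro i
        change 0 ≤ c i + t * a i
        by_cases hi : a i < 0
        · have := hmin i (by simpa using hi)
          rw [le_div_iff₀ (neg_pos.2 hi)] at this
          linarith
        · exact add_nonneg (hc i) (mul_nonneg ht0.le (not_lt.1 hi))
      have hcj : c' j = 0 := by
        change c j + t * a j = 0
        rw [ht]; field_simp [hj'.ne]; ring
      have hsub : (Finset.univ.filter fun i => 0 < c' i) ⊂ K := by
        refine Finset.ssubset_iff_subset_ne.2 ⟨fun i hi => ?_, fun h => ?_⟩
        · by_contra hK
          have : c' i = 0 := by change c i + t * a i = 0; rw [hc0 i hK, ha0 i hK]; simp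
          simp [this] at hi
        · rw [← h] at hjK
          simp [hcj] at hjK
      have hη' : X.comb c' = X.η := by
        change X.comb (c + t • a) = _
        rw [map_add, map_smul, ha, smul_zero, add_zero, hη]
      obtain ⟨I, hI, hIc, hIh⟩ := ih _ (hn ▸ Finset.card_lt_card hsub) c' hc' hη' rfl
      refine ⟨I, hI, fun i hi => (hmem i).1 (hsub.1 (by simpa using hIc i hi)), hIh.trans ?_⟩
      change h ⬝ᵥ (c + t • a) ≤ _
      rw [dotProduct_add, dotProduct_smul, smul_eq_mul]
      have := mul_nonpos_of_nonneg_of_nonpos ht0.le hle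
      linarith

theorem exists_vertex_subset (hB : X.CondB) (hC : X.CondC) {K : Finset (Fin m)}
    (hK : K ∈ X.anticones) : ∃ I ∈ X.vertices, I ⊆ K := by
  obtain ⟨c, hc, hc0, hη⟩ := X.mem_anticones_iff.1 hK
  have hc' : ∀ i, 0 ≤ c i := fun i => by
    by_cases hi : i ∈ K
    · exact (hc i hi).le
    · exact (hc0 i hi).ge
  obtain ⟨I, hI, hIc, -⟩ := exists_vertex_le hB hC 0 c hc' hη
  exact ⟨I, hI, fun i hi => by by_contra h; exact (hIc i hi).ne' (hc0 i h)⟩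

theorem mem_anticones_iff_exists_vertex (hB : X.CondB) (hC : X.CondC) {K : Finset (Fin m)} :
    K ∈ X.anticones ↔ ∃ I ∈ X.vertices, I ⊆ K :=
  ⟨exists_vertex_subset hB hC, fun ⟨_, hI, h⟩ => hB.anticones_mono (mem_vertices.1 hI).1 h⟩

/-- A linear function that separates the vertices. -/
theorem exists_cost (X : ToricData m r) : ∃ h : Fin m → ℝ, ∀ I, ∀ hI : I ∈ X.vertices,
    ∀ I', ∀ hI' : I' ∈ X.vertices, h ⬝ᵥ vertex I hI = h ⬝ᵥ vertex I' hI' → I = I' := by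
  let ι := {p : X.vertices × X.vertices // p.1 ≠ p.2}
  obtain ⟨f, hf⟩ := Module.exists_dual_forall_apply_ne_zero (K := ℝ)
    (fun p : ι => vertex p.1.1.1 p.1.1.2 - vertex p.1.2.1 p.1.2.2)
    (fun p h => p.2 (Subtype.ext (vertex_injective _ _ (sub_eq_zero.1 h))))
  have key : ∀ c : Fin m → ℝ, (fun i => f (Pi.single i 1)) ⬝ᵥ c = f c := by
    intro c
    rw [dotProduct_comm, dotProduct_single_eq]
  refine ⟨fun i => f (Pi.single i 1), fun I hI I' hI' h => ?_⟩
  by_contra hne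
  refine hf ⟨(⟨I, hI⟩, ⟨I', hI'⟩), fun h => hne (congrArg Subtype.val h)⟩ ?_
  rw [key, key] at h
  simp [h]

/-- The simplex method: a face `{c_i = 0 for i ∉ K}` containing the vertex `v_I` contains a vertex
of lower cost if and only if `K` contains an index `l` whose reduced cost `h_l - D_l · u` at `v_I`
is negative. -/
theorem exists_lower_vertex_iff (hB : X.CondB) (hC : X.CondC) {h : Fin m → ℝ}
    {I : Finset (Fin m)} (hI : I ∈ X.vertices) {u : Fin r → ℝ} (hu : ∀ i ∈ I, X.DR i ⬝ᵥ u = h i)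
    {K : Finset (Fin m)} (hIK : I ⊆ K) :
    (∃ I', ∃ hI' : I' ∈ X.vertices, h ⬝ᵥ vertex I' hI' < h ⬝ᵥ vertex I hI ∧ I' ⊆ K) ↔
      ∃ l ∈ K, h l < X.DR l ⬝ᵥ u := by
  classical
  let red : Fin m → ℝ := fun i => h i - X.DR i ⬝ᵥ u
  have hred : ∀ i ∈ I, red i = 0 := fun i hi => by simp [red, hu i hi]
  -- On the polyhedron, the cost differs from the reduced cost by a constant.
  have hval : ∀ c, X.comb c = X.η → h ⬝ᵥ c = red ⬝ᵥ c + X.η ⬝ᵥ u := by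
    intro c hc
    rw [← hc, comb_apply, sum_dotProduct]
    simp only [dotProduct, red, sub_mul, Finset.sum_sub_distrib, Pi.smul_apply, smul_eq_mul,
      Finset.sum_mul]
    rw [sub_add_eq_add_sub, eq_sub_iff_add_eq]
    congr 1
    exact Finset.sum_congr rfl fun i _ => Finset.sum_congr rfl fun a _ => by ring
  have hvI : red ⬝ᵥ vertex I hI = 0 := by
    refine Finset.sum_eq_zero fun i _ => ?_
    by_cases hi : i ∈ I
    · rw [hred i hi, zero_mul]
    · rw [vertex_eq_zero hI hi, mul_zero]
  constructor
  · rintro ⟨I', hI', hlt, hsub⟩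
    rw [hval _ (comb_vertex hI'), hval _ (comb_vertex hI), hvI, zero_add,
      add_lt_iff_neg_right] at hlt
    obtain ⟨l, -, hl⟩ := Finset.exists_lt_of_sum_lt (g := fun _ => (0 : ℝ))
      (s := Finset.univ) (by simpa [dotProduct] using hlt)
    have hlI : l ∈ I' := by
      by_contra h'
      rw [vertex_eq_zero hI' h', mul_zero] at hl
      exact lt_irrefl _ hl
    have hl' : red l < 0 := by
      by_contra h'
      exact hl.not_ge (mul_nonneg (not_lt.1 h') (vertex_nonneg hI' l))
    exact ⟨l, hsub hlI, sub_neg.1 hl'⟩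
  · rintro ⟨l, hlK, hl⟩
    have hl : red l < 0 := sub_neg.2 hl
    have hlI : l ∉ I := fun h => hl.ne (hred l h)
    obtain ⟨a, ha0, ha⟩ := hB.exists_comb (mem_vertices.1 hI).1 (X.DR l)
    obtain ⟨ε, hε, hpos⟩ := exists_pos_smul_le (fun i hi => vertex_pos hI hi) a
    -- A short step along the edge of the polyhedron on which the coordinate `l` becomes positive.
    let c : Fin m → ℝ := vertex I hI - ε • a + ε • Pi.single l 1
    have hcI : ∀ i, i ≠ l → c i = vertex I hI i - ε * a i := by
      intro i hi
      simp [c, hi]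
    have hcl : c l = ε := by simp [c, vertex_eq_zero hI hlI, ha0 l hlI]
    have hcout : ∀ i, i ∉ I → i ≠ l → c i = 0 := by
      intro i hi hil
      rw [hcI i hil, vertex_eq_zero hI hi, ha0 i hi]; simp
    have hc : ∀ i, 0 ≤ c i := by
      intro i
      by_cases hil : i = l
      · rw [hil, hcl]; exact hε.le
      · by_cases hi : i ∈ I
        · rw [hcI i hil]; exact (hpos i hi).le
        · exact (hcout i hi hil).ge
    have hη : X.comb c = X.η := by
      change X.comb (vertex I hI - ε • a + ε • Pi.single l 1) = _
      rw [map_add, map_sub, map_smul, map_smul, comb_single, ha, comb_vertex]; abel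
    have hcost : h ⬝ᵥ c < h ⬝ᵥ vertex I hI := by
      rw [hval _ hη, hval _ (comb_vertex hI), hvI, zero_add, add_lt_iff_neg_right]
      have : red ⬝ᵥ c = red l * ε := by
        rw [dotProduct, Finset.sum_eq_single l, hcl]
        · intro i _ hil
          by_cases hi : i ∈ I
          · rw [hred i hi, zero_mul]
          · rw [hcout i hi hil, mul_zero]
        · simp
      rw [this]
      exact mul_neg_of_neg_of_pos hl hε
    obtain ⟨I', hI', hIc, hle⟩ := exists_vertex_le hB hC h c hc hη
    refine ⟨I', hI', hle.trans_lt hcost, fun i hi => ?_⟩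
    by_cases hil : i = l
    · exact hil ▸ hlK
    · by_contra hK
      exact (hIc i hi).ne' (hcout i (fun h => hK (hIK h)) hil)

end ToricData

/-! ### The stabilizer of a vertex -/

theorem Matrix.card_quotient_range_mulVecLin {ι : Type*} [Fintype ι] [DecidableEq ι]
    (M : Matrix ι ι ℤ) (hM : M.det ≠ 0) :
    Nat.card ((ι → ℤ) ⧸ LinearMap.range M.mulVecLin) = M.det.natAbs := by
  have hinj : Function.Injective M.mulVecLin := by
    intro x y h
    exact Matrix.mulVec_injective_of_det_ne_zero hM h
  let e : (ι → ℤ) ≃ₗ[ℤ] LinearMap.range M.mulVecLin := LinearEquiv.ofInjective _ hinj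
  rw [← Submodule.natAbs_det_equiv _ e]
  congr 1
  rw [← LinearMap.det_toLin' M]
  rfl

namespace ToricData

variable {m r : ℕ} {X : ToricData m r}

/-- An enumeration of the elements of a minimal anticone. -/
def enum {I : Finset (Fin m)} (hI : I ∈ X.vertices) : Fin r ≃ I :=
  (I.equivFinOfCardEq (mem_vertices.1 hI).2).symm

/-- The square matrix with the rows `D_i`, `i ∈ I`. -/
def charMatrix {I : Finset (Fin m)} (hI : I ∈ X.vertices) : Matrix (Fin r) (Fin r) ℤ :=
  Matrix.of fun j => X.D (enum hI j)

theorem CondB.det_charMatrix_ne_zero (hB : X.CondB) {I : Finset (Fin m)} (hI : I ∈ X.vertices) :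
    (charMatrix hI).det ≠ 0 := by
  have h1 : LinearIndependent ℝ ((charMatrix hI).map (Int.cast : ℤ → ℝ)).row :=
    (hB.linearIndependent hI).comp (enum hI) (enum hI).injective
  have h2 := (Matrix.isUnit_iff_isUnit_det _).1 (Matrix.linearIndependent_rows_iff_isUnit.1 h1)
  intro h0
  have h3 : ((charMatrix hI).map (Int.cast : ℤ → ℝ)).det = ((charMatrix hI).det : ℝ) :=
    ((Int.castRingHom ℝ).map_det _).symm
  rw [h3, h0, Int.cast_zero] at h2
  exact not_isUnit_zero h2

/-- The homomorphism `ℤ^r → ℂˣ` with the given values on the standard basis vectors. -/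
def evalHom (t : Fin r → ℂˣ) : (Fin r → ℤ) →+ Additive ℂˣ where
  toFun z := Additive.ofMul (∏ a, t a ^ z a)
  map_zero' := by simp
  map_add' x y := by simp [zpow_add, Finset.prod_mul_distrib]

theorem evalHom_single (t : Fin r → ℂˣ) (a : Fin r) :
    evalHom t (Pi.single a 1) = Additive.ofMul (t a) := by
  change Additive.ofMul _ = _
  rw [Finset.prod_eq_single a]
  · simp
  · intro b _ hb; simp [hb]
  · simp

/-- The stabilizer of a point with support `I` is the character group of `ℤ^r / ∑_{i ∈ I} ℤ D_i`. -/
theorem CondB.card_charKer (hB : X.CondB) {I : Finset (Fin m)} (hI : I ∈ X.vertices) :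
    Nat.card (X.charKer I) = (charMatrix hI).det.natAbs := by
  have hdet := hB.det_charMatrix_ne_zero hI
  have hcard := Matrix.card_quotient_range_mulVecLin (charMatrix hI).transpose
    (by rwa [Matrix.det_transpose])
  rw [Matrix.det_transpose] at hcard
  rw [← hcard]
  set S := LinearMap.range (charMatrix hI).transpose.mulVecLin with hS
  have hfin : Finite ((Fin r → ℤ) ⧸ S) := Nat.finite_of_card_ne_zero (by
    rw [hcard]; exact Int.natAbs_ne_zero.2 hdet)
  have hfin' : Finite (Multiplicative ((Fin r → ℤ) ⧸ S)) := hfin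
  have hroots : NeZero (Monoid.exponent (Multiplicative ((Fin r → ℤ) ⧸ S)) : ℂ) :=
    ⟨Nat.cast_ne_zero.2 Monoid.exponent_ne_zero_of_finite⟩
  have hd := CommGroup.card_monoidHom_of_hasEnoughRootsOfUnity
    (Multiplicative ((Fin r → ℤ) ⧸ S)) ℂ
  refine Eq.trans ?_ (hd.trans (Nat.card_congr Multiplicative.toAdd))
  symm
  refine (Nat.card_congr AddMonoidHom.toMultiplicativeLeft.symm).trans ?_
  -- A homomorphism to `ℂˣ` corresponds to its values on the standard basis vectors.
  have hmem : ∀ f : ((Fin r → ℤ) ⧸ S) →+ Additive ℂˣ,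
      f.comp S.mkQ.toAddMonoidHom =
        evalHom fun a => (f (S.mkQ (Pi.single a 1))).toMul := by
    intro f
    refine AddMonoidHom.functions_ext' _ _ _ fun a => ?_
    refine AddMonoidHom.ext_int ?_
    change f (S.mkQ (Pi.single a 1)) = evalHom _ (Pi.single a 1)
    rw [evalHom_single]
    rfl
  have hrow : ∀ i (hi : i ∈ I), X.D i ∈ S := by
    intro i hi
    refine ⟨Pi.single ((enum hI).symm ⟨i, hi⟩) 1, ?_⟩
    rw [Matrix.mulVecLin_apply, Matrix.mulVec_single_one]
    funext a
    simp [charMatrix, Matrix.col]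
  refine Nat.card_congr (Equiv.ofBijective (fun f =>
    ⟨fun a => (f (S.mkQ (Pi.single a 1))).toMul, fun i hi => ?_⟩) ⟨?_, ?_⟩)
  · have h1 := DFunLike.congr_fun (hmem f) (X.D i)
    have h2 : (f.comp S.mkQ.toAddMonoidHom) (X.D i) = 0 := by
      change f (S.mkQ (X.D i)) = 0
      rw [Submodule.mkQ_apply, (Submodule.Quotient.mk_eq_zero S).2 (hrow i hi), map_zero]
    exact h1.symm.trans h2
  · intro f g h
    have h : (fun a => (f (S.mkQ (Pi.single a 1))).toMul) =
      fun a => (g (S.mkQ (Pi.single a 1))).toMul := congrArg Subtype.val h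
    have h1 : f.comp S.mkQ.toAddMonoidHom = g.comp S.mkQ.toAddMonoidHom := by
      rw [hmem f, hmem g, h]
    refine AddMonoidHom.ext fun x => ?_
    obtain ⟨x, rfl⟩ := Submodule.Quotient.mk_surjective S x
    exact DFunLike.congr_fun h1 x
  · rintro ⟨t, ht⟩
    have hle : S.toAddSubgroup ≤ (evalHom t).ker := by
      rintro _ ⟨c, rfl⟩
      rw [AddMonoidHom.mem_ker, Matrix.mulVecLin_apply, Matrix.mulVec_eq_sum, map_sum]
      refine Finset.sum_eq_zero fun j _ => ?_
      have h0 : evalHom t (X.D (enum hI j)) = 0 := ht _ (enum hI j).2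
      have h1 : MulOpposite.op (c j) • (charMatrix hI).transpose.transpose j =
          c j • X.D (enum hI j) := by
        funext a
        exact mul_comm _ _
      exact (congrArg (evalHom t) h1).trans (by rw [map_zsmul, h0, smul_zero])
    refine ⟨QuotientAddGroup.lift S.toAddSubgroup (evalHom t) hle, Subtype.ext (funext fun a => ?_)⟩
    exact congrArg Additive.toMul (evalHom_single t a)

theorem CondB.isFrame (hB : X.CondB) {I : Finset (Fin m)} (hI : I ∈ X.vertices) :
    X.IsFrame I where
  finite := Nat.finite_of_card_ne_zero (by
    rw [hB.card_charKer hI]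
    exact Int.natAbs_ne_zero.2 (hB.det_charMatrix_ne_zero hI))
  surjective y := by
    obtain ⟨u, hu⟩ := hB.exists_dual hI fun i => (Complex.log (y i)).re
    obtain ⟨v, hv⟩ := hB.exists_dual hI fun i => (Complex.log (y i)).im
    refine ⟨fun a => Units.mk0 (Complex.exp (u a + v a * Complex.I)) (Complex.exp_ne_zero _),
      fun i hi => Units.ext ?_⟩
    have hlog : ∑ a, (X.D i a : ℂ) * (u a + v a * Complex.I) = Complex.log (y i) := by
      have h1 := hu i hi
      have h2 := hv i hi
      rw [← Complex.re_add_im (Complex.log (y i)), ← h1, ← h2]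
      simp only [dotProduct, DR]
      push_cast
      rw [Finset.sum_mul, ← Finset.sum_add_distrib]
      exact Finset.sum_congr rfl fun a _ => by ring
    change ((∏ a, _ : ℂˣ) : ℂ) = _
    rw [Units.coe_prod, ← Complex.exp_log (y i).ne_zero, ← hlog, Complex.exp_sum]
    refine Finset.prod_congr rfl fun a _ => ?_
    rw [Units.val_zpow_eq_zpow_val, Units.val_mk0, ← Complex.exp_int_mul]

end ToricData

/-! ### The cohomology of the components of the inertia stack -/

namespace SingChain

/-- An embedding identifies the homology of a space with that of its image. It is the case of the
trivial group in `HIso.of_finite_quotient`. -/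
theorem HIso.of_isEmbedding {X Y : Type} [TopologicalSpace X] [TopologicalSpace Y] (f : C(X, Y))
    (hf : Topology.IsEmbedding f) : HIso f Set.univ (Set.range f) := by
  refine HIso.of_finite_quotient (G := Unit) f (fun x _ => ⟨x, rfl⟩)
    (fun _ => ContinuousMap.id X) (fun _ => Set.mapsTo_univ _ _) (fun _ _ => rfl) (fun _ => rfl)
    ?_ ?_ ?_
  · intro k s hs
    choose l hl using hs
    refine ⟨⟨l, hf.continuous_iff.2 ?_⟩, fun _ => trivial, ?_⟩
    · have : f ∘ l = s := funext hl
      rw [this]; exact s.continuous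
    · ext1 w; exact hl w
  · intro k l l' _ _ h
    refine ⟨(), ?_⟩
    ext1 w
    exact hf.injective (DFunLike.congr_fun h w).symm
  · intro _ k z _
    rw [push_id, sub_self]
    exact zero_mem _

end SingChain

theorem Cardinal.mk_sigma_fin {ι : Type} (n : ι →₀ ℕ) :
    Cardinal.mk (Σ i, Fin (n i)) = ((n.sum fun _ a => a : ℕ) : Cardinal) := by
  let _ : Fintype (Σ i, Fin (n i)) := ⟨n.support.sigma fun _ => Finset.univ, fun x => by
    rw [Finset.mem_sigma, Finsupp.mem_support_iff]
    exact ⟨(Nat.pos_of_ne_zero fun h => by have := x.2.2; omega).ne', Finset.mem_univ _⟩⟩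
  rw [Cardinal.mk_fintype]
  congr 1
  change (n.support.sigma fun _ => Finset.univ).card = _
  rw [Finset.card_sigma]
  simp [Finsupp.sum]

namespace ToricData
open SingChain

variable {m r : ℕ} {X : ToricData m r}

variable (X) in
open scoped Classical in
/-- The indices of the coordinates on which `g` acts trivially. -/
def fixedIndices (g : Fin r → ℂˣ) : Finset (Fin m) :=
  Finset.univ.filter fun i => X.torusHom g i = 1

theorem subset_fixedIndices_iff {g : Fin r → ℂˣ} {I : Finset (Fin m)} :
    I ⊆ X.fixedIndices g ↔ g ∈ X.charKer I := by
  simp [fixedIndices, Finset.subset_iff, charKer]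

theorem act_eq_self_iff {g : Fin r → ℂˣ} {z : Fin m → ℂ} :
    X.act g z = z ↔ csupp z ⊆ X.fixedIndices g := by
  rw [funext_iff]
  refine forall_congr' fun i => ?_
  rw [mem_csupp]
  by_cases hz : z i = 0
  · simp [act, hz]
  · simp [act, fixedIndices, hz]

theorem mem_stableLocus_iff (hB : X.CondB) {z : Fin m → ℂ} :
    z ∈ X.stableLocus ↔ csupp z ∈ X.anticones := by
  have h : ∀ I, z ∈ coordSubspace I ↔ csupp z ⊆ I := by
    intro I
    refine forall_congr' fun i => ?_
    rw [mem_csupp, ← not_imp_not, not_not]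
  simp only [stableLocus, Set.mem_compl_iff, Set.mem_iUnion, not_exists, h]
  constructor
  · intro hz
    by_contra hn
    exact hz _ hn le_rfl
  · intro hz I hI hsub
    exact hI (hB.anticones_mono hz hsub)

variable (X) in
/-- The vertices all of whose coordinates are fixed by `g`. -/
def fixedVertices (g : Fin r → ℂˣ) : Finset (Finset (Fin m)) :=
  X.vertices.filter fun I => I ⊆ X.fixedIndices g

/-- The fixed locus of `g` is covered by the charts of the vertices whose support is fixed by `g`.
-/
theorem mem_fixedLocus_iff (hB : X.CondB) (hC : X.CondC) {g : Fin r → ℂˣ} {z : Fin m → ℂ} :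
    z ∈ X.fixedLocus g ↔ X.orbit z ∈ X.chartUnion (X.fixedIndices g) (X.fixedVertices g) := by
  refine (and_congr (mem_stableLocus_iff hB) act_eq_self_iff).trans ?_
  rw [mem_anticones_iff_exists_vertex hB hC]
  refine and_congr_left fun h => ?_
  simp only [fixedVertices, Finset.mem_filter]
  exact ⟨fun ⟨I, h1, h2⟩ => ⟨I, ⟨h1, h2.trans h⟩, h2⟩, fun ⟨I, h1, h2⟩ => ⟨I, h1.1, h2⟩⟩

theorem nonempty_fixedLocus_iff (hB : X.CondB) (hC : X.CondC) {g : Fin r → ℂˣ} :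
    (X.fixedLocus g).Nonempty ↔ (X.fixedVertices g).Nonempty := by
  constructor
  · rintro ⟨z, hz⟩
    obtain ⟨⟨I, hI, -⟩, -⟩ := (mem_fixedLocus_iff hB hC).1 hz
    exact ⟨I, hI⟩
  · rintro ⟨I, hI⟩
    refine ⟨slice I ∅ 0, (mem_fixedLocus_iff hB hC).2 ⟨⟨I, hI, ?_⟩, ?_⟩⟩ <;>
      rw [qsupp_orbit, csupp_slice, Finset.inter_empty, Finset.union_empty]
    exact (Finset.mem_filter.1 hI).2

variable (X) in
/-- The map from a component of the inertia stack to the space of all orbits. -/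
def inertiaMap (g : X.InertiaIndex) : C(X.inertiaSpace g, X.OrbitSpace) where
  toFun := Quotient.map (sa := X.orbitSetoid g.1) (sb := X.orbits) Subtype.val fun _ _ h => h
  continuous_toFun := Continuous.quotient_map' continuous_subtype_val _

theorem range_inertiaMap (hB : X.CondB) (hC : X.CondC) (g : X.InertiaIndex) :
    Set.range (X.inertiaMap g) = X.chartUnion (X.fixedIndices g.1) (X.fixedVertices g.1) := by
  ext q
  obtain ⟨z, rfl⟩ := X.isOpenQuotientMap_orbit.surjective q
  constructor
  · rintro ⟨⟨w⟩, hw⟩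
    have hw : X.orbit w.1 = X.orbit z := hw
    rw [← hw]
    exact (mem_fixedLocus_iff hB hC).1 w.2
  · intro h
    exact ⟨Quotient.mk _ ⟨z, (mem_fixedLocus_iff hB hC).2 h⟩, rfl⟩

/-- The orbit space of the fixed locus of `g` carries the subspace topology of the space of all
orbits, as the action of the torus is by homeomorphisms. -/
theorem isEmbedding_inertiaMap (hB : X.CondB) (hC : X.CondC) (g : X.InertiaIndex) :
    Topology.IsEmbedding (X.inertiaMap g) := by
  let R := X.chartUnion (X.fixedIndices g.1) (X.fixedVertices g.1)
  have hR : ∀ q, X.inertiaMap g q ∈ R := fun q => (range_inertiaMap hB hC g).le ⟨q, rfl⟩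
  have hcont : Continuous fun q => (⟨X.inertiaMap g q, hR q⟩ : R) :=
    (X.inertiaMap g).continuous.subtype_mk hR
  have hinj : Function.Injective (X.inertiaMap g) := by
    rintro ⟨z⟩ ⟨w⟩ h
    exact Quotient.sound (s := X.orbitSetoid g.1) (orbit_eq_iff.1 h)
  have hopen : IsOpenMap fun q => (⟨X.inertiaMap g q, hR q⟩ : R) := by
    intro U hU
    let V : Set (X.orbit ⁻¹' R) :=
      {z | Quotient.mk (X.orbitSetoid g.1) ⟨z.1, (mem_fixedLocus_iff hB hC).2 z.2⟩ ∈ U}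
    have hV : IsOpen V := by
      refine hU.preimage (f := fun z : X.orbit ⁻¹' R =>
        Quotient.mk (X.orbitSetoid g.1) ⟨z.1, (mem_fixedLocus_iff hB hC).2 z.2⟩) ?_
      exact continuous_quotient_mk'.comp (continuous_subtype_val.subtype_mk _)
    have := X.isOpenQuotientMap_orbit.isOpenMap.restrictPreimage R _ hV
    convert! this using 1
    ext q
    constructor
    · rintro ⟨⟨z⟩, hz, rfl⟩
      exact ⟨⟨z.1, (mem_fixedLocus_iff hB hC).1 z.2⟩, hz, rfl⟩
    · rintro ⟨z, hz, rfl⟩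
      exact ⟨_, hz, rfl⟩
  exact Topology.IsEmbedding.subtypeVal.comp
    (Topology.IsOpenEmbedding.of_continuous_injective_isOpenMap hcont
      (fun x y h => hinj (congrArg Subtype.val h)) hopen).isEmbedding

/-- The dimensions of the even cohomology groups of a component of the inertia stack add up to the
number of its vertices. The vertices are ordered by a generic linear cost, and the set `E` at a
vertex consists of the indices of negative reduced cost. -/
theorem exists_cohomology (hB : X.CondB) (hC : X.CondC) (g : X.InertiaIndex) :
    ∃ n : ℕ →₀ ℕ, (∀ p, Module.rank ℂ (SingCohomology (X.inertiaSpace g) (2 * p)) = n p) ∧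
      (n.sum fun _ a => a) = (X.fixedVertices g.1).card := by
  classical
  obtain ⟨h, hh⟩ := exists_cost X
  have hmem : ∀ I ∈ X.fixedVertices g.1, I ∈ X.vertices ∧ I ⊆ X.fixedIndices g.1 :=
    fun I hI => Finset.mem_filter.1 hI
  obtain ⟨β, hβ, heven, hsum⟩ := X.exists_betti (X.fixedIndices g.1) (X.fixedVertices g.1)
    (fun I => if hI : I ∈ X.vertices then h ⬝ᵥ vertex I hI else 0)
    (fun I hI => ⟨hB.isFrame (hmem I hI).1, (hmem I hI).2⟩)
    (by
      intro I hI I' hI' he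
      simp only [(hmem I hI).1, (hmem I' hI').1, dif_pos] at he
      exact hh I _ I' _ he)
    (by
      intro I hI
      obtain ⟨u, hu⟩ := hB.exists_dual (hmem I hI).1 h
      refine ⟨(X.fixedIndices g.1).filter fun l => h l < X.DR l ⬝ᵥ u, fun l hl => ?_,
        fun K hIK hKJ => ?_⟩
      · obtain ⟨h1, h2⟩ := Finset.mem_filter.1 hl
        exact Finset.mem_sdiff.2 ⟨h1, fun h3 => h2.ne' (hu l h3)⟩
      have hiff : (∃ l ∈ (X.fixedIndices g.1).filter fun l => h l < X.DR l ⬝ᵥ u, l ∈ K) ↔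
          ∃ l ∈ K, h l < X.DR l ⬝ᵥ u :=
        ⟨fun ⟨l, h1, h2⟩ => ⟨l, h2, (Finset.mem_filter.1 h1).2⟩,
          fun ⟨l, h1, h2⟩ => ⟨l, Finset.mem_filter.2 ⟨hKJ h1, h2⟩, h1⟩⟩
      rw [hiff, ← exists_lower_vertex_iff hB hC (hmem I hI).1 hu hIK]
      refine exists_congr fun I' => ?_
      constructor
      · rintro ⟨h1, h2, h3⟩
        simp only [(hmem I hI).1, (hmem I' h1).1, dif_pos] at h2
        exact ⟨(hmem I' h1).1, h2, h3⟩
      · rintro ⟨h1, h2, h3⟩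
        refine ⟨Finset.mem_filter.2 ⟨h1, h3.trans hKJ⟩, ?_, h3⟩
        simpa only [(hmem I hI).1, h1, dif_pos] using h2)
    ((nonempty_fixedLocus_iff hB hC).1 g.2)
  have hrank : ∀ k, Module.rank ℂ (H k (Set.univ : Set (X.inertiaSpace g))) = β k := by
    intro k
    rw [(HIso.of_isEmbedding _ (isEmbedding_inertiaMap hB hC g)).rank_eq k,
      range_inertiaMap hB hC g, hβ]
  have hne : Nonempty (X.inertiaSpace g) := g.2.elim fun z hz => ⟨Quotient.mk _ ⟨z, hz⟩⟩
  have hbij : Set.BijOn (fun p => 2 * p + 1) ((fun p => 2 * p + 1) ⁻¹' (β.support : Set ℕ))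
      (β.support : Set ℕ) := by
    refine ⟨fun p hp => hp, fun p _ q _ h => by simpa using h, fun k hk => ?_⟩
    have hodd : Odd k := by
      rw [← Nat.not_even_iff_odd]
      exact fun h => (Finsupp.mem_support_iff.1 hk) (heven k h)
    obtain ⟨p, rfl⟩ := hodd
    exact ⟨p, hk, rfl⟩
  -- The index `2 p + 1` of reduced homology is the degree `2 p`; in degree zero there is one more
  -- class.
  refine ⟨Finsupp.single 0 1 + β.comapDomain _ hbij.injOn, fun p => ?_, ?_⟩
  · rw [Finsupp.add_apply, Finsupp.comapDomain_apply]
    cases p with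
    | zero =>
      obtain ⟨h1, h2⟩ := finrank_singCohomology_zero (X.inertiaSpace g) (hrank 1)
      rw [Finsupp.single_eq_same]
      exact (Module.finrank_eq_rank ℂ _).symm.trans (congrArg _ h2)
    | succ p =>
      obtain ⟨h1, h2⟩ := finrank_singCohomology_succ (X.inertiaSpace g) (hrank (2 * p + 1 + 2))
      rw [Finsupp.single_eq_of_ne (by simp), zero_add]
      exact (Module.finrank_eq_rank ℂ _).symm.trans (congrArg _ h2)
  · rw [Finsupp.sum_add_index (by simp) (by simp), Finsupp.sum_single_index rfl, add_comm, ← hsum]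
    congr 1
    exact Finsupp.sum_comapDomain _ β (fun _ a => a) hbij

/-- Summing over the components of the inertia stack counts the pairs of a vertex `I` and an element
of its stabilizer. -/
theorem rank_orbCohomology (hB : X.CondB) (hC : X.CondC) :
    Module.rank ℂ X.OrbCohomology =
      ((∑ I : X.vertices, (charMatrix I.2).det.natAbs : ℕ) : Cardinal) := by
  choose n hn hsum using fun g : X.InertiaIndex => exists_cohomology hB hC g
  have h1 : Module.rank ℂ X.OrbCohomology =
      Cardinal.mk (Σ x : X.InertiaIndex × ℕ, Fin (n x.1 x.2)) := by
    have hfree : ∀ x : X.InertiaIndex × ℕ,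
        Module.Free ℂ (SingCohomology (X.inertiaSpace x.1) (2 * x.2)) := fun x =>
      Module.Free.of_divisionRing ℂ _
    rw [rank_directSum, Cardinal.mk_sigma]
    congr 1
    funext x
    rw [hn, Cardinal.mk_fin]
  have h2 : ∀ g : X.InertiaIndex, Nonempty ((Σ p, Fin (n g p)) ≃ X.fixedVertices g.1) := by
    intro g
    rw [← Cardinal.eq, Cardinal.mk_sigma_fin, hsum]
    simp
  let e : (Σ g : X.InertiaIndex, X.fixedVertices g.1) ≃ Σ I : X.vertices, X.charKer I.1 :=
    { toFun := fun x => ⟨⟨x.2.1, (Finset.mem_filter.1 x.2.2).1⟩,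
        ⟨x.1.1, subset_fixedIndices_iff.1 (Finset.mem_filter.1 x.2.2).2⟩⟩
      invFun := fun x =>
        have hx : x.1.1 ∈ X.fixedVertices x.2.1 :=
          Finset.mem_filter.2 ⟨x.1.2, subset_fixedIndices_iff.2 x.2.2⟩
        ⟨⟨x.2.1, (nonempty_fixedLocus_iff hB hC).2 ⟨x.1.1, hx⟩⟩, ⟨x.1.1, hx⟩⟩
      left_inv := fun x => rfl
      right_inv := fun x => rfl }
  have h3 : ∀ I : X.vertices, Finite (X.charKer I.1) := fun I => (hB.isFrame I.2).finite
  rw [h1, Cardinal.mk_congr ((Equiv.sigmaAssocProd.trans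
    (Equiv.sigmaCongrRight fun g => (h2 g).some)).trans e), ← Nat.cast_card, Nat.card_sigma]
  refine congrArg Nat.cast (Finset.sum_congr rfl fun I _ => ?_)
  rw [← hB.card_charKer I.2]

end ToricData

namespace ToricData

variable {m r : ℕ} {X : ToricData m r}

/-! ### The fan -/

variable (X) in
/-- The map `ℝ^m → N ⊗ ℝ`, `c ↦ ∑ c_i b_i`. -/
def combN : (Fin m → ℝ) →ₗ[ℝ] X.NR := Fintype.linearCombination ℝ X.bR

theorem combN_apply (c : Fin m → ℝ) : X.combN c = ∑ i, c i • X.bR i := rfl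

theorem combN_single (i : Fin m) : X.combN (Pi.single i 1) = X.bR i := by simp [combN]

theorem sum_smul_b (y : Fin m → ℤ) :
    ∑ i, y i • X.b i = Submodule.Quotient.mk (p := LinearMap.range X.pairing) y := by
  have h : y = ∑ i, y i • (Pi.single i 1 : Fin m → ℤ) := by
    funext j
    simp [Finset.sum_apply, Pi.single_apply]
  conv_rhs => rw [h, ← Submodule.mkQ_apply, map_sum]
  exact Finset.sum_congr rfl fun i _ => ((LinearMap.range X.pairing).mkQ.map_smul _ _).symm

theorem pairing_apply (l : Fin r → ℤ) (i : Fin m) : X.pairing l i = X.D i ⬝ᵥ l := rfl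

theorem combN_dual (l : Fin r → ℝ) : X.combN (fun i => X.DR i ⬝ᵥ l) = 0 := by
  have h0 : ∀ a, ∑ i, X.D i a • X.b i = 0 := by
    intro a
    rw [sum_smul_b, Submodule.Quotient.mk_eq_zero]
    exact ⟨Pi.single a 1, funext fun i => by rw [pairing_apply]; simp⟩
  have h1 : X.combN (fun i => X.DR i ⬝ᵥ l) = ∑ i, ∑ a, l a ⊗ₜ[ℤ] (X.D i a • X.b i) := by
    rw [combN_apply]
    refine Finset.sum_congr rfl fun i _ => ?_
    rw [dotProduct, Finset.sum_smul]
    refine Finset.sum_congr rfl fun a _ => ?_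
    rw [bR, TensorProduct.smul_tmul', TensorProduct.tmul_smul, TensorProduct.smul_tmul', DR]
    congr 1
    simp
  rw [h1, Finset.sum_comm]
  refine Finset.sum_eq_zero fun a _ => ?_
  rw [← TensorProduct.tmul_sum, h0, TensorProduct.tmul_zero]

variable (X) in
/-- The linear map `ℝ^r → ℝ^m` defined by `D_1, …, D_m`. -/
def dualR : (Fin r → ℝ) →ₗ[ℝ] (Fin m → ℝ) := Matrix.mulVecLin (Matrix.of X.DR)

theorem dualR_apply (l : Fin r → ℝ) (i : Fin m) : X.dualR l i = X.DR i ⬝ᵥ l := rfl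

variable (X) in
/-- The map `N → ℝ^m / 𝕃_ℝ` induced by the inclusion of `ℤ^m` in `ℝ^m`. -/
def toQuotient : X.N →ₗ[ℤ] ((Fin m → ℝ) ⧸ LinearMap.range X.dualR) :=
  (LinearMap.range X.pairing).liftQ
    (((LinearMap.range X.dualR).mkQ.restrictScalars ℤ) ∘ₗ
      LinearMap.compLeft (Int.castAddHom ℝ).toIntLinearMap (Fin m)) (by
    rintro _ ⟨l, rfl⟩
    rw [LinearMap.mem_ker, LinearMap.comp_apply, LinearMap.restrictScalars_apply,
      Submodule.mkQ_apply, Submodule.Quotient.mk_eq_zero]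
    refine ⟨fun a => (l a : ℝ), funext fun i => ?_⟩
    rw [dualR_apply, LinearMap.compLeft_apply, Function.comp_apply, pairing_apply]
    simp [dotProduct, DR])

/-- The kernel of `ℝ^m → N ⊗ ℝ` is the image of `ℝ^r`. -/
theorem combN_eq_zero_iff {c : Fin m → ℝ} :
    X.combN c = 0 ↔ ∃ l : Fin r → ℝ, ∀ i, c i = X.DR i ⬝ᵥ l := by
  constructor
  · intro h
    have key : ∀ c, (X.toQuotient.liftBaseChange ℝ) (X.combN c) =
        (LinearMap.range X.dualR).mkQ c := by
      intro c
      have : (X.toQuotient.liftBaseChange ℝ) ∘ₗ X.combN = (LinearMap.range X.dualR).mkQ := by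
        refine LinearMap.pi_ext' fun i => LinearMap.ext_ring ?_
        change (X.toQuotient.liftBaseChange ℝ) (X.combN (Pi.single i 1)) = _
        rw [combN_single, bR, LinearMap.liftBaseChange_tmul, one_smul]
        change (LinearMap.range X.dualR).mkQ _ = (LinearMap.range X.dualR).mkQ (Pi.single i 1)
        congr 1
        funext j
        by_cases hj : j = i
        · subst hj; simp
        · simp [hj]
      exact LinearMap.congr_fun this c
    have h1 := key c
    rw [h, map_zero, eq_comm, Submodule.mkQ_apply, Submodule.Quotient.mk_eq_zero] at h1
    obtain ⟨l, rfl⟩ := h1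
    exact ⟨l, fun i => rfl⟩
  · rintro ⟨l, hl⟩
    rw [funext hl, combN_dual]

theorem combN_eq_iff {c c' : Fin m → ℝ} :
    X.combN c = X.combN c' ↔ ∃ l : Fin r → ℝ, ∀ i, c i - c' i = X.DR i ⬝ᵥ l := by
  rw [← sub_eq_zero, ← map_sub, combN_eq_zero_iff]
  rfl

theorem combN_surjective : Function.Surjective X.combN := by
  intro x
  induction x using TensorProduct.induction_on with
  | zero => exact ⟨0, map_zero _⟩
  | add x y hx hy =>
    obtain ⟨c, rfl⟩ := hx
    obtain ⟨d, rfl⟩ := hy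
    exact ⟨c + d, map_add _ _ _⟩
  | tmul a n =>
    obtain ⟨y, rfl⟩ := Submodule.Quotient.mk_surjective _ n
    refine ⟨fun i => a * y i, ?_⟩
    rw [combN_apply, ← sum_smul_b, TensorProduct.tmul_sum]
    refine Finset.sum_congr rfl fun i _ => ?_
    rw [bR, TensorProduct.smul_tmul', TensorProduct.tmul_smul, TensorProduct.smul_tmul']
    congr 1
    simp [mul_comm]

/-- A linear function that vanishes on `D_i` for all `i` in an anticone is zero. -/
theorem CondB.eq_zero_of_dotProduct (hB : X.CondB) {I : Finset (Fin m)} (hI : I ∈ X.anticones)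
    {l : Fin r → ℝ} (h : ∀ i ∈ I, X.DR i ⬝ᵥ l = 0) : l = 0 := by
  obtain ⟨a, ha0, ha⟩ := hB.exists_comb hI l
  have : X.comb a ⬝ᵥ l = 0 := by
    rw [X.comb_eq_sum ha0, sum_dotProduct]
    exact Finset.sum_eq_zero fun i hi => by rw [smul_dotProduct, h i hi, smul_zero]
  rw [ha] at this
  exact dotProduct_self_eq_zero.1 this

theorem CondB.combN_injective (hB : X.CondB) {I : Finset (Fin m)} (hI : I ∈ X.anticones)
    {c : Fin m → ℝ} (hc : ∀ i ∈ I, c i = 0) (h : X.combN c = 0) : c = 0 := by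
  obtain ⟨l, hl⟩ := combN_eq_zero_iff.1 h
  have : l = 0 := hB.eq_zero_of_dotProduct hI fun i hi => by rw [← hl, hc i hi]
  funext i
  rw [hl, this, dotProduct_zero]; rfl

theorem CondB.linearIndependent_bR (hB : X.CondB) {I : Finset (Fin m)} (hI : I ∈ X.anticones) :
    LinearIndepOn ℝ X.bR ((Iᶜ : Finset (Fin m)) : Set (Fin m)) := by
  rw [linearIndepOn_finset_iff]
  intro c hc i hi
  have h := hB.combN_injective hI (c := fun i => if i ∈ I then 0 else c i)
    (fun i hi => by simp [hi]) (by
      rw [combN_apply, ← hc]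
      symm
      refine (Finset.sum_congr rfl fun i hi => ?_).trans
        (Finset.sum_subset (Finset.subset_univ Iᶜ) fun i _ hi => ?_)
      · rw [if_neg (Finset.mem_compl.1 hi)]
      · rw [if_pos (by simpa using hi), zero_smul])
  have := congrFun h i
  simpa [Finset.mem_compl.1 hi] using this

theorem mem_cone_iff {I : Finset (Fin m)} {x : X.NR} :
    x ∈ X.cone I ↔ ∃ c : Fin m → ℝ, (∀ i, 0 ≤ c i) ∧ (∀ i ∈ I, c i = 0) ∧ x = X.combN c := by
  have key : ∀ c : Fin m → ℝ, (∀ i ∈ I, c i = 0) → X.combN c = ∑ i ∈ Iᶜ, c i • X.bR i := by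
    intro c hc
    rw [combN_apply]
    refine (Finset.sum_subset (Finset.subset_univ Iᶜ) fun i _ hi => ?_).symm
    rw [hc i (by simpa using hi), zero_smul]
  constructor
  · rintro ⟨c, hc, rfl⟩
    refine ⟨fun i => if i ∈ I then 0 else c i, fun i => ?_, fun i hi => by simp [hi], ?_⟩
    · dsimp only
      split_ifs
      exacts [le_rfl, hc i]
    · rw [key _ fun i hi => by simp [hi]]
      exact Finset.sum_congr rfl fun i hi => by rw [if_neg (Finset.mem_compl.1 hi)]
  · rintro ⟨c, hc, h0, rfl⟩
    exact ⟨c, hc, key c h0⟩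

theorem bR_mem_cone {I : Finset (Fin m)} {i : Fin m} (hi : i ∉ I) : X.bR i ∈ X.cone I := by
  refine mem_cone_iff.2 ⟨Pi.single i 1, fun j => ?_, fun j hj => ?_, (combN_single i).symm⟩
  · by_cases h : j = i <;> simp [h]
  · have : j ≠ i := fun h => hi (h ▸ hj)
    simp [this]

theorem CondB.finrank_span_cone (hB : X.CondB) {I : Finset (Fin m)} (hI : I ∈ X.anticones) :
    Module.finrank ℝ (Submodule.span ℝ (X.cone I)) = m - I.card := by
  have h : Submodule.span ℝ (X.cone I) =
      Submodule.span ℝ (Set.range fun i : ((Iᶜ : Finset (Fin m)) : Set (Fin m)) => X.bR i) := by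
    refine le_antisymm (Submodule.span_le.2 ?_) (Submodule.span_le.2 ?_)
    · rintro _ ⟨c, _, rfl⟩
      exact Submodule.sum_mem _ fun i hi => Submodule.smul_mem _ _
        (Submodule.subset_span ⟨⟨i, hi⟩, rfl⟩)
    · rintro _ ⟨⟨i, hi⟩, rfl⟩
      exact Submodule.subset_span (bR_mem_cone (by simpa using hi))
  rw [h, finrank_span_eq_card (hB.linearIndependent_bR hI)]
  refine (Fintype.card_coe Iᶜ).trans ((Finset.card_compl I).trans ?_)
  rw [Fintype.card_fin]

theorem CondB.card_le (hB : X.CondB) {I : Finset (Fin m)} (hI : I ∈ X.anticones) :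
    r ≤ I.card := by
  have h := finrank_span_finset_le_card (R := ℝ) (I.image X.DR)
  rw [Finset.coe_image, Set.finrank, hB I hI] at h
  simpa using h.trans Finset.card_image_le

/-- The maximal cones are the cones of the minimal anticones. -/
theorem CondB.mem_maxCones_iff (hB : X.CondB) {σ : Set X.NR} :
    σ ∈ X.maxCones ↔ ∃ I ∈ X.vertices, σ = X.cone I := by
  constructor
  · rintro ⟨⟨I, hI, rfl⟩, h⟩
    rw [hB.finrank_span_cone hI] at h
    have h1 := hB.card_le hI
    have h2 : I.card ≤ m := by simpa using Finset.card_le_univ I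
    exact ⟨I, mem_vertices.2 ⟨hI, by omega⟩, rfl⟩
  · rintro ⟨I, hI, rfl⟩
    obtain ⟨h1, h2⟩ := mem_vertices.1 hI
    exact ⟨⟨I, h1, rfl⟩, by rw [hB.finrank_span_cone h1, h2]⟩

theorem eta_dotProduct {I : Finset (Fin m)} (hI : I ∈ X.vertices) (l : Fin r → ℝ) :
    X.η ⬝ᵥ l = ∑ i ∈ I, vertex I hI i * (X.DR i ⬝ᵥ l) := by
  rw [← comb_vertex hI, X.comb_eq_sum (fun i hi => vertex_eq_zero hI hi), sum_dotProduct]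
  exact Finset.sum_congr rfl fun i _ => smul_dotProduct _ _ _

/-- A vector of the stacky fan lies in the maximal cone `σ_I` only if its index is not in `I`.
Otherwise pairing `η`, as a combination of the `D_j` with `j ≠ i` and as one of the `D_j` with `j ∈
I`, with the relation between the vectors gives opposite signs. -/
theorem CondB.gens_cone (hB : X.CondB) {I : Finset (Fin m)} (hI : I ∈ X.vertices) :
    X.gens (X.cone I) = ((Iᶜ : Finset (Fin m)) : Set (Fin m)) := by
  ext i
  rw [Finset.mem_coe, Finset.mem_compl]
  constructor
  · rintro ⟨hray, hi⟩ hiI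
    obtain ⟨c, hc, hc0, he⟩ := mem_cone_iff.1 hi
    rw [← combN_single, combN_eq_iff] at he
    obtain ⟨l, hl⟩ := he
    have hle : ∀ j, j ≠ i → X.DR j ⬝ᵥ l ≤ 0 := by
      intro j hj
      rw [← hl j]
      simpa [hj] using hc j
    have h1 : X.η ⬝ᵥ l ≤ 0 := by
      obtain ⟨a, ha, ha0, hη⟩ := X.mem_anticones_iff.1 hray
      rw [← hη, X.comb_eq_sum ha0, sum_dotProduct]
      refine Finset.sum_nonpos fun j hj => ?_
      rw [smul_dotProduct, smul_eq_mul]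
      exact mul_nonpos_of_nonneg_of_nonpos (ha j hj).le (hle j (Finset.ne_of_mem_erase hj))
    have h2 : X.η ⬝ᵥ l = vertex I hI i := by
      rw [eta_dotProduct hI, Finset.sum_eq_single i]
      · rw [← hl i, hc0 i hiI]; simp
      · intro j hj hji
        rw [← hl j, hc0 j hj]; simp [hji]
      · exact fun h => absurd hiI h
    exact h1.not_gt (h2 ▸ vertex_pos hI hiI)
  · intro hi
    refine ⟨hB.anticones_mono (mem_vertices.1 hI).1 fun j hj => ?_, bR_mem_cone hi⟩
    exact Finset.mem_erase.2 ⟨fun h => hi (h ▸ hj), Finset.mem_univ j⟩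

theorem CondB.linearIndependent_gens (hB : X.CondB) {σ : Set X.NR} (hσ : σ ∈ X.maxCones) :
    LinearIndependent ℝ fun i : X.gens σ => X.bR i := by
  obtain ⟨I, hI, rfl⟩ := hB.mem_maxCones_iff.1 hσ
  rw [hB.gens_cone hI]
  exact hB.linearIndependent_bR (mem_vertices.1 hI).1

theorem CondB.mem_simplex_iff (hB : X.CondB) {I : Finset (Fin m)} (hI : I ∈ X.vertices)
    {x : X.NR} : x ∈ X.simplex (X.cone I) ↔ ∃ c : Fin m → ℝ, (∀ i, 0 ≤ c i) ∧
      (∀ i ∈ I, c i = 0) ∧ ∑ i, c i ≤ 1 ∧ x = X.combN c := by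
  constructor
  · rintro ⟨c, h1, h2, h3, rfl⟩
    refine ⟨c, fun i => (h1 i).1, fun i hi => h2 i ?_, h3, rfl⟩
    rw [hB.gens_cone hI]; simpa using hi
  · rintro ⟨c, h1, h2, h3, rfl⟩
    refine ⟨c, fun i => ⟨h1 i, ?_⟩, fun i hi => h2 i ?_, h3, rfl⟩
    · exact (Finset.single_le_sum (fun j _ => h1 j) (Finset.mem_univ i)).trans h3
    · rw [hB.gens_cone hI] at hi; simpa using hi

/-! ### The subdivision of the polytope -/

theorem Shat_eq : X.Shat = X.combN '' stdSimplex ℝ (Fin m) := by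
  rw [Shat, ← convexHull_rangle_single_eq_stdSimplex, LinearMap.image_convexHull, ← Set.range_comp]
  congr 2
  funext i
  exact (combN_single i).symm

/-- By condition (C), the convex hull of the `D_i` does not contain the origin, and is separated
from it by a linear function. In terms of the `b_i`, the origin is a combination of them with
positive coefficients. -/
theorem CondC.exists_pos_dual (hC : X.CondC) : ∃ l : Fin r → ℝ, ∀ i, 0 < X.DR i ⬝ᵥ l := by
  have hcl : IsClosed (convexHull ℝ (Set.range X.DR)) :=
    ((Set.finite_range X.DR).isCompact_convexHull (𝕜 := ℝ)).isClosed
  have h0 : (0 : Fin r → ℝ) ∉ convexHull ℝ (Set.range X.DR) := by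
    have : convexHull ℝ (Set.range X.DR) = X.comb '' stdSimplex ℝ (Fin m) := by
      rw [← convexHull_rangle_single_eq_stdSimplex, LinearMap.image_convexHull, ← Set.range_comp]
      congr 2
      funext i
      exact (X.comb_single i).symm
    rw [this]
    rintro ⟨c, hc, h⟩
    have := hC c hc.1 h
    have h1 := hc.2
    simp [this] at h1
  obtain ⟨f, u, hu, hf⟩ := geometric_hahn_banach_point_closed (convex_convexHull ℝ _) hcl h0
  rw [map_zero] at hu
  refine ⟨fun a => f (Pi.single a 1), fun i => ?_⟩
  exact (hu.trans (hf _ (subset_convexHull ℝ _ ⟨i, rfl⟩))).trans_eq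
    (dotProduct_single_eq f.toLinearMap (X.DR i)).symm

theorem dotProduct_nonneg_of_mem_closure {I : Finset (Fin m)} {x l : Fin r → ℝ}
    (hx : x ∈ closure (X.posCone I)) (hl : ∀ i ∈ I, 0 ≤ X.DR i ⬝ᵥ l) : 0 ≤ x ⬝ᵥ l := by
  have hcl : IsClosed {x : Fin r → ℝ | 0 ≤ x ⬝ᵥ l} :=
    isClosed_le continuous_const (Continuous.dotProduct continuous_id continuous_const)
  refine closure_minimal ?_ hcl hx
  rintro _ ⟨c, hc, rfl⟩
  change 0 ≤ _ ⬝ᵥ l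
  rw [sum_dotProduct]
  exact Finset.sum_nonneg fun i hi => by
    rw [smul_dotProduct]; exact mul_nonneg (hc i hi).le (hl i hi)

/-- If `c` is a convex combination of the `b_i`, then the reduced costs of `c` at the vertex of
smallest cost are coefficients of the same point of `N ⊗ ℝ` with respect to the generators of one
maximal cone. Their sum is `1 - ρ̂ · l`, which is at most `1` because `ρ̂` is in the closure of the
cone spanned by `D_i`, `i ∈ I`. Conversely, the simplices are contained in `Ŝ` as `0 ∈ Ŝ`. -/
theorem Shat_eq_iUnion_vertices (hm : 0 < m) (hA : X.CondA) (hB : X.CondB) (hC : X.CondC)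
    (hρ : X.rhoHat ∈ closure X.extKahlerCone) :
    X.Shat = ⋃ I ∈ X.vertices, X.simplex (X.cone I) := by
  rw [Shat_eq]
  refine Set.Subset.antisymm ?_ ?_
  · rintro _ ⟨c, hc, rfl⟩
    have hne : X.vertices.attach.Nonempty := by
      obtain ⟨I, hI, -⟩ := exists_vertex_subset hB hC hA
      exact ⟨⟨I, hI⟩, Finset.mem_attach _ _⟩
    -- The vertex of smallest cost `c` gives the maximal cone which contains the point.
    obtain ⟨⟨I, hI⟩, -, hmin⟩ := Finset.exists_min_image _
      (fun I : X.vertices => c ⬝ᵥ vertex I.1 I.2) hne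
    obtain ⟨l, hl⟩ := hB.exists_dual hI c
    have hred : ∀ i, 0 ≤ c i - X.DR i ⬝ᵥ l := by
      intro i
      by_contra hlt
      obtain ⟨I', hI', h1, -⟩ := (exists_lower_vertex_iff hB hC hI hl
        (Finset.subset_univ I)).2 ⟨i, Finset.mem_univ i, sub_neg.1 (not_le.1 hlt)⟩
      exact (hmin ⟨I', hI'⟩ (Finset.mem_attach _ _)).not_gt h1
    have hρl : 0 ≤ X.rhoHat ⬝ᵥ l := by
      refine dotProduct_nonneg_of_mem_closure (closure_mono ?_ hρ)
        fun i hi => (hl i hi).symm ▸ hc.1 i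
      exact Set.biInter_subset_of_mem (mem_vertices.1 hI).1
    refine Set.mem_biUnion hI ((hB.mem_simplex_iff hI).2
      ⟨fun i => c i - X.DR i ⬝ᵥ l, hred, fun i hi => sub_eq_zero.2 (hl i hi).symm, ?_, ?_⟩)
    · rw [Finset.sum_sub_distrib, hc.2, ← sum_dotProduct]
      exact sub_le_self _ hρl
    · exact combN_eq_iff.2 ⟨l, fun i => sub_sub_cancel _ _⟩
  · refine Set.iUnion₂_subset fun I hI => ?_
    intro x hx
    obtain ⟨c, h1, -, h3, rfl⟩ := (hB.mem_simplex_iff hI).1 hx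
    obtain ⟨l, hl⟩ := hC.exists_pos_dual
    have : Nonempty (Fin m) := ⟨⟨0, hm⟩⟩
    -- A multiple of a positive relation raises the sum of the coefficients to `1`.
    set s := ∑ i, X.DR i ⬝ᵥ l with hs
    have hs0 : 0 < s := Finset.sum_pos (fun i _ => hl i) Finset.univ_nonempty
    set t := (1 - ∑ i, c i) / s with ht
    have ht0 : 0 ≤ t := div_nonneg (sub_nonneg.2 h3) hs0.le
    refine ⟨fun i => c i + t * (X.DR i ⬝ᵥ l), ⟨fun i => ?_, ?_⟩, ?_⟩
    · exact add_nonneg (h1 i) (mul_nonneg ht0 (hl i).le)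
    · rw [Finset.sum_add_distrib, ← Finset.mul_sum, ← hs, ht, div_mul_cancel₀ _ hs0.ne']
      ring
    · refine combN_eq_iff.2 ⟨t • l, fun i => ?_⟩
      rw [dotProduct_smul, smul_eq_mul, add_sub_cancel_left]

end ToricData

/-! ### The volume of a simplex -/

section Volume
open MeasureTheory

/-- The simplex `{c ≥ 0, ∑ c_i ≤ t}`. -/
def cornerSimplex (n : ℕ) (t : ℝ) : Set (Fin n → ℝ) := {c | (∀ i, 0 ≤ c i) ∧ ∑ i, c i ≤ t}

theorem isClosed_cornerSimplex (n : ℕ) (t : ℝ) : IsClosed (cornerSimplex n t) := by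
  have : cornerSimplex n t = (⋂ i, {c | 0 ≤ c i}) ∩ {c | ∑ i, c i ≤ t} := by
    ext; simp [cornerSimplex]
  rw [this]
  exact (isClosed_iInter fun i => isClosed_le continuous_const (continuous_apply i)).inter
    (isClosed_le (by fun_prop) continuous_const)

theorem isCompact_cornerSimplex (n : ℕ) (t : ℝ) : IsCompact (cornerSimplex n t) := by
  have hbox : IsCompact (Set.univ.pi fun _ : Fin n => Set.Icc (0 : ℝ) t) :=
    isCompact_univ_pi fun _ => isCompact_Icc
  refine hbox.of_isClosed_subset (isClosed_cornerSimplex n t) fun c hc i _ => ⟨hc.1 i, ?_⟩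
  exact (Finset.single_le_sum (fun j _ => hc.1 j) (Finset.mem_univ i)).trans hc.2

theorem volume_cornerSimplex (n : ℕ) {t : ℝ} (ht : 0 ≤ t) :
    volume (cornerSimplex n t) = ENNReal.ofReal (t ^ n / n !) := by
  induction n generalizing t with
  | zero =>
    have : cornerSimplex 0 t = Set.univ := by ext; simp [cornerSimplex, ht]
    rw [this, MeasureTheory.volume_pi, MeasureTheory.Measure.pi_univ]
    simp
  | succ n ih =>
    -- The section at the first coordinate `x` is a simplex of one dimension less and of size `t -
    -- x`.
    let S : Set (ℝ × (Fin n → ℝ)) := {p | 0 ≤ p.1 ∧ p.2 ∈ cornerSimplex n (t - p.1)}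
    have hS : IsClosed S := by
      have : S = {p | 0 ≤ p.1} ∩ ((⋂ i, {p | 0 ≤ p.2 i}) ∩ {p | ∑ i, p.2 i ≤ t - p.1}) := by
        ext; simp [S, cornerSimplex]
      rw [this]
      exact (isClosed_le continuous_const continuous_fst).inter
        ((isClosed_iInter fun i => isClosed_le continuous_const (by fun_prop)).inter
          (isClosed_le (by fun_prop) (by fun_prop)))
    have hpre : cornerSimplex (n + 1) t =
        MeasurableEquiv.piFinSuccAbove (fun _ : Fin (n + 1) => ℝ) 0 ⁻¹' S := by
      ext c
      change ((∀ i, 0 ≤ c i) ∧ ∑ i, c i ≤ t) ↔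
        0 ≤ c 0 ∧ (∀ i : Fin n, 0 ≤ c i.succ) ∧ ∑ i : Fin n, c i.succ ≤ t - c 0
      rw [Fin.forall_fin_succ, Fin.sum_univ_succ, and_assoc, le_sub_iff_add_le']
    rw [hpre, (volume_preserving_piFinSuccAbove (fun _ : Fin (n + 1) => ℝ) 0).measure_preimage
      hS.measurableSet.nullMeasurableSet, Measure.volume_eq_prod,
      Measure.prod_apply hS.measurableSet]
    have hsec : ∀ x : ℝ, volume (Prod.mk x ⁻¹' S) =
        (Set.Icc 0 t).indicator (fun x => ENNReal.ofReal ((t - x) ^ n / n !)) x := by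
      intro x
      by_cases hx : x ∈ Set.Icc 0 t
      · rw [Set.indicator_of_mem hx, ← ih (sub_nonneg.2 hx.2)]
        congr 1
        ext c
        exact and_iff_right hx.1
      · rw [Set.indicator_of_notMem hx]
        have : Prod.mk x ⁻¹' S = ∅ := by
          refine Set.eq_empty_of_forall_notMem fun c hc => hx ⟨hc.1, ?_⟩
          exact sub_nonneg.1 ((Finset.sum_nonneg fun i _ => hc.2.1 i).trans hc.2.2)
        rw [this, measure_empty]
    simp only [hsec]
    rw [lintegral_indicator measurableSet_Icc, ← ofReal_integral_eq_lintegral_ofReal]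
    · congr 1
      rw [integral_Icc_eq_integral_Ioc, ← intervalIntegral.integral_of_le ht,
        intervalIntegral.integral_comp_sub_left (fun x => x ^ n / (n ! : ℝ)),
        intervalIntegral.integral_div, integral_pow, Nat.factorial_succ]
      push_cast
      rw [sub_self, sub_zero, zero_pow (Nat.succ_ne_zero n), sub_zero, div_div]
    · exact (Continuous.integrableOn_Icc (by fun_prop))
    · refine (ae_restrict_iff' measurableSet_Icc).2 (Filter.Eventually.of_forall fun x hx => ?_)
      have := sub_nonneg.2 hx.2
      positivity

end Volume

namespace ToricData

variable {m r : ℕ} {X : ToricData m r}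

/-! ### Lattice indices -/

section
variable {I : Finset (Fin m)} (hI : I ∈ X.vertices)

/-- An enumeration of the complement of a minimal anticone. -/
def enumCompl : Fin (m - r) ≃ (Iᶜ : Finset (Fin m)) :=
  (Finset.equivFinOfCardEq (by
    rw [Finset.card_compl, Fintype.card_fin, (mem_vertices.1 hI).2])).symm

/-- A vector indexed by the complement of `I`, extended by zero. -/
def extend {R : Type} [Zero R] (c : Fin (m - r) → R) (i : Fin m) : R :=
  if h : i ∈ Iᶜ then c ((enumCompl hI).symm ⟨i, h⟩) else 0

theorem extend_eq_zero {R : Type} [Zero R] (c : Fin (m - r) → R) {i : Fin m} (hi : i ∈ I) :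
    extend hI c i = 0 := dif_neg (by simpa using hi)

theorem extend_enumCompl {R : Type} [Zero R] (c : Fin (m - r) → R) (j : Fin (m - r)) :
    extend hI c (enumCompl hI j) = c j := by
  rw [extend, dif_pos (enumCompl hI j).2]
  simp

theorem extend_restrict {R : Type} [Zero R] {c : Fin m → R} (hc : ∀ i ∈ I, c i = 0) :
    extend hI (fun j => c (enumCompl hI j)) = c := by
  funext i
  by_cases hi : i ∈ Iᶜ
  · rw [extend, dif_pos hi]; simp
  · rw [extend, dif_neg hi, hc i (by simpa using hi)]

theorem sum_extend {R M : Type} [Semiring R] [AddCommMonoid M] [Module R M]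
    (c : Fin (m - r) → R) (v : Fin m → M) :
    ∑ i, extend hI c i • v i = ∑ j, c j • v (enumCompl hI j) := by
  have h1 : ∑ i, extend hI c i • v i = ∑ i ∈ Iᶜ, extend hI c i • v i :=
    (Finset.sum_subset (Finset.subset_univ _) fun i _ hi => by
      rw [extend_eq_zero hI c (by simpa using hi), zero_smul]).symm
  rw [h1, ← Finset.sum_coe_sort Iᶜ, ← (enumCompl hI).sum_comp]
  exact Finset.sum_congr rfl fun j _ => by rw [extend_enumCompl]

theorem sum_extend_eq {R : Type} [Semiring R] (c : Fin (m - r) → R) :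
    ∑ i, extend hI c i = ∑ j, c j := by
  simpa using sum_extend hI c fun _ => (1 : R)

variable (e : Module.Basis (Fin (m - r)) ℤ X.Nfree)

/-- The coordinates of the vectors `b_i`, `i ∉ I`. -/
def coordMatrix : Matrix (Fin (m - r)) (Fin (m - r)) ℤ :=
  Matrix.of fun k j => e.coord k (X.Ntor.mkQ (X.b (enumCompl hI j)))

theorem equivFun_mk_extend (c : Fin (m - r) → ℤ) :
    e.equivFun (X.Ntor.mkQ (Submodule.Quotient.mk (extend hI c))) =
      (coordMatrix hI e).mulVec c := by
  rw [← sum_smul_b, sum_extend hI c X.b]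
  funext k
  rw [map_sum, map_sum, Finset.sum_apply, Matrix.mulVec, dotProduct]
  refine Finset.sum_congr rfl fun j _ => ?_
  rw [map_smul, map_smul, Pi.smul_apply, smul_eq_mul, mul_comm]
  rfl

/-- An element of `ℤ^m` which vanishes on an anticone represents a torsion element of `N` only if it
is zero. -/
theorem CondB.eq_zero_of_mk_mem_torsion (hB : X.CondB) {I : Finset (Fin m)}
    (hI : I ∈ X.vertices) {y : Fin m → ℤ} (hy : ∀ i ∈ I, y i = 0)
    (h : (Submodule.Quotient.mk y : X.N) ∈ X.Ntor) : y = 0 := by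
  obtain ⟨⟨a, ha⟩, hay⟩ := h
  have hay : (Submodule.Quotient.mk (a • y) : X.N) = 0 := hay
  rw [Submodule.Quotient.mk_eq_zero] at hay
  obtain ⟨l, hl⟩ := hay
  have ha0 : a ≠ 0 := nonZeroDivisors.ne_zero ha
  have hl0 : (fun b => (l b : ℝ)) = 0 := by
    refine hB.eq_zero_of_dotProduct (mem_vertices.1 hI).1 fun i hi => ?_
    have : X.D i ⬝ᵥ l = 0 := by
      rw [← pairing_apply, hl, Pi.smul_apply, hy i hi, smul_zero]
    have := congrArg (Int.cast : ℤ → ℝ) this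
    simpa [dotProduct, DR] using this
  have hl1 : l = 0 := by
    funext b
    exact Int.cast_injective (α := ℝ) ((congrFun hl0 b).trans Int.cast_zero.symm)
  rw [hl1, map_zero] at hl
  exact (smul_eq_zero.1 hl.symm).resolve_left ha0

theorem CondB.det_coordMatrix_ne_zero (hB : X.CondB) : (coordMatrix hI e).det ≠ 0 := by
  intro h0
  obtain ⟨c, hc, h⟩ := Matrix.exists_mulVec_eq_zero_iff.2 h0
  rw [← equivFun_mk_extend, LinearEquiv.map_eq_zero_iff, Submodule.mkQ_apply,
    Submodule.Quotient.mk_eq_zero] at h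
  have := hB.eq_zero_of_mk_mem_torsion hI (fun i hi => extend_eq_zero hI c hi) h
  exact hc (funext fun j => (extend_enumCompl hI c j).symm.trans (congrFun this _))

theorem _root_.Matrix.index_range_mulVecLin {ι : Type*} [Fintype ι] [DecidableEq ι]
    (M : Matrix ι ι ℤ) (hM : M.det ≠ 0) :
    (LinearMap.range M.mulVecLin).toAddSubgroup.index = M.det.natAbs :=
  M.card_quotient_range_mulVecLin hM

/-- The vectors `b_i`, `i ∉ I`, generate a subgroup `L` of `N` whose index is the order of the
stabilizer of the vertex `I`. As `L` is torsion-free, its index is the product of the order of the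
torsion and the index of its image in the free part. -/
theorem CondB.card_torsion_mul (hB : X.CondB) :
    Nat.card X.Ntor * (coordMatrix hI e).det.natAbs = (charMatrix hI).det.natAbs := by
  let K : AddSubgroup (Fin m → ℤ) :=
    { carrier := {x | ∀ i ∈ I, x i = 0}
      zero_mem' := fun i _ => rfl
      add_mem' := fun {x y} hx hy i hi => by rw [Pi.add_apply, hx i hi, hy i hi, add_zero]
      neg_mem' := fun {x} hx i hi => by rw [Pi.neg_apply, hx i hi, neg_zero] }
  let π : (Fin m → ℤ) →+ X.N := (LinearMap.range X.pairing).mkQ.toAddMonoidHom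
  have hπ : Function.Surjective π := Submodule.Quotient.mk_surjective _
  let τ : X.N →+ X.Nfree := X.Ntor.mkQ.toAddMonoidHom
  have hτ : Function.Surjective τ := Submodule.Quotient.mk_surjective _
  have hτk : τ.ker = X.Ntor.toAddSubgroup := by
    ext x
    exact Submodule.Quotient.mk_eq_zero X.Ntor
  let L : AddSubgroup X.N := K.map π
  -- The index of `L` is the index of the image of `𝕃` in `ℤ^I`.
  have h1 : L.index = (charMatrix hI).det.natAbs := by
    let ρ : (Fin m → ℤ) →+ (Fin r → ℤ) :=
      { toFun := fun x j => x (enum hI j)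
        map_zero' := rfl
        map_add' := fun _ _ => rfl }
    have hρ : Function.Surjective ρ := by
      intro x
      refine ⟨fun i => if h : i ∈ I then x ((enum hI).symm ⟨i, h⟩) else 0, funext fun j => ?_⟩
      change (if h : (enum hI j).1 ∈ I then x ((enum hI).symm ⟨(enum hI j).1, h⟩) else 0) = x j
      rw [dif_pos (enum hI j).2]
      simp
    have hc : L.comap π = (LinearMap.range (charMatrix hI).mulVecLin).toAddSubgroup.comap ρ := by
      ext x
      constructor
      · rintro ⟨y, hy, hxy⟩
        obtain ⟨l, hl⟩ := (Submodule.Quotient.eq (LinearMap.range X.pairing)).1 hxy.symm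
        refine ⟨l, funext fun j => ?_⟩
        have := congrFun hl (enum hI j)
        rw [Pi.sub_apply, hy _ (enum hI j).2, sub_zero] at this
        exact this
      · rintro ⟨l, hl⟩
        refine ⟨x - X.pairing l, fun i hi => ?_, ?_⟩
        · have := congrFun hl ((enum hI).symm ⟨i, hi⟩)
          change X.D _ ⬝ᵥ l = x _ at this
          rw [Equiv.apply_symm_apply] at this
          rw [Pi.sub_apply, pairing_apply, this, sub_self]
        · refine (Submodule.Quotient.eq (LinearMap.range X.pairing)).2 ⟨-l, ?_⟩
          rw [map_neg]; abel
    rw [← L.index_comap_of_surjective hπ, hc, AddSubgroup.index_comap_of_surjective _ hρ]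
    exact Matrix.index_range_mulVecLin _ (hB.det_charMatrix_ne_zero hI)
  have hinf : L ⊓ τ.ker = ⊥ := by
    rw [hτk, eq_bot_iff]
    rintro _ ⟨⟨y, hy, rfl⟩, ht⟩
    have := hB.eq_zero_of_mk_mem_torsion hI hy ht
    rw [this]; exact map_zero π
  have h2 : L.relIndex (L ⊔ τ.ker) = Nat.card X.Ntor := by
    rw [AddSubgroup.relIndex_sup_left, ← AddSubgroup.inf_relIndex_right, hinf,
      AddSubgroup.relIndex_bot_left, hτk]
    rfl
  have h3 : (L ⊔ τ.ker).index = (coordMatrix hI e).det.natAbs := by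
    rw [← AddSubgroup.comap_map_eq, AddSubgroup.index_comap_of_surjective _ hτ,
      ← Matrix.index_range_mulVecLin _ (hB.det_coordMatrix_ne_zero hI e),
      ← AddSubgroup.index_map_equiv _ e.equivFun.toAddEquiv]
    congr 1
    ext x
    constructor
    · rintro ⟨_, ⟨_, ⟨y, hy, rfl⟩, rfl⟩, rfl⟩
      refine ⟨fun j => y (enumCompl hI j), ?_⟩
      rw [Matrix.mulVecLin_apply, ← equivFun_mk_extend, extend_restrict hI hy]
      rfl
    · rintro ⟨c, rfl⟩
      rw [Matrix.mulVecLin_apply, ← equivFun_mk_extend]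
      exact ⟨_, ⟨_, ⟨extend hI c, fun i hi => extend_eq_zero hI c hi, rfl⟩, rfl⟩, rfl⟩
  rw [← h1, ← h2, ← h3]
  exact AddSubgroup.relIndex_mul_index le_sup_left

/-! ### The volume of the polytope -/

/-- The linear map with the values `coords e (bR i)`, `i ∉ I`, on the standard basis vectors. -/
def coordLin : (Fin (m - r) → ℝ) →ₗ[ℝ] (Fin (m - r) → ℝ) :=
  Matrix.toLin' ((coordMatrix hI e).map (Int.cast : ℤ → ℝ))

theorem coords_combN_extend (c : Fin (m - r) → ℝ) :
    X.coords e (X.combN (extend hI c)) = coordLin hI e c := by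
  rw [combN_apply, sum_extend hI c X.bR, map_sum]
  funext k
  rw [coordLin, Matrix.toLin'_apply, Finset.sum_apply, Matrix.mulVec, dotProduct]
  refine Finset.sum_congr rfl fun j _ => ?_
  rw [map_smul, Pi.smul_apply, smul_eq_mul, mul_comm, bR, coords, LinearMap.liftBaseChange_tmul,
    one_smul]
  rfl

theorem abs_det_coordLin : |LinearMap.det (coordLin hI e)| = (coordMatrix hI e).det.natAbs := by
  have : ((coordMatrix hI e).map (Int.cast : ℤ → ℝ)).det = ((coordMatrix hI e).det : ℝ) :=
    ((Int.castRingHom ℝ).map_det _).symm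
  rw [coordLin, LinearMap.det_toLin', this, Nat.cast_natAbs, Int.cast_abs]

theorem CondB.coordLin_injective (hB : X.CondB) : Function.Injective (coordLin hI e) := by
  have h : LinearMap.det (coordLin hI e) ≠ 0 := by
    rw [← abs_ne_zero, abs_det_coordLin]
    exact_mod_cast Int.natAbs_ne_zero.2 (hB.det_coordMatrix_ne_zero hI e)
  exact LinearMap.ker_eq_bot.1 (by
    by_contra hk
    exact h (LinearMap.det_eq_zero_iff_ker_ne_bot.2 hk))

theorem CondB.coords_simplex (hB : X.CondB) :
    X.coords e '' X.simplex (X.cone I) = coordLin hI e '' cornerSimplex (m - r) 1 := by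
  ext x
  constructor
  · rintro ⟨_, hy, rfl⟩
    obtain ⟨c, h1, h2, h3, rfl⟩ := (hB.mem_simplex_iff hI).1 hy
    refine ⟨fun j => c (enumCompl hI j), ⟨fun j => h1 _, ?_⟩, ?_⟩
    · rwa [← sum_extend_eq hI, extend_restrict hI h2]
    · rw [← coords_combN_extend, extend_restrict hI h2]
  · rintro ⟨c, ⟨h1, h2⟩, rfl⟩
    refine ⟨_, (hB.mem_simplex_iff hI).2 ⟨extend hI c, fun i => ?_,
      fun i hi => extend_eq_zero hI c hi, by rwa [sum_extend_eq], rfl⟩, coords_combN_extend hI e c⟩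
    rw [extend]
    split_ifs
    exacts [h1 _, le_rfl]

theorem CondB.volume_coords_simplex (hB : X.CondB) :
    MeasureTheory.volume (X.coords e '' X.simplex (X.cone I)) =
      ENNReal.ofReal ((coordMatrix hI e).det.natAbs / (m - r)!) := by
  rw [hB.coords_simplex hI e, MeasureTheory.Measure.addHaar_image_linearMap,
    volume_cornerSimplex _ zero_le_one, abs_det_coordLin, ← ENNReal.ofReal_mul (Nat.cast_nonneg _),
    one_pow, mul_one_div]

theorem CondB.coords_injective (hB : X.CondB) {I : Finset (Fin m)} (hI : I ∈ X.vertices)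
    (e : Module.Basis (Fin (m - r)) ℤ X.Nfree) : Function.Injective (X.coords e) := by
  rw [← LinearMap.ker_eq_bot, LinearMap.ker_eq_bot']
  intro x hx
  obtain ⟨c, rfl⟩ := combN_surjective x
  obtain ⟨l, hl⟩ := hB.exists_dual hI c
  have h : X.combN c = X.combN fun i => c i - X.DR i ⬝ᵥ l :=
    combN_eq_iff.2 ⟨l, fun i => sub_sub_cancel _ _⟩
  have h0 : ∀ i ∈ I, (fun i => c i - X.DR i ⬝ᵥ l) i = 0 := fun i hi => sub_eq_zero.2 (hl i hi).symm
  rw [h, ← extend_restrict hI h0, coords_combN_extend] at hx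
  rw [h, ← extend_restrict hI h0, (map_eq_zero_iff _ (hB.coordLin_injective hI e)).1 hx]
  have : extend hI (0 : Fin (m - r) → ℝ) = 0 := by
    funext i
    rw [extend]; split_ifs <;> rfl
  rw [this, map_zero]

end

/-- A point of two maximal cones `σ_I` and `σ_I'` lies in the common face of `σ_I` on which the
coordinates in `I'` vanish. -/
theorem cone_inter_cone {I I' : Finset (Fin m)} (hI : I ∈ X.vertices) (hI' : I' ∈ X.vertices)
    {c c' : Fin m → ℝ} (hc : ∀ i, 0 ≤ c i) (hcI : ∀ i ∈ I, c i = 0) (hc' : ∀ i, 0 ≤ c' i)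
    (hcI' : ∀ i ∈ I', c' i = 0) (h : X.combN c = X.combN c') : ∀ i ∈ I', c i = 0 := by
  obtain ⟨l, hl⟩ := combN_eq_iff.1 h
  have h1 : X.η ⬝ᵥ l ≤ 0 := by
    rw [eta_dotProduct hI]
    refine Finset.sum_nonpos fun i hi => mul_nonpos_of_nonneg_of_nonpos (vertex_nonneg hI i) ?_
    rw [← hl i, hcI i hi, zero_sub]
    exact neg_nonpos.2 (hc' i)
  have h2 : ∀ i ∈ I', 0 ≤ vertex I' hI' i * (X.DR i ⬝ᵥ l) := by
    intro i hi
    rw [← hl i, hcI' i hi, sub_zero]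
    exact mul_nonneg (vertex_nonneg hI' i) (hc i)
  rw [eta_dotProduct hI'] at h1
  intro i hi
  have h3 := (Finset.sum_eq_zero_iff_of_nonneg h2).1 (le_antisymm h1 (Finset.sum_nonneg h2)) i hi
  rw [← hl i, hcI' i hi, sub_zero] at h3
  exact (mul_eq_zero.1 h3).resolve_left (vertex_pos hI' hi).ne'

/-- Two different simplices meet in the image of a proper linear subspace. -/
theorem CondB.aedisjoint_simplex (hB : X.CondB) {I I' : Finset (Fin m)} (hI : I ∈ X.vertices)
    (hI' : I' ∈ X.vertices) (hne : I ≠ I') (e : Module.Basis (Fin (m - r)) ℤ X.Nfree) :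
    MeasureTheory.AEDisjoint MeasureTheory.volume (X.coords e '' X.simplex (X.cone I))
      (X.coords e '' X.simplex (X.cone I')) := by
  obtain ⟨i, hi, hiI⟩ : ∃ i ∈ I', i ∉ I := by
    by_contra! h
    exact hne (Finset.eq_of_subset_of_card_le h
      ((mem_vertices.1 hI).2.trans (mem_vertices.1 hI').2.symm).le).symm
  let j : Fin (m - r) := (enumCompl hI).symm ⟨i, by simpa using hiI⟩
  have hj : (enumCompl hI j).1 = i := by simp [j]
  let W : Submodule ℝ (Fin (m - r) → ℝ) := LinearMap.ker (LinearMap.proj j)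
  have hW : W ≠ ⊤ := by
    intro h
    have : (Pi.single j 1 : Fin (m - r) → ℝ) ∈ W := by rw [h]; trivial
    have : (Pi.single j 1 : Fin (m - r) → ℝ) j = 0 := this
    simp at this
  refine MeasureTheory.measure_mono_null (t := coordLin hI e '' W) ?_ (by
    rw [MeasureTheory.Measure.addHaar_image_linearMap,
      MeasureTheory.Measure.addHaar_submodule _ _ hW, mul_zero])
  rintro _ ⟨⟨x, hx, rfl⟩, ⟨x', hx', hxx'⟩⟩
  obtain rfl := hB.coords_injective hI e hxx'
  obtain ⟨c, h1, h2, -, rfl⟩ := (hB.mem_simplex_iff hI).1 hx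
  obtain ⟨c', h1', h2', -, h⟩ := (hB.mem_simplex_iff hI').1 hx'
  refine ⟨fun j => c (enumCompl hI j), ?_, ?_⟩
  · change c (enumCompl hI j) = 0
    rw [hj]
    exact cone_inter_cone hI hI' h1 h2 h1' h2' h i hi
  · rw [← coords_combN_extend, extend_restrict hI h2]

theorem volume_Shat (hm : 0 < m) (hA : X.CondA) (hB : X.CondB) (hC : X.CondC)
    (hρ : X.rhoHat ∈ closure X.extKahlerCone) (e : Module.Basis (Fin (m - r)) ℤ X.Nfree) :
    (Nat.card X.Ntor : ℝ≥0∞) * ((m - r)! : ℕ) * X.vol e X.Shat =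
      ((∑ I : X.vertices, (charMatrix I.2).det.natAbs : ℕ) : ℝ≥0∞) := by
  have h1 : X.vol e X.Shat =
      ∑ I : X.vertices, ENNReal.ofReal ((coordMatrix I.2 e).det.natAbs / (m - r)!) := by
    rw [vol, Shat_eq_iUnion_vertices hm hA hB hC hρ, Set.image_iUnion₂,
      MeasureTheory.measure_biUnion_finset₀, ← Finset.sum_coe_sort]
    · exact Finset.sum_congr rfl fun I _ => hB.volume_coords_simplex I.2 e
    · exact fun I hI I' hI' hne => hB.aedisjoint_simplex hI hI' hne e
    · intro I hI
      rw [hB.coords_simplex hI e]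
      exact ((isCompact_cornerSimplex _ _).image
        (coordLin hI e).continuous_of_finiteDimensional).isClosed.measurableSet.nullMeasurableSet
  rw [h1, Finset.mul_sum, Nat.cast_sum]
  refine Finset.sum_congr rfl fun I _ => ?_
  rw [← hB.card_torsion_mul I.2 e, Nat.cast_mul, mul_assoc]
  congr 1
  rw [← ENNReal.ofReal_natCast ((m - r)!), ← ENNReal.ofReal_mul (Nat.cast_nonneg _),
    mul_div_cancel₀ _ (Nat.cast_ne_zero.2 (Nat.factorial_ne_zero _)), ENNReal.ofReal_natCast]

end ToricData

end

theorem lemma3p6 {m r : ℕ} (hm : 0 < m) (X : ToricData m r)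
    (hA : X.CondA) (hB : X.CondB) (hC : X.CondC)
    (hρ : X.rhoHat ∈ closure X.extKahlerCone) :
    (∀ σ ∈ X.maxCones, LinearIndependent ℝ (fun i : X.gens σ => X.bR i)) ∧
    X.Shat = ⋃ σ ∈ X.maxCones, X.simplex σ ∧
    Module.Finite ℂ X.OrbCohomology ∧
    ∀ e : Module.Basis (Fin (m - r)) ℤ X.Nfree,
      (Nat.card X.Ntor : ℝ≥0∞) * ((m - r)! : ℕ) * X.vol e X.Shat =
        (Module.finrank ℂ X.OrbCohomology : ℝ≥0∞) := by
  have hrank := ToricData.rank_orbCohomology hB hC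
  refine ⟨fun σ hσ => hB.linearIndependent_gens hσ, ?_, ?_, fun e => ?_⟩
  · rw [ToricData.Shat_eq_iUnion_vertices hm hA hB hC hρ]
    ext x
    simp only [Set.mem_iUnion, hB.mem_maxCones_iff]
    constructor
    · rintro ⟨I, hI, hx⟩
      exact ⟨_, ⟨I, hI, rfl⟩, hx⟩
    · rintro ⟨_, ⟨I, hI, rfl⟩, hx⟩
      exact ⟨I, hI, hx⟩
  · have hfree (p : X.InertiaIndex × ℕ) :
        Module.Free ℂ (SingCohomology (X.inertiaSpace p.1) (2 * p.2)) :=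
      Module.Free.of_divisionRing ℂ _
    have : Module.Free ℂ X.OrbCohomology := inferInstance
    rw [← Module.rank_lt_aleph0_iff, hrank]
    exact Cardinal.natCast_lt_aleph0
  · rw [ToricData.volume_Shat hm hA hB hC hρ e, Module.finrank_eq_of_rank_eq hrank]
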